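/- **Setting.** Let $t=(t_0;t_1,t_2,\dots)$ be complex times, $x=t_1$, $y=t_2$, and $\zeta(\lambda,t)=t_0\ln\lambda+\sum_{k\ge1}\lambda^kt_k$. Let $\tau$ be a tau function of the KP hierarchy on a domain $U$ of times (open in each finite set of the times $t_1,t_2,\dots$): $\tau$ has no zeros on $U$, is holomorphic in any finite number of the times $t_1,t_2,\dots$, and its formal Baker–Akhiezer functions $$\varphi(\lambda,t)=e^{\zeta(\lambda,t)}\,\frac{\tau(t_0;t_k-\frac1{k\lambda^k})}{\tau(t)},\qquad \varphi^*(\lambda,t)=e^{-\zeta(\lambda,t)}\,\frac{\tau(t_0;t_k+\frac1{k\lambda^k})}{\tau(t)}$$ (series in $\lambda^{-1}$) satisfy the bilinear identity $\operatorname{res}_\lambda\varphi(\lambda,t')\varphi^*(\lambda,t)=0$, as a formal series in the shift $t'-t$ of $t_1,t_2,\dots$. Let $w=2\partial_x\ln\tau$. The vertex operators are $$X(\lambda)=e^{-\partial_0}e^{\zeta(\lambda,t)}e^{-\sum_{k\ge1}\frac1{k\lambda^k}\partial_k},\qquad X^*(\lambda)=e^{\partial_0}e^{-\zeta(\lambda,t)}e^{\sum_{k\ge1}\frac1{k\lambda^k}\partial_k},$$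 where $\partial_k=\partial/\partial t_k$ and $e^{\pm\partial_0}$ is the shift $t_0\mapsto t_0\pm1$; in products $X(\lambda)X^*(\mu)$ one expands for $|\lambda|>|\mu|$. Let $N\ge1$, and let $t\in U$ be a point at which all of $t_1,t_2,\dots$ except $t_1,t_2,t_N$ vanish and $t_k=0$ for $k>N$. Let $h(z)=\sum_{n\in\mathbb Z}h_nz^n$ be a Laurent series with constant coefficients which converges in an annulus containing $t_N$; if $h_n=0$ for all $n<0$, convergence in a disc about $0$ containing $t_N$ is enough, and $t_N=0$ is allowed. Put $h(\partial_{\lambda^N})=\sum_nh_n\partial_{\lambda^N}^n$, $\partial_{\lambda^N}=\frac1N\lambda^{1-N}\partial_\lambda$, acting on expressions $e^{\zeta(\lambda,t)}A(\lambda)$ with $A\in\mathbb C[[\lambda^{-1}]]$. Negative powers follow the path-integral convention: $$\partial_{\lambda^N}^{-1}f=\int_\infty^\lambda f(\lambda')\,d(\lambda'^N).$$ **Theorem 5.** Let $\alpha\in\{N,2,1,0,-1\}$, $\alpha\le N$. 1. If $t_N\ne0$, then $\partial_{\lambda^N}$ is invertible on $e^{\zeta(\lambda,t)}\mathbb C[[\lambda^{-1}]]$,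 and its inverse is the asymptotic expansion for $\lambda\to\infty$ of the path integral along any ray on which $e^{t_N\lambda^N}$ decays at infinity. The series $h(\partial_{\lambda^N})$ converge, coefficient by coefficient, on $\varphi(\lambda)$ and on $X(\lambda)X^*(\mu)\tau$. 2. The point symmetries $V^N(\alpha,h)$ of the field $w$ result from the action $$V^N(\alpha,h)\tau=\operatorname{res}_\lambda\Bigl[\lambda^\alpha\,[h(\partial_{\lambda^N})X(\lambda)]\,X^*(\lambda)\Bigr]\tau$$ on the tau function at the point $t$. Precisely, the product at coinciding points is defined by point splitting, modulo $x$-independent multiples of $\tau$, which do not change $w$: the variation $\delta\tau=[h(\partial_{\lambda^N})X(\lambda)]X^*(\mu)\tau$ induces $$\delta w=2\partial_x\frac{\delta\tau}{\tau}=2\,[h(\partial_{\lambda^N})\varphi(\lambda)]\,\varphi^*(\mu)$$ (the quotients by $\tau$ being differentiable in $x$, coefficient by coefficient). This is regular at $\mu=\lambda$, and setting $\mu=\lambda$, multiplying by $\lambda^\alpha$ and taking the residue gives the flow $$V^N(\alpha,h)w=2\operatorname{res}_\lambda\lambda^\alpha[h(\partial_{\lambda^N})\varphi(\lambda)]\varphi^*(\lambda).$$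 3. This flow is the point flow $V^N(\alpha,h)w=v_xw_x+v_yw_y+v_Nw_{t_N}-p$ with the following right-hand sides, where $h,h',\dots$ are taken at $t_N$. * $N\ge3$, $\alpha=N$: $\;hw_{t_N}+\frac2Nyh'w_y+\frac1Nxh'w_x+\frac1Nwh'+R_N$, plus the term $\frac29y^2h''w_x$ if $N=3$, where $R_3=\frac19(x^2+4yt_0-2y)h''+\frac4{27}xy^2h'''+\frac4{243}y^4h''''$, $R_4=\frac14xyh''$, $R_5=\frac4{25}y^2h''$, and $R_N=0$ for $N\ge6$. * $N\ge3$, $\alpha=2$: $\;hw_y$, plus $\frac23yh'w_x+\frac23t_0h'+\frac49xyh''+\frac8{81}y^3h'''$ if $N=3$, plus $\frac12xh'$ if $N=4$, plus $\frac45yh'$ if $N=5$. * $N\ge3$, $\alpha=1$: $\;hw_x$, plus $\frac23xh'+\frac49y^2h''$ if $N=3$, plus $yh'$ if $N=4$. * $N\ge3$, $\alpha=0$: $\;\frac43yh'$ if $N=3$, and $0$ if $N\ge4$. * $\alpha=-1$ (every $N\ge1$): $\;2h$. * $N=1$: $\;hw_x+wh'+(t_0^2-t_0)h''$ for $\alpha=1$;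 $\;2t_0h'$ for $\alpha=0$. * $N=2$: $\;hw_y+\frac12xh'w_x+\frac12wh'-\frac14x(1-2t_0)h''+\frac1{24}x^3h'''$ for $\alpha=2$; $\;hw_x+t_0h'+\frac14x^2h''$ for $\alpha=1$; $\;xh'$ for $\alpha=0$. -/

import Mathlib

open Filter Topology MeasureTheory PowerSeries

namespace KP

noncomputable section

/-- The times of the KP hierarchy: `t 0` is the "zero time" `t₀` and `t k`, `k ≥ 1`, are the
higher times; `t 1 = x`, `t 2 = y`. -/
abbrev Times := ℕ → ℂ

/-- The unit vector in the direction of the time `t_k`. -/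
def e (k : ℕ) : Times := Pi.single k 1

/-- The partial derivative `∂_k = ∂/∂t_k`. -/
def pd (k : ℕ) (F : Times → ℂ) : Times → ℂ := fun t => lineDeriv ℂ F t (e k)

/-- The coefficients `P_n` of
`exp (c ∑_{k ≥ 1} z ^ k / k · D_k) = ∑_{n ≥ 0} P_n z ^ n` for commuting operators `D_1, D_2, …`.
(Apply `z d/dz` to both sides: `n P_n = c ∑_{k = 1}^n D_k P_{n - k}`, `P_0 = 1`.) -/
def expShift {V : Type} [AddCommGroup V] [Module ℂ V] (c : ℂ) (D : ℕ → V → V) : ℕ → V → V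
  | 0, v => v
  | n + 1, v => (c / (n + 1)) • ∑ k : Fin (n + 1), D ((k : ℕ) + 1) (expShift c D (n - (k : ℕ)) v)

/-- The action of `∂_k`, `k ≥ 1`, on `exp (c ζ(ν, t)) ∑_i b_i(t) ν ^ i`, in terms of the
coefficients `b`, where `ζ(ν, t) = t₀ log ν + ∑_{k ≥ 1} t_k ν ^ k`. -/
def twist (c : ℂ) (k : ℕ) (b : ℤ → Times → ℂ) : ℤ → Times → ℂ :=
  fun i t => pd k (b i) t + c * b (i - k) t

/-- The coefficients `K_n = a_{-n}` in `φ(ν, t) = exp (ζ(ν, t)) ∑_{i ≤ 0} a_i(t) ν ^ i`, the formal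
Baker-Akhiezer function
`φ(ν, t) = exp (ζ(ν, t)) τ(t₀, t_k - 1/(k ν ^ k)) / τ(t)`. -/
def wave (τ : Times → ℂ) : ℤ → Times → ℂ :=
  fun i t => if i ≤ 0 then expShift (-1) pd (-i).toNat τ t / τ t else 0

/-- The coefficients in `φ*(ν, t) = exp (-ζ(ν, t)) ∑_{i ≤ 0} a*_i(t) ν ^ i`, the formal adjoint
Baker-Akhiezer function
`φ*(ν, t) = exp (-ζ(ν, t)) τ(t₀, t_k + 1/(k ν ^ k)) / τ(t)`. -/
def waveStar (τ : Times → ℂ) : ℤ → Times → ℂ :=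
  fun i t => if i ≤ 0 then expShift 1 pd (-i).toNat τ t / τ t else 0

/-- `τ` is a (zero-free) tau function of the KP hierarchy on `U`: it is holomorphic in any finite
number of the times `t_1, t_2, …`, and satisfies the bilinear identity
`res_ν φ(ν, t') φ*(ν, t) = 0` for small shifts `t' - t` of `t_1, t_2, …`, i.e. all Taylor
coefficients in `t' - t` vanish: `res_ν (∂_{k_1} ⋯ ∂_{k_r} φ)(ν, t) φ*(ν, t) = 0`. -/
structure IsTau (U : Set Times) (τ : Times → ℂ) : Prop where
  isOpen : ∀ t ∈ U, ∀ n : ℕ, ∀ᶠ s : Fin n → ℂ in 𝓝 0, t + ∑ i, s i • e ((i : ℕ) + 1) ∈ U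
  ne_zero : ∀ t ∈ U, τ t ≠ 0
  analytic : ∀ t ∈ U, ∀ n : ℕ,
    AnalyticAt ℂ (fun s : Fin n → ℂ => τ (t + ∑ i, s i • e ((i : ℕ) + 1))) 0
  bilinear : ∀ t ∈ U, ∀ l : List ℕ, (∀ k ∈ l, 1 ≤ k) →
    ∑ᶠ i : ℤ, (l.foldr (twist 1) (wave τ)) i t * waveStar τ (-1 - i) t = 0

/-- The KP field `w = 2 ∂_x log τ`. -/
def field (τ : Times → ℂ) : Times → ℂ := fun t => 2 * pd 1 τ t / τ t

/-! ### Vertex operators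

`X(λ) = exp(-∂_0) exp(ζ(λ, t)) exp(-∑ ∂_k / (k λ ^ k))` and
`X*(μ) = exp(∂_0) exp(-ζ(μ, t)) exp(∑ ∂_k / (k μ ^ k))`, where `exp(± ∂_0)` is the shift
`t₀ ↦ t₀ ± 1`. -/

/-- `X*(μ) F = exp (-ζ(μ, t)) ∑_m (vertexStar F m t) μ ^ m`. -/
def vertexStar (F : Times → ℂ) : ℤ → Times → ℂ :=
  fun m t => if m < 0 then expShift 1 pd (-1 - m).toNat F (t + e 0) else 0

/-- For `G = exp (-ζ(μ, t)) ∑_m b_m(t) μ ^ m`,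
`X(λ) G = exp (ζ(λ, t) - ζ(μ, t)) ∑_{i, m} (vertex b i m t) λ ^ i μ ^ m`. The shift of `t₀` by `-1`
turns `exp (-ζ(μ, t))` into `μ exp (-ζ(μ, t))` and `exp (ζ(λ, t))` into `λ⁻¹ exp (ζ(λ, t))`. -/
def vertex (b : ℤ → Times → ℂ) : ℤ → ℤ → Times → ℂ :=
  fun i m t =>
    if i < 0 then expShift (-1) (twist (-1)) (-1 - i).toNat b (m - 1) (t - e 0) else 0

/-! ### The operators `h(∂_E)`, `E = λ ^ N`

They act on `exp (ζ(λ, t)) A`, where `A` is a formal power series in `λ⁻¹`, for `t` with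
`t_k = 0` for `k > N`. The variable `X` of the power series is `λ⁻¹`. -/

/-- `∂_E = N⁻¹ λ ^ (1 - N) ∂_λ` on `exp (ζ(λ, t)) A`:
`∂_E (exp (ζ) A) = exp (ζ) (dE N t A)`. -/
def dE (N : ℕ) (t : Times) : Module.End ℂ ℂ⟦X⟧ :=
  (N : ℂ)⁻¹ • (LinearMap.mulLeft ℂ
      ((∑ k ∈ Finset.Icc 1 N, C (k * t k) * X ^ (N - k)) + C (t 0) * X ^ N) -
    LinearMap.mulLeft ℂ (X ^ (N + 1)) ∘ₗ (derivative ℂ).toLinearMap)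

/-- The integer powers of `∂_E`. -/
def dEpow (N : ℕ) (t : Times) : ℤ → Module.End ℂ ℂ⟦X⟧
  | Int.ofNat n => dE N t ^ n
  | Int.negSucc n => Ring.inverse (dE N t) ^ (n + 1)

/-- The function `exp (ζ(λ, t))` when `t_k = 0` for `k > N`. -/
def expZeta (N : ℕ) (t : Times) (l : ℂ) : ℂ :=
  l ^ (t 0) * Complex.exp (∑ k ∈ Finset.Icc 1 N, t k * l ^ k)

/-- The value at `l` of the truncation of `A` after the term `l ^ (-M)`. -/
def truncVal (M : ℕ) (A : ℂ⟦X⟧) (l : ℂ) : ℂ :=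
  ∑ n ∈ Finset.range (M + 1), coeff n A * l⁻¹ ^ n

/-- `exp (ζ(λ, t)) B` is the asymptotic expansion, for `λ → ∞`, of the path integral
`∫_∞^λ exp (ζ(λ', t)) A(λ') dE(λ')`, `E = λ' ^ N`, along any ray `λ' = s u` on which the
exponential decays at infinity. -/
def IsPathIntegral (N : ℕ) (t : Times) (A B : ℂ⟦X⟧) : Prop :=
  ∀ u : ℂ, ‖u‖ = 1 → (t N * u ^ N).re < 0 → ∀ M : ℕ,
    (∀ r : ℝ, 0 < r → IntegrableOn (fun s : ℝ =>
      expZeta N t (s * u) * truncVal M A (s * u) * (N * (s * u) ^ (N - 1) * u)) (Set.Ioi r)) ∧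
    (fun r : ℝ =>
      (-∫ s in Set.Ioi r,
        expZeta N t (s * u) * truncVal M A (s * u) * (N * (s * u) ^ (N - 1) * u)) /
          expZeta N t (r * u) - truncVal M B (r * u))
      =O[atTop] fun r : ℝ => r⁻¹ ^ (M + 1)

/-- The Laurent series `∑ h_n z ^ n` converges in an annulus that contains `z` (in a disc that
contains `z`, if there are no negative powers). -/
def ConvergesAround (h : ℤ → ℂ) (z : ℂ) : Prop :=
  (∃ z₂ : ℂ, ‖z‖ < ‖z₂‖ ∧ Summable fun n : ℕ => h n * z₂ ^ n) ∧
  ((∀ n : ℤ, n < 0 → h n = 0) ∨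
    ∃ z₁ : ℂ, z₁ ≠ 0 ∧ ‖z₁‖ < ‖z‖ ∧ Summable fun n : ℕ => h (-n) * z₁⁻¹ ^ n)

/-- The function `h(z) = ∑ h_n z ^ n`. -/
def laurentFun (h : ℤ → ℂ) (z : ℂ) : ℂ := ∑' n : ℤ, h n * z ^ n

/-- The coefficient of `λ ^ i` in `B`, where
`h(∂_E) (exp (ζ) A) = ∑_n h_n ∂_E ^ n (exp (ζ) A) = exp (ζ) B`. -/
def hApply (h : ℤ → ℂ) (N : ℕ) (t : Times) (A : ℂ⟦X⟧) (i : ℤ) : ℂ :=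
  if i ≤ 0 then ∑' n : ℤ, h n * coeff (-i).toNat (dEpow N t n A) else 0

/-- The `λ`-dependence of the coefficient of `μ ^ m` in `exp (ζ(μ) - ζ(λ)) X(λ) X*(μ) τ`, as a power
series in `λ⁻¹`. -/
def vertexSeries (τ : Times → ℂ) (m : ℤ) (t : Times) : ℂ⟦X⟧ :=
  PowerSeries.mk fun n => vertex (vertexStar τ) (-(n : ℤ)) m t

/-- The power series `∑ K_n λ ^ (-n)` of the Baker-Akhiezer function. -/
def waveSeries (τ : Times → ℂ) (t : Times) : ℂ⟦X⟧ :=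
  PowerSeries.mk fun n => wave τ (-(n : ℤ)) t

/-- The action on the tau function before the points are merged:
`[h(∂_{λ ^ N}) X(λ)] X*(μ) τ = exp (ζ(λ, t) - ζ(μ, t)) ∑_{i, m} (tauAction h N τ i m t) λ ^ i μ ^ m`. -/
def tauAction (h : ℤ → ℂ) (N : ℕ) (τ : Times → ℂ) : ℤ → ℤ → Times → ℂ :=
  fun i m t => hApply h N t (vertexSeries τ m t) i

/-- The variation `δw = 2 ∂_x (δτ / τ)` of `w = 2 ∂_x log τ` for
`δτ = [h(∂_{λ ^ N}) X(λ)] X*(μ) τ`; the coefficient of `λ ^ i μ ^ m` after the factor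
`exp (ζ(λ, t) - ζ(μ, t))`, whose `x`-derivative produces `λ - μ`. -/
def fieldAction (h : ℤ → ℂ) (N : ℕ) (τ : Times → ℂ) : ℤ → ℤ → Times → ℂ :=
  fun i m t => 2 * (pd 1 (fun s => tauAction h N τ i m s / τ s) t +
    tauAction h N τ (i - 1) m t / τ t - tauAction h N τ i (m - 1) t / τ t)

/-- The flow of `w` induced by `τ ↦ res_λ λ ^ α [h(∂_{λ ^ N}) X(λ)] X*(λ) τ`: put `μ = λ` in the
variation of `w` and take the coefficient of `λ⁻¹` after multiplication with `λ ^ α`. -/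
def inducedFlow (h : ℤ → ℂ) (N : ℕ) (α : ℤ) (τ : Times → ℂ) (t : Times) : ℂ :=
  ∑ᶠ m : ℤ, fieldAction h N τ (-1 - α - m) m t

/-- The symmetry flow `V^N(α, h) w = 2 res_λ λ ^ α [h(∂_{λ ^ N}) φ(λ)] φ*(λ)`. -/
def symmetryFlow (h : ℤ → ℂ) (N : ℕ) (α : ℤ) (τ : Times → ℂ) (t : Times) : ℂ :=
  2 * ∑ᶠ m : ℤ, hApply h N t (waveSeries τ t) (-1 - α - m) * waveStar τ m t

/-- A vector `v = (v_x, v_y, v_N)` and a scalar `p`. The point flow with these coefficients is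
`∂w/∂z = v_x w_x + v_y w_y + v_N w_{t_N} - p`. -/
structure PointField where
  vx : ℂ
  vy : ℂ
  vN : ℂ
  p : ℂ

/-- The coefficients of the Lie point symmetry `V^N(α, h)` as functions of `t₀, x, y, w` and of the
derivatives `H k = h^(k)(t_N)`. -/
def pointField (N : ℕ) (α : ℤ) (t₀ x y w : ℂ) (H : ℕ → ℂ) : PointField :=
  match N with
  | 0 => ⟨0, 0, 0, 0⟩
  | 1 =>
    if α = 1 then ⟨H 0, 0, 0, -(w * H 1 + (t₀ ^ 2 - t₀) * H 2)⟩
    else if α = 0 then ⟨0, 0, 0, -(2 * t₀ * H 1)⟩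
    else if α = -1 then ⟨0, 0, 0, -(2 * H 0)⟩
    else ⟨0, 0, 0, 0⟩
  | 2 =>
    if α = 2 then
      ⟨x * H 1 / 2, H 0, 0, -(w * H 1 / 2 - x * (1 - 2 * t₀) / 4 * H 2 + x ^ 3 / 24 * H 3)⟩
    else if α = 1 then ⟨H 0, 0, 0, -(t₀ * H 1 + x ^ 2 / 4 * H 2)⟩
    else if α = 0 then ⟨0, 0, 0, -(x * H 1)⟩
    else if α = -1 then ⟨0, 0, 0, -(2 * H 0)⟩
    else ⟨0, 0, 0, 0⟩
  | 3 =>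
    if α = 3 then
      ⟨x * H 1 / 3 + 2 / 9 * y ^ 2 * H 2, 2 * y * H 1 / 3, H 0,
        -(w * H 1 / 3 + (x ^ 2 + 4 * y * t₀ - 2 * y) / 9 * H 2 + 4 / 27 * x * y ^ 2 * H 3 +
          4 / 243 * y ^ 4 * H 4)⟩
    else if α = 2 then
      ⟨2 / 3 * y * H 1, H 0, 0,
        -(2 / 3 * t₀ * H 1 + 4 / 9 * x * y * H 2 + 8 / 81 * y ^ 3 * H 3)⟩
    else if α = 1 then ⟨H 0, 0, 0, -(2 / 3 * x * H 1 + 4 / 9 * y ^ 2 * H 2)⟩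
    else if α = 0 then ⟨0, 0, 0, -(4 / 3 * y * H 1)⟩
    else if α = -1 then ⟨0, 0, 0, -(2 * H 0)⟩
    else ⟨0, 0, 0, 0⟩
  | 4 =>
    if α = 4 then ⟨x * H 1 / 4, y * H 1 / 2, H 0, -(w * H 1 / 4 + x * y / 4 * H 2)⟩
    else if α = 2 then ⟨0, H 0, 0, -(x / 2 * H 1)⟩
    else if α = 1 then ⟨H 0, 0, 0, -(y * H 1)⟩
    else if α = -1 then ⟨0, 0, 0, -(2 * H 0)⟩
    else ⟨0, 0, 0, 0⟩
  | 5 =>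
    if α = 5 then ⟨x * H 1 / 5, 2 * y * H 1 / 5, H 0, -(w * H 1 / 5 + 4 / 25 * y ^ 2 * H 2)⟩
    else if α = 2 then ⟨0, H 0, 0, -(4 / 5 * y * H 1)⟩
    else if α = 1 then ⟨H 0, 0, 0, 0⟩
    else if α = -1 then ⟨0, 0, 0, -(2 * H 0)⟩
    else ⟨0, 0, 0, 0⟩
  | N =>
    if α = N then ⟨x * H 1 / N, 2 * y * H 1 / N, H 0, -(w * H 1 / N)⟩
    else if α = 2 then ⟨0, H 0, 0, 0⟩
    else if α = 1 then ⟨H 0, 0, 0, 0⟩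
    else if α = -1 then ⟨0, 0, 0, -(2 * H 0)⟩
    else ⟨0, 0, 0, 0⟩

/-- The point flow `v_x w_x + v_y w_y + v_N w_{t_N} - p`. -/
def pointFlow (N : ℕ) (V : PointField) (w : Times → ℂ) (t : Times) : ℂ :=
  V.vx * pd 1 w t + V.vy * pd 2 w t + V.vN * pd N w t - V.p

end

end KP

/-! Write $t\pm[\lambda^{-1}]$ for the shifts $t_k\mapsto t_k\pm1/(k\lambda^k)$. The proof combines
two consequences of the bilinear identity with a normal form of $h(\partial_{\lambda^N})$.

Normal ordering gives
$X(\lambda)X^*(\mu)\tau=e^{\zeta(\lambda)-\zeta(\mu)}\,\tau(t-[\lambda^{-1}]+[\mu^{-1}])/(\lambda-\mu)$.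
Put $t'=t-[\lambda^{-1}]+[\mu^{-1}]$ in the bilinear identity. The exponentials contribute the
rational factor $(1-\nu/\lambda)/(1-\nu/\mu)$, so only a few terms of the residue survive, and they
form the differential Fay identity `BilinearAt.differential_fay`. Divided by $\lambda-\mu$ it reads
$\partial_x(X(\lambda)X^*(\mu)\tau/\tau)=\varphi(\lambda)\varphi^*(\mu)$, which is
`IsTau.hasLineDerivAt_vertexSeries`: the pole at $\lambda=\mu$ has gone. The bilinear identity with
one derivative $\partial_n$ gives $2\operatorname{res}\lambda^n\varphi\varphi^*=\partial_nw$
(`IsTau.sum_antidiagonal_eq`).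

Conjugated with $e^\zeta$, the operator $\partial_{\lambda^N}$ becomes $t_N+D$, where $D$ raises the
order in $\lambda^{-1}$. Each coefficient of $(t_N+D)^j$ is therefore a finite binomial sum,
negative powers exist for $t_N\ne0$, and summation against $h_j$ gives
$h(\partial_{\lambda^N})=\sum_kh^{(k)}(t_N)D^k/k!$ (`ConvergesAround.hApply_eq`). This operator
commutes with $\partial_x$ (`HasTwistedDeriv.hApply`), so the Fay identity passes to $\delta
w=2[h(\partial_{\lambda^N})\varphi(\lambda)]\varphi^*(\mu)$ (`IsTau.fieldAction_eq`).

The residue with $\lambda^\alpha$ sees only total order $\alpha+1$, which leaves finitely many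
powers of $D$; for $N\ge6$ only $D^0$ and $D^1$ remain, since $D$ raises the order by at least
$N-2$. The coefficients of $\varphi$ and $\varphi^*$ enter through
$\operatorname{res}\lambda^n\varphi\varphi^*$ and through the first two coefficients, which are $1$
and $\mp w/2$ (`IsTau.symmetryFlow_eq_pointFlow`).

The path integral is a separate matter: the fundamental theorem of calculus is applied to a
truncated antiderivative, and the tail is bounded by the decay of the exponential
(`isPathIntegral_of_dE_eq`). -/

namespace KP

noncomputable section

/-! ### Exponentials of commuting operators, coefficient by coefficient -/

section ExpShift

open Finset hiding antidiagonal mem_antidiagonal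
open Finset.HasAntidiagonal (antidiagonal mem_antidiagonal)

variable {V W : Type} [AddCommGroup V] [Module ℂ V] [AddCommGroup W] [Module ℂ W]

@[simp]
lemma expShift_zero (c : ℂ) (D : ℕ → V → V) (v : V) : expShift c D 0 v = v := by
  rw [expShift]

lemma expShift_succ (c : ℂ) (D : ℕ → V → V) (n : ℕ) (v : V) :
    expShift c D (n + 1) v =
      (c / (n + 1)) • ∑ p ∈ antidiagonal n, D (p.1 + 1) (expShift c D p.2 v) := by
  rw [expShift, Nat.sum_antidiagonal_eq_sum_range_succ
    (fun i j => D (i + 1) (expShift c D j v)), ← Fin.sum_univ_eq_sum_range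
    (fun i => D (i + 1) (expShift c D (n - i) v))]

/-- The recursion is the differential equation $zF'=c\sum_kz^kD_kF$ with $F(0)=v$. Multiplicativity
of the exponential is proved by checking this equation, never by expanding. -/
lemma expShift_unique {c : ℂ} {D : ℕ → V → V} {v : V} (f : ℕ → V) (h0 : f 0 = v)
    (hf : ∀ n : ℕ, ((n : ℂ) + 1) • f (n + 1) = c • ∑ p ∈ antidiagonal n, D (p.1 + 1) (f p.2))
    (n : ℕ) : expShift c D n v = f n := by
  induction n using Nat.strong_induction_on with
  | _ n ih =>
    cases n with
    | zero => simp [h0]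
    | succ n =>
      have hn : ((n : ℂ) + 1) ≠ 0 := by exact_mod_cast n.succ_ne_zero
      rw [expShift_succ, ← inv_smul_smul₀ hn (f (n + 1)), hf, smul_smul, div_eq_inv_mul]
      congr 1
      refine sum_congr rfl fun p hp => ?_
      rw [ih _ (Nat.antidiagonal.snd_lt hp |>.trans_le le_rfl)]

/-- `expShift` respects relations that are compatible with the operations it is built from. -/
lemma expShift_rel (r : V → W → Prop) (h0 : r 0 0) (hadd : ∀ a b a' b', r a a' → r b b' →
    r (a + b) (a' + b')) (hsmul : ∀ (c : ℂ) a a', r a a' → r (c • a) (c • a'))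
    {D : ℕ → V → V} {D' : ℕ → W → W} (hD : ∀ k a a', r a a' → r (D (k + 1) a) (D' (k + 1) a'))
    (c : ℂ) (n : ℕ) {v : V} {w : W} (h : r v w) : r (expShift c D n v) (expShift c D' n w) := by
  induction n using Nat.strong_induction_on with
  | _ n ih =>
    cases n with
    | zero => simpa using h
    | succ n =>
      rw [expShift_succ, expShift_succ]
      apply hsmul
      have : ∀ s ⊆ antidiagonal n, r (∑ p ∈ s, D (p.1 + 1) (expShift c D p.2 v))
          (∑ p ∈ s, D' (p.1 + 1) (expShift c D' p.2 w)) := by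
        intro s
        induction s using Finset.induction_on with
        | empty => simpa using h0
        | insert p s hp ih' =>
          intro hs
          rw [sum_insert hp, sum_insert hp]
          refine hadd _ _ _ _ (hD _ _ _ (ih _ ?_)) (ih' fun q hq => hs (mem_insert_of_mem hq))
          exact Nat.antidiagonal.snd_lt (hs (mem_insert_self _ _))
      exact this _ subset_rfl

lemma expShift_map (T : V →ₗ[ℂ] W) {D : ℕ → V → V} {D' : ℕ → W → W}
    (hD : ∀ k a, T (D (k + 1) a) = D' (k + 1) (T a)) (c : ℂ) (n : ℕ) (v : V) :
    T (expShift c D n v) = expShift c D' n (T v) :=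
  expShift_rel (fun a b => T a = b) (map_zero T) (by rintro a b _ _ rfl rfl; exact map_add T a b)
    (by rintro c a _ rfl; exact map_smul T c a) (by rintro k a _ rfl; exact hD k a) c n rfl

lemma sum_antidiagonal_assoc {M : Type*} [AddCommMonoid M] (f : ℕ → ℕ → ℕ → M) (n : ℕ) :
    ∑ p ∈ antidiagonal n, ∑ q ∈ antidiagonal p.1, f q.1 q.2 p.2 =
      ∑ p ∈ antidiagonal n, ∑ q ∈ antidiagonal p.2, f p.1 q.1 q.2 := by
  rw [sum_sigma', sum_sigma']
  refine sum_nbij' (fun x => ⟨(x.2.1, x.2.2 + x.1.2), (x.2.2, x.1.2)⟩)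
    (fun x => ⟨(x.1.1 + x.2.1, x.2.2), (x.1.1, x.2.1)⟩) ?_ ?_ ?_ ?_ ?_ <;>
  · rintro ⟨⟨a, b⟩, ⟨c, d⟩⟩
    simp only [mem_sigma, mem_antidiagonal]
    rintro ⟨rfl, rfl⟩
    simp [add_assoc]

lemma sum_antidiagonal_assoc' {M : Type*} [AddCommMonoid M] (f : ℕ → ℕ → ℕ → M) (n : ℕ) :
    ∑ p ∈ antidiagonal n, ∑ q ∈ antidiagonal p.2, f q.1 p.1 q.2 =
      ∑ p ∈ antidiagonal n, ∑ q ∈ antidiagonal p.2, f p.1 q.1 q.2 := by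
  rw [← sum_antidiagonal_assoc f, ← sum_antidiagonal_assoc (fun i j k => f j i k)]
  exact sum_congr rfl fun p _ => Nat.sum_antidiagonal_swap (f := fun q => f q.1 q.2 p.2)

/-- The exponential of a sum is a product of exponentials: a criterion in terms of the
doubly indexed coefficients of the product. -/
lemma expShift_eq_sum_antidiagonal {c : ℂ} (T : ℕ → V →ₗ[ℂ] V) (f : ℕ → ℕ → V)
    (g g' : ℕ → ℕ → ℕ → V) (hT : ∀ k a b, T (k + 1) (f a b) = g (k + 1) a b + g' (k + 1) a b)
    (hg : ∀ a b : ℕ, ((a : ℂ) + 1) • f (a + 1) b = c • ∑ p ∈ antidiagonal a, g (p.1 + 1) p.2 b)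
    (hg' : ∀ a b : ℕ, ((b : ℂ) + 1) • f a (b + 1) = c • ∑ p ∈ antidiagonal b, g' (p.1 + 1) a p.2)
    (n : ℕ) : expShift c (fun k => T k) n (f 0 0) = ∑ p ∈ antidiagonal n, f p.1 p.2 := by
  refine expShift_unique (fun n => ∑ p ∈ antidiagonal n, f p.1 p.2) (by simp) (fun n => ?_) n
  have h1 : ((n : ℂ) + 1) • ∑ p ∈ antidiagonal (n + 1), f p.1 p.2 =
      ∑ p ∈ antidiagonal (n + 1), (p.1 : ℂ) • f p.1 p.2 +
      ∑ p ∈ antidiagonal (n + 1), (p.2 : ℂ) • f p.1 p.2 := by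
    rw [smul_sum, ← sum_add_distrib]
    refine sum_congr rfl fun p hp => ?_
    rw [← add_smul]
    congr 1
    exact_mod_cast (mem_antidiagonal.1 hp).symm
  simp only [h1, map_sum, hT, sum_add_distrib, smul_add]
  congr 1
  · rw [Nat.sum_antidiagonal_succ]
    simp only [Nat.cast_zero, zero_smul, zero_add, Nat.cast_succ, hg, ← smul_sum]
    rw [sum_antidiagonal_assoc (fun i j k => g (i + 1) j k)]
  · rw [Nat.sum_antidiagonal_succ']
    simp only [Nat.cast_zero, zero_smul, zero_add, Nat.cast_succ, hg', ← smul_sum]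
    rw [sum_antidiagonal_assoc' (fun i j k => g' (i + 1) j k) n]

/-- The coefficients of `exp (c ∑ z ^ k / k · D_k)` as linear maps. -/
def expOp (c : ℂ) (D : ℕ → Module.End ℂ V) (n : ℕ) : Module.End ℂ V :=
  expShift c (fun k T => D k * T) n 1

lemma expOp_apply (c : ℂ) (D : ℕ → Module.End ℂ V) (n : ℕ) (v : V) :
    expOp c D n v = expShift c (fun k => D k) n v := by
  have := expShift_map (LinearMap.applyₗ v : Module.End ℂ V →ₗ[ℂ] V)
    (D := fun k T => D k * T) (D' := fun k => D k) (fun k a => rfl) c n 1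
  simpa [expOp] using this

@[simp]
lemma expOp_zero (c : ℂ) (D : ℕ → Module.End ℂ V) : expOp c D 0 = 1 := expShift_zero _ _ _

lemma smul_expOp_succ (c : ℂ) (D : ℕ → Module.End ℂ V) (n : ℕ) :
    ((n : ℂ) + 1) • expOp c D (n + 1) = c • ∑ p ∈ antidiagonal n, D (p.1 + 1) * expOp c D p.2 := by
  have hn : ((n : ℂ) + 1) ≠ 0 := by exact_mod_cast n.succ_ne_zero
  rw [expOp, expShift_succ, smul_smul, mul_div_cancel₀ _ hn]
  rfl

lemma expOp_one (c : ℂ) (D : ℕ → Module.End ℂ V) : expOp c D 1 = c • D 1 := by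
  simpa using smul_expOp_succ c D 0

lemma commute_expOp {c : ℂ} {D : ℕ → Module.End ℂ V} {T : Module.End ℂ V}
    (hT : ∀ k, Commute T (D k)) (n : ℕ) : Commute T (expOp c D n) :=
  expShift_rel (fun a _ : Module.End ℂ V => Commute T a) (Commute.zero_right T)
    (fun _ _ _ _ ha hb => ha.add_right hb) (fun c _ _ ha => ha.smul_right c)
    (D' := fun _ _ => 0) (fun _ _ _ ha => (hT _).mul_right ha) c n (w := 0) (Commute.one_right T)

lemma expOp_mem {c : ℂ} {D : ℕ → Module.End ℂ V} (M : Submodule ℂ V)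
    (hM : ∀ k, ∀ v ∈ M, D (k + 1) v ∈ M) (n : ℕ) {v : V} (hv : v ∈ M) : expOp c D n v ∈ M := by
  rw [expOp_apply]
  exact expShift_rel (fun a _ : V => a ∈ M) M.zero_mem (fun a b _ _ ha hb => M.add_mem ha hb)
    (fun c a _ ha => M.smul_mem c ha) (D' := fun _ _ => 0) (fun k a _ ha => hM k a ha) c n
    (w := 0) hv

/-- `exp (-∑ z ^ k / k · D_k) exp (∑ z ^ k / k · D_k) = 1`. -/
lemma sum_expOp_mul_expOp {D : ℕ → Module.End ℂ V} (hD : ∀ j k, Commute (D j) (D k)) (n : ℕ) :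
    ∑ p ∈ antidiagonal n, expOp (-1) D p.1 * expOp 1 D p.2 = if n = 0 then 1 else 0 := by
  -- The product has zero logarithmic derivative, so it is compared with the exponential of the zero
  -- operators; the contributions of the two factors are negatives of each other.
  have key := expShift_eq_sum_antidiagonal (V := Module.End ℂ V) (c := 1)
    (fun _ => (0 : Module.End ℂ V →ₗ[ℂ] _))
    (fun a b => expOp (-1) D a * expOp 1 D b)
    (fun k a b => -(D k * (expOp (-1) D a * expOp 1 D b)))
    (fun k a b => D k * (expOp (-1) D a * expOp 1 D b)) (by simp) ?_ ?_ n
  · rw [← key]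
    cases n with
    | zero => simp
    | succ n => simp [expShift_succ]
  · intro a b
    rw [← smul_mul_assoc, smul_expOp_succ]
    simp [sum_mul, mul_assoc]
  · intro a b
    rw [← mul_smul_comm, smul_expOp_succ]
    simp only [one_smul, mul_sum]
    refine sum_congr rfl fun p _ => ?_
    rw [← mul_assoc, ← mul_assoc, (commute_expOp (fun k => hD _ k) a).eq]

end ExpShift

/-! ### Exponentials of the twisted operators $D_k+\kappa\nu^k$ -/

section Twist

open Finset hiding antidiagonal mem_antidiagonal
open Finset.HasAntidiagonal (antidiagonal mem_antidiagonal)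

variable {R : Type} [CommRing R] [Algebra ℂ R]

/-- The operators `D_k + c σ ^ k` on sequences, where `σ` is the shift. -/
def twistOp (c : ℂ) (D : ℕ → Module.End ℂ R) (k : ℕ) : Module.End ℂ (ℤ → R) where
  toFun b i := D k (b i) + c • b (i - k)
  map_add' b b' := by ext i; simp; abel
  map_smul' r b := by
    ext i
    simp only [Pi.smul_apply, map_smul, RingHom.id_apply, smul_add]
    rw [smul_comm c r]

lemma twistOp_apply (c : ℂ) (D : ℕ → Module.End ℂ R) (k : ℕ) (b : ℤ → R) (i : ℤ) :
    twistOp c D k b i = D k (b i) + c • b (i - k) := rfl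

/-- `exp (ε ∑ z ^ k / k · (D_k + κ σ ^ k))`, where `w` are the coefficients of
`exp (ε κ ∑ z ^ k / k)`. -/
lemma expOp_twistOp {ε κ : ℂ} (D : ℕ → Module.End ℂ R) (w : ℕ → ℂ) (w0 : w 0 = 1)
    (hw : ∀ n : ℕ, ((n : ℂ) + 1) * w (n + 1) = ε * κ * ∑ p ∈ antidiagonal n, w p.2) (n : ℕ)
    (b : ℤ → R) (i : ℤ) :
    expOp ε (twistOp κ D) n b i =
      ∑ p ∈ antidiagonal n, w p.2 • expOp ε D p.1 (b (i - p.2)) := by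
  -- The operators $D_k$ commute with the shift, so the exponential factors; the two indices are the
  -- degrees in the $D$-part and in the shift part.
  have key := expShift_eq_sum_antidiagonal (V := ℤ → R) (c := ε) (twistOp κ D)
    (fun a p i => w p • expOp ε D a (b (i - p)))
    (fun k a p i => D k (w p • expOp ε D a (b (i - p))))
    (fun k a p i => κ • w p • expOp ε D a (b (i - k - p))) (fun k a p => rfl) ?_ ?_ n
  · have h0 : (fun i => w 0 • expOp ε D 0 (b (i - (0 : ℕ)))) = b := by
      ext i; simp [w0]
    rw [h0] at key
    rw [expOp_apply, key, Finset.sum_apply]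
  · intro a p
    ext i
    simp only [Pi.smul_apply, Finset.sum_apply]
    rw [smul_comm, ← LinearMap.smul_apply, smul_expOp_succ]
    simp [smul_sum, smul_comm ε]
  · intro a p
    ext i
    simp only [Pi.smul_apply, Finset.sum_apply, smul_smul, hw, smul_sum, mul_sum, sum_smul]
    refine sum_congr rfl fun q hq => ?_
    have hq' := mem_antidiagonal.1 hq
    rw [show i - ((p + 1 : ℕ) : ℤ) = i - ((q.1 + 1 : ℕ) : ℤ) - (q.2 : ℤ) by omega, mul_assoc]

/-- `1 - z`, by its coefficients. -/
def oneSub : ℕ → ℂ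
  | 0 => 1
  | 1 => -1
  | _ + 2 => 0

/-- This is $1-z=\exp(-\sum_kz^k/k)$ in the form of the exponential recursion. -/
lemma oneSub_rec (n : ℕ) :
    ((n : ℂ) + 1) * oneSub (n + 1) = (-1) * 1 * ∑ p ∈ antidiagonal n, oneSub p.2 := by
  cases n with
  | zero => simp [oneSub]
  | succ n =>
    rw [Nat.sum_antidiagonal_succ', ]
    cases n with
    | zero => simp [oneSub]
    | succ n =>
      rw [Nat.sum_antidiagonal_succ']
      simp [oneSub]

lemma expOp_neg_one_twistOp_one (D : ℕ → Module.End ℂ R) (n : ℕ) (b : ℤ → R) (i : ℤ) :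
    expOp (-1) (twistOp 1 D) (n + 1) b i =
      expOp (-1) D (n + 1) (b i) - expOp (-1) D n (b (i - 1)) := by
  rw [expOp_twistOp D oneSub rfl oneSub_rec, Nat.sum_antidiagonal_succ']
  cases n with
  | zero => simp [oneSub, sub_eq_add_neg]
  | succ n =>
    rw [Nat.sum_antidiagonal_succ']
    simp [oneSub, sub_eq_add_neg]

/-- Here the scalar factor is $\exp(\sum_kz^k/k)=1/(1-z)$, whose coefficients are all $1$. -/
lemma expOp_twistOp_of_mul_eq_one {ε κ : ℂ} (h : ε * κ = 1) (D : ℕ → Module.End ℂ R) (n : ℕ)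
    (b : ℤ → R) (i : ℤ) : expOp ε (twistOp κ D) n b i =
      ∑ p ∈ antidiagonal n, expOp ε D p.1 (b (i - p.2)) := by
  rw [expOp_twistOp D (fun _ => 1) rfl (fun n => by simp [h])]
  simp

end Twist

/-! ### Shifted tau functions and the span on which the residue vanishes -/

section Fay

open Finset hiding antidiagonal mem_antidiagonal
open Finset.HasAntidiagonal (antidiagonal mem_antidiagonal)

variable {R : Type} [CommRing R] [Algebra ℂ R]

/-- The coefficients of `exp (-∑ ν ^ (-k) / k · D_k) τ`. -/
def shiftNeg (D : ℕ → Module.End ℂ R) (τ : R) (i : ℤ) : R :=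
  if i ≤ 0 then expOp (-1) D (-i).toNat τ else 0

/-- The coefficients of `exp (∑ ν ^ (-k) / k · D_k) τ`. -/
def shiftPos (D : ℕ → Module.End ℂ R) (τ : R) (i : ℤ) : R :=
  if i ≤ 0 then expOp 1 D (-i).toNat τ else 0

variable {D : ℕ → Module.End ℂ R}

lemma shiftNeg_of_pos {τ : R} {i : ℤ} (hi : 0 < i) : shiftNeg D τ i = 0 := by
  simp [shiftNeg, hi]

lemma shiftPos_of_pos {τ : R} {i : ℤ} (hi : 0 < i) : shiftPos D τ i = 0 := by
  simp [shiftPos, hi]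

lemma shiftNeg_neg (τ : R) (n : ℕ) : shiftNeg D τ (-n) = expOp (-1) D n τ := by
  simp [shiftNeg]

lemma shiftPos_neg (τ : R) (n : ℕ) : shiftPos D τ (-n) = expOp 1 D n τ := by
  simp [shiftPos]

/-- The family `exp (∑ μ ^ (-k) / k · (D_k + ν ^ k)) exp (-∑ ν ^ (-k) / k · D_k) τ`. -/
def crossShift (D : ℕ → Module.End ℂ R) (τ : R) (c : ℕ) : ℤ → R :=
  expOp 1 (twistOp 1 D) c (shiftNeg D τ)

/-- The generating function is $\tau(t+[\mu^{-1}]-[\nu^{-1}])/(1-\nu/\mu)$; the recursion is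
multiplication by $1-\nu/\mu$. -/
lemma crossShift_succ (τ : R) (c : ℕ) (r : ℤ) : crossShift D τ (c + 1) (r + 1) =
    expOp 1 D (c + 1) (shiftNeg D τ (r + 1)) + crossShift D τ c r := by
  rw [crossShift, crossShift, expOp_twistOp_of_mul_eq_one (mul_one 1),
    expOp_twistOp_of_mul_eq_one (mul_one 1), Nat.sum_antidiagonal_succ']
  simp

/-- The coefficient of $\nu^0$ collects all products of the two opposite shifts of total degree $c$,
as if $\mu=\nu$; there the shifts cancel. -/
lemma crossShift_zero_right (hD : ∀ j k, Commute (D j) (D k)) (τ : R) (c : ℕ) :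
    crossShift D τ c 0 = if c = 0 then τ else 0 := by
  have key := congrArg (fun T : Module.End ℂ R => T τ) (sum_expOp_mul_expOp hD c)
  simp only [LinearMap.sum_apply] at key
  rw [crossShift, expOp_twistOp_of_mul_eq_one (mul_one 1)]
  trans (if c = 0 then (1 : Module.End ℂ R) else 0) τ
  · rw [← key, ← Nat.sum_antidiagonal_swap]
    refine sum_congr rfl fun p _ => ?_
    rw [Prod.fst_swap, Prod.snd_swap, zero_sub, shiftNeg_neg,
      (commute_expOp (fun k => (commute_expOp (fun j => hD k j) p.1).symm) p.2).eq]
    rfl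
  · split_ifs <;> simp

lemma crossShift_natCast (hD : ∀ j k, Commute (D j) (D k)) (τ : R) (c r : ℕ) :
    crossShift D τ c r = if r = c then τ else 0 := by
  induction r generalizing c with
  | zero => simp [crossShift_zero_right hD, eq_comm]
  | succ r ih =>
    cases c with
    | zero => simp [crossShift, shiftNeg_of_pos]
    | succ c =>
      rw [Nat.cast_succ, crossShift_succ, shiftNeg_of_pos (by positivity), ih]
      simp

lemma crossShift_neg_one (hD : ∀ j k, Commute (D j) (D k)) (τ : R) (c : ℕ) :
    crossShift D τ c (-1) = -expOp 1 D (c + 1) τ := by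
  have := crossShift_succ (D := D) τ c (-1)
  rw [neg_add_cancel, crossShift_zero_right hD] at this
  simpa [shiftNeg, eq_neg_iff_add_eq_zero, add_comm] using this.symm

lemma crossShift_neg_two (hD : ∀ j k, Commute (D j) (D k)) (τ : R) (c : ℕ) :
    crossShift D τ c (-2) = -expOp 1 D (c + 2) τ + D 1 (expOp 1 D (c + 1) τ) := by
  have := crossShift_succ (D := D) τ c (-2)
  rw [show (-2 + 1 : ℤ) = -((1 : ℕ) : ℤ) by rfl, shiftNeg_neg, expOp_one, Nat.cast_one,
    crossShift_neg_one hD, ← Module.End.mul_apply, mul_smul_comm,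
    ← (commute_expOp (fun k => hD 1 k) (c + 1)).eq] at this
  rw [this]
  simp

/-- The `R`-linear span of the families obtained from `φ` by applying the twisted operators. -/
def twistSpan (D : ℕ → Module.End ℂ R) (φ : ℤ → R) : Submodule R (ℤ → R) :=
  Submodule.span R {b | ∃ l : List ℕ, (∀ k ∈ l, 1 ≤ k) ∧ l.foldr (fun k b => twistOp 1 D k b) φ = b}

/-- By the Leibniz rule a twisted operator applied to $r\cdot b$ differs from $r$ times its value on
$b$ by $(D_{k+1}r)\cdot b$. Closure holds only because the span has coefficients in $R$. -/
lemma twistOp_mem_twistSpan {D : ℕ → Derivation ℂ R R} {φ : ℤ → R} (k : ℕ) (b : ℤ → R)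
    (hb : b ∈ twistSpan (fun k => D k) φ) :
    twistOp 1 (fun k => (D k : Module.End ℂ R)) (k + 1) b ∈ twistSpan (fun k => D k) φ := by
  induction hb using Submodule.span_induction with
  | mem b hb =>
    obtain ⟨l, hl, rfl⟩ := hb
    exact Submodule.subset_span ⟨(k + 1) :: l, by simpa using hl, rfl⟩
  | zero => simp
  | add x y _ _ hx hy => rw [map_add]; exact Submodule.add_mem _ hx hy
  | smul r x hx' hx =>
    have : twistOp 1 (fun k => (D k : Module.End ℂ R)) (k + 1) (r • x) =
        (D (k + 1) r) • x + r • twistOp 1 (fun k => (D k : Module.End ℂ R)) (k + 1) x := by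
      ext i
      simp [twistOp_apply]
      ring
    rw [this]
    exact Submodule.add_mem _ (Submodule.smul_mem _ _ hx') (Submodule.smul_mem _ _ hx)

lemma expOp_mem_twistSpan {D : ℕ → Derivation ℂ R R} {φ : ℤ → R} (c : ℂ) (n : ℕ) {b : ℤ → R}
    (hb : b ∈ twistSpan (fun k => D k) φ) :
    expOp c (twistOp 1 (fun k => (D k : Module.End ℂ R))) n b ∈ twistSpan (fun k => D k) φ :=
  expOp_mem ((twistSpan (fun k => (D k : Module.End ℂ R)) φ).restrictScalars ℂ)
    (fun k b hb => twistOp_mem_twistSpan k b hb) n hb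

variable {ev : R →ₐ[ℂ] ℂ} {s : ℤ → ℂ} {φ : ℤ → R}

/-- A family is annihilated by the residue pairing with `s`. -/
structure ResEqZero (ev : R →ₐ[ℂ] ℂ) (s : ℤ → ℂ) (b : ℤ → R) : Prop where
  bddAbove : ∃ B, ∀ i, B < i → b i = 0
  finsum_eq_zero : ∑ᶠ i : ℤ, ev (b i) * s (-1 - i) = 0

/-- Finiteness is needed for additivity of the residue, because `finsum` is zero by default on an
infinite support. -/
lemma finite_support_pairing (hs : ∀ i, 0 < i → s i = 0) {b : ℤ → R}
    (hb : ∃ B, ∀ i, B < i → b i = 0) :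
    (Function.support fun i : ℤ => ev (b i) * s (-1 - i)).Finite := by
  obtain ⟨B, hB⟩ := hb
  refine (Set.finite_Icc (-1) B).subset fun i hi => ?_
  by_contra hi'
  apply hi
  rcases lt_or_ge B i with h | h
  · simp [hB i h]
  · have : i < -1 := by by_contra h2; exact hi' ⟨by omega, h⟩
    simp [hs (-1 - i) (by omega)]

lemma foldr_twistOp_eq_zero {B : ℤ} (hφ : ∀ i, B < i → φ i = 0) (l : List ℕ) :
    ∃ B', ∀ i, B' < i → l.foldr (fun k b => twistOp 1 D k b) φ i = 0 := by
  induction l with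
  | nil => exact ⟨B, hφ⟩
  | cons k l ih =>
    obtain ⟨B', hB'⟩ := ih
    refine ⟨B' + k, fun i hi => ?_⟩
    rw [List.foldr_cons, twistOp_apply, hB' i (by omega), hB' _ (by omega)]
    simp

lemma resEqZero_of_mem_twistSpan (hs : ∀ i, 0 < i → s i = 0) {B : ℤ} (hφ : ∀ i, B < i → φ i = 0)
    (h : ∀ l : List ℕ, (∀ k ∈ l, 1 ≤ k) →
      ∑ᶠ i : ℤ, ev (l.foldr (fun k b => twistOp 1 D k b) φ i) * s (-1 - i) = 0)
    {b : ℤ → R} (hb : b ∈ twistSpan D φ) : ResEqZero ev s b := by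
  induction hb using Submodule.span_induction with
  | mem b hb =>
    obtain ⟨l, hl, rfl⟩ := hb
    exact ⟨foldr_twistOp_eq_zero hφ l, h l hl⟩
  | zero => exact ⟨⟨0, by simp⟩, by simp⟩
  | add x y _ _ hx hy =>
    refine ⟨?_, ?_⟩
    · obtain ⟨B, hB⟩ := hx.1
      obtain ⟨B', hB'⟩ := hy.1
      refine ⟨max B B', fun i hi => ?_⟩
      rw [Pi.add_apply, hB i (by omega), hB' i (by omega), add_zero]
    · simp only [Pi.add_apply, map_add, add_mul]
      rw [finsum_add_distrib (finite_support_pairing hs hx.1) (finite_support_pairing hs hy.1),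
        hx.2, hy.2, add_zero]
  | smul r x _ hx =>
    refine ⟨?_, ?_⟩
    · obtain ⟨B, hB⟩ := hx.1
      exact ⟨B, fun i hi => by simp [hB i hi]⟩
    · simp only [Pi.smul_apply, smul_eq_mul, map_mul, mul_assoc]
      rw [← mul_finsum, hx.2, mul_zero]

end Fay

/-! ### The differential Fay identity from the bilinear identity -/

section DifferentialFay

open Finset hiding antidiagonal mem_antidiagonal
open Finset.HasAntidiagonal (antidiagonal mem_antidiagonal)

variable {R : Type} [CommRing R] [Algebra ℂ R]

/-- The bilinear identity for a unit `τ` of a differential algebra `R`, evaluated at a point. -/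
structure BilinearAt (D : ℕ → Derivation ℂ R R) (ev : R →ₐ[ℂ] ℂ) (τ τ' : R) : Prop where
  comm : ∀ j k, Commute (D j : Module.End ℂ R) (D k : Module.End ℂ R)
  mul_eq_one : τ * τ' = 1
  bilinear : ∀ l : List ℕ, (∀ k ∈ l, 1 ≤ k) → ∑ᶠ i : ℤ,
    ev (l.foldr (fun k b => twistOp 1 (fun k => (D k : Module.End ℂ R)) k b)
      (τ' • shiftNeg (fun k => D k) τ) i) * (ev (shiftPos (fun k => D k) τ (-1 - i)) / ev τ) = 0

variable {D : ℕ → Derivation ℂ R R} {ev : R →ₐ[ℂ] ℂ} {τ τ' : R}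

lemma BilinearAt.ev_mul (h : BilinearAt D ev τ τ') : ev τ * ev τ' = 1 := by
  rw [← map_mul, h.mul_eq_one, map_one]

lemma BilinearAt.ev_ne_zero (h : BilinearAt D ev τ τ') : ev τ ≠ 0 :=
  left_ne_zero_of_mul_eq_one h.ev_mul

/-- The denominators of the Baker–Akhiezer functions are cleared: the numerator of $\varphi$ is
$\tau$ times $\varphi$ and so lies in the span, while $1/\tau$ in $\varphi^*$ is a nonzero constant
at the point. -/
lemma BilinearAt.finsum_eq_zero (h : BilinearAt D ev τ τ') {b : ℤ → R}
    (hb : b ∈ twistSpan (fun k => (D k : Module.End ℂ R)) (shiftNeg (fun k => D k) τ)) :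
    ∑ᶠ i : ℤ, ev (b i) * ev (shiftPos (fun k => D k) τ (-1 - i)) = 0 := by
  have hb' : b ∈ twistSpan (fun k => (D k : Module.End ℂ R))
      (τ' • shiftNeg (fun k => D k) τ) := by
    have hψ : shiftNeg (fun k => (D k : Module.End ℂ R)) τ ∈
        twistSpan (fun k => (D k : Module.End ℂ R)) (τ' • shiftNeg (fun k => D k) τ) := by
      have h1 : shiftNeg (fun k => (D k : Module.End ℂ R)) τ =
          τ • τ' • shiftNeg (fun k => D k) τ := by
        rw [smul_smul, h.mul_eq_one, one_smul]
      rw [h1]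
      conv_lhs => rw [← h1]
      exact Submodule.smul_mem _ _ (Submodule.subset_span ⟨[], by simp, rfl⟩)
    induction hb using Submodule.span_induction with
    | mem b hb =>
      obtain ⟨l, hl, rfl⟩ := hb
      induction l with
      | nil => exact hψ
      | cons k l ih =>
        obtain ⟨k, rfl⟩ := Nat.exists_eq_succ_of_ne_zero
          (Nat.one_le_iff_ne_zero.1 (hl k List.mem_cons_self))
        exact twistOp_mem_twistSpan k _ (ih fun j hj => hl j (List.mem_cons_of_mem _ hj))
    | zero => exact Submodule.zero_mem _
    | add x y _ _ hx hy => exact Submodule.add_mem _ hx hy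
    | smul r x _ hx => exact Submodule.smul_mem _ _ hx
  have := (resEqZero_of_mem_twistSpan (ev := ev)
    (s := fun i => ev (shiftPos (fun k => D k) τ i) / ev τ) (B := 0)
    (fun i hi => by simp [shiftPos_of_pos hi])
    (fun i hi => by simp [shiftNeg_of_pos hi]) h.bilinear hb').finsum_eq_zero
  simp only [div_eq_mul_inv, ← mul_assoc] at this
  rw [← finsum_mul, mul_eq_zero] at this
  exact this.resolve_right (inv_ne_zero h.ev_ne_zero)

/-- Two terms survive: indices below $-1$ meet a vanishing coefficient of $\tau(t+[\nu^{-1}])$, and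
among the indices $i\ge0$ only the diagonal one $i=c$ contributes. -/
lemma finsum_crossShift (hD : ∀ j k, Commute (D j : Module.End ℂ R) (D k : Module.End ℂ R))
    (S : Module.End ℂ R) (c : ℕ) :
    ∑ᶠ i : ℤ, ev (S (crossShift (fun k => D k) τ c i)) *
        ev (shiftPos (fun k => D k) τ (-1 - i)) =
      ev (S τ) * ev (expOp 1 (fun k => (D k : Module.End ℂ R)) (c + 1) τ) -
        ev (S (expOp 1 (fun k => (D k : Module.End ℂ R)) (c + 1) τ)) * ev τ := by
  rw [finsum_eq_sum_of_support_subset (s := {-1, (c : ℤ)}), sum_pair (by omega)]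
  · rw [crossShift_neg_one hD, crossShift_natCast hD, if_pos rfl,
      show (-1 - -1 : ℤ) = -((0 : ℕ) : ℤ) by simp,
      show (-1 - c : ℤ) = -((c + 1 : ℕ) : ℤ) by push_cast; ring, shiftPos_neg, shiftPos_neg]
    simp
    ring
  · intro i hi
    by_contra hi'
    apply hi
    simp only [coe_insert, coe_singleton, Set.mem_insert_iff, Set.mem_singleton_iff, not_or] at hi'
    rcases lt_or_ge i 0 with h | h
    · simp [shiftPos_of_pos (show 0 < -1 - i by omega)]
    · obtain ⟨r, rfl⟩ := Int.eq_ofNat_of_zero_le h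
      beta_reduce
      rw [crossShift_natCast hD, if_neg (by omega)]
      simp

lemma finsum_crossShift_sub_one
    (hD : ∀ j k, Commute (D j : Module.End ℂ R) (D k : Module.End ℂ R))
    (S : Module.End ℂ R) (c : ℕ) :
    ∑ᶠ i : ℤ, ev (S (crossShift (fun k => D k) τ c (i - 1))) *
        ev (shiftPos (fun k => D k) τ (-1 - i)) =
      ev (S τ) * ev (expOp 1 (fun k => (D k : Module.End ℂ R)) (c + 2) τ) -
        ev (S (expOp 1 (fun k => (D k : Module.End ℂ R)) (c + 2) τ)) * ev τ +
        ev (S (D 1 (expOp 1 (fun k => (D k : Module.End ℂ R)) (c + 1) τ))) * ev τ -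
        ev (S (expOp 1 (fun k => (D k : Module.End ℂ R)) (c + 1) τ)) * ev (D 1 τ) := by
  rw [finsum_eq_sum_of_support_subset (s := {-1, 0, (c + 1 : ℤ)}),
    sum_insert (by simp; omega), sum_pair (by omega)]
  · rw [zero_sub, crossShift_neg_one hD, add_sub_cancel_right, crossShift_natCast hD, if_pos rfl,
      show (-1 - -1 : ℤ) = -((0 : ℕ) : ℤ) by simp, show (-1 - 1 : ℤ) = -2 by rfl,
      crossShift_neg_two hD, show (-1 - 0 : ℤ) = -((1 : ℕ) : ℤ) by simp,
      show (-1 - (c + 1) : ℤ) = -((c + 2 : ℕ) : ℤ) by push_cast; ring, shiftPos_neg, shiftPos_neg,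
      shiftPos_neg, expOp_one]
    simp
    ring
  · intro i hi
    by_contra hi'
    apply hi
    simp only [coe_insert, coe_singleton, Set.mem_insert_iff, Set.mem_singleton_iff, not_or] at hi'
    rcases lt_or_ge i 1 with h | h
    · simp [shiftPos_of_pos (show 0 < -1 - i by omega)]
    · obtain ⟨r, hr⟩ := Int.eq_ofNat_of_zero_le (sub_nonneg.2 h)
      beta_reduce
      rw [hr, crossShift_natCast hD, if_neg (by omega)]
      simp

/-- The operator `f ↦ τ ∂_1 f - f ∂_1 τ`, that is `τ ^ 2 ∂_1 (f / τ)`. -/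
def wronskian (D : ℕ → Derivation ℂ R R) (τ : R) : R →ₗ[ℂ] R :=
  LinearMap.mulLeft ℂ τ ∘ₗ (D 1 : R →ₗ[ℂ] R) - LinearMap.mulLeft ℂ (D 1 τ)

lemma wronskian_apply (f : R) : wronskian D τ f = τ * D 1 f - D 1 τ * f := rfl

/-- The coefficient of `λ ^ i μ ^ j` in
`τ(t - [λ⁻¹]) τ(t + [μ⁻¹]) - τ(t - [λ⁻¹] + [μ⁻¹]) τ(t)`. -/
def fayDefect (D : ℕ → Derivation ℂ R R) (τ : R) (a : ℕ) (j : ℤ) : R :=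
  expOp (-1) (fun k => (D k : Module.End ℂ R)) a τ * shiftPos (fun k => D k) τ j -
    expOp (-1) (fun k => (D k : Module.End ℂ R)) a (shiftPos (fun k => D k) τ j) * τ

lemma fayDefect_zero (j : ℤ) : fayDefect D τ 0 j = 0 := by
  simp [fayDefect, mul_comm]

/-- The differential Fay identity. -/
lemma BilinearAt.differential_fay (h : BilinearAt D ev τ τ') (a : ℕ) (j : ℤ) :
    ev (fayDefect D τ (a + 1) j) - ev (fayDefect D τ a (j - 1)) =
      ev (wronskian D τ (expOp (-1) (fun k => (D k : Module.End ℂ R)) a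
        (shiftPos (fun k => D k) τ j))) := by
  rcases lt_or_ge 1 j with hj | hj
  · simp [fayDefect, shiftPos_of_pos (show 0 < j by omega),
      shiftPos_of_pos (show 0 < j - 1 by omega)]
  obtain ⟨n, hn⟩ := Int.eq_ofNat_of_zero_le (sub_nonneg.2 hj)
  obtain rfl : j = 1 - n := by omega
  match n with
  | 0 => simp [fayDefect, shiftPos, wronskian_apply, mul_comm]
  | 1 =>
    rw [show (1 - (1 : ℕ) - 1 : ℤ) = -((1 : ℕ) : ℤ) by simp,
      show (1 - (1 : ℕ) : ℤ) = -((0 : ℕ) : ℤ) by simp]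
    simp only [fayDefect, shiftPos_neg, expOp_one, wronskian_apply]
    have := LinearMap.congr_fun (commute_expOp (c := -1) (fun k => h.comm 1 k) a).eq τ
    simp only [Module.End.mul_apply, Derivation.coeFn_coe] at this
    simp [← this]
    ring
  | c + 2 =>
    rw [show (1 - (c + 2 : ℕ) - 1 : ℤ) = -((c + 2 : ℕ) : ℤ) by push_cast; ring,
      show (1 - (c + 2 : ℕ) : ℤ) = -((c + 1 : ℕ) : ℤ) by push_cast; ring]
    -- The bilinear identity is used at $t'=t-[\lambda^{-1}]+[\mu^{-1}]$, coefficient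
    -- $\lambda^{-(a+1)}\mu^{-c}$. The positive shift supplies $1/(1-\nu/\mu)$; the negative one
    -- supplies $1-\nu/\lambda$, which splits the residue into the two sums already evaluated.
    have hmem := expOp_mem_twistSpan (D := D) (-1) (a + 1) (expOp_mem_twistSpan (D := D) 1 c
      (Submodule.subset_span (s := {b | ∃ l : List ℕ, (∀ k ∈ l, 1 ≤ k) ∧
        l.foldr (fun k b => twistOp 1 (fun k => (D k : Module.End ℂ R)) k b)
          (shiftNeg (fun k => D k) τ) = b}) ⟨[], by simp, rfl⟩))
    have key := h.finsum_eq_zero hmem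
    simp only [expOp_neg_one_twistOp_one, map_sub, sub_mul] at key
    rw [List.foldr_nil, ← crossShift] at key
    have hs : ∀ i, 0 < i → ev (shiftPos (fun k => (D k : Module.End ℂ R)) τ i) = 0 :=
      fun i hi => by simp [shiftPos_of_pos hi]
    have hbdd : ∀ i : ℤ, (c : ℤ) < i →
        crossShift (fun k => (D k : Module.End ℂ R)) τ c i = 0 := fun i hi => by
      obtain ⟨r, rfl⟩ := Int.eq_ofNat_of_zero_le (show 0 ≤ i by omega)
      rw [crossShift_natCast h.comm, if_neg (by omega)]
    rw [finsum_sub_distrib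
      (finite_support_pairing (ev := ev)
        (b := fun i => expOp (-1) (fun k => (D k : Module.End ℂ R)) (a + 1)
        (crossShift (fun k => (D k : Module.End ℂ R)) τ c i)) hs
        ⟨c, fun i hi => by simp only [hbdd i hi, map_zero]⟩)
      (finite_support_pairing (ev := ev)
        (b := fun i => expOp (-1) (fun k => (D k : Module.End ℂ R)) a
        (crossShift (fun k => (D k : Module.End ℂ R)) τ c (i - 1))) hs
        ⟨c + 1, fun i hi => by simp only [hbdd (i - 1) (by omega), map_zero]⟩),
      finsum_crossShift h.comm, finsum_crossShift_sub_one h.comm] at key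
    have hc := LinearMap.congr_fun (commute_expOp (c := -1) (fun k => h.comm 1 k) a).eq
      (expOp 1 (fun k => (D k : Module.End ℂ R)) (c + 1) τ)
    simp only [Module.End.mul_apply, Derivation.coeFn_coe] at hc
    simp only [fayDefect, shiftPos_neg, wronskian_apply, hc, map_sub, map_mul]
    linear_combination key

/-- The coefficients of `1 / (λ - μ) τ(t - [λ⁻¹] + [μ⁻¹])`, `|λ| > |μ|`. -/
def fayQuotient (D : ℕ → Derivation ℂ R R) (τ : R) (n : ℕ) (m : ℤ) : R :=
  ∑ p ∈ antidiagonal n, expOp (-1) (fun k => (D k : Module.End ℂ R)) p.1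
    (shiftPos (fun k => D k) τ (m - p.2))

lemma fayQuotient_succ (n : ℕ) (m : ℤ) : fayQuotient D τ (n + 1) m =
    expOp (-1) (fun k => (D k : Module.End ℂ R)) (n + 1) (shiftPos (fun k => D k) τ m) +
      fayQuotient D τ n (m - 1) := by
  rw [fayQuotient, Nat.sum_antidiagonal_succ', fayQuotient]
  simp [sub_sub, add_comm]

/-- Division of the Fay identity by $\lambda-\mu$: along $(n+1,m),(n,m-1),\dots$ the differences of
defects telescope down to the vanishing defect at $a=0$. -/
lemma BilinearAt.ev_wronskian_fayQuotient (h : BilinearAt D ev τ τ') (n : ℕ) (m : ℤ) :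
    ev (wronskian D τ (fayQuotient D τ n m)) = ev (fayDefect D τ (n + 1) m) := by
  induction n generalizing m with
  | zero =>
    have := h.differential_fay 0 m
    rw [fayDefect_zero, map_zero, sub_zero] at this
    rw [this]
    simp [fayQuotient]
  | succ n ih =>
    rw [fayQuotient_succ, map_add, map_add, ih, ← h.differential_fay]
    ring

/-- `res ν ^ n φ φ* = ∂_n ∂_1 log τ`. -/
lemma BilinearAt.sum_antidiagonal_eq (h : BilinearAt D ev τ τ') (n : ℕ) (hn : 1 ≤ n) :
    ∑ p ∈ antidiagonal (n + 1), ev (expOp (-1) (fun k => (D k : Module.End ℂ R)) p.1 τ) *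
        ev (expOp 1 (fun k => (D k : Module.End ℂ R)) p.2 τ) =
      ev τ * ev (D n (D 1 τ)) - ev (D n τ) * ev (D 1 τ) := by
  have hmem : twistOp 1 (fun k => (D k : Module.End ℂ R)) n (shiftNeg (fun k => D k) τ) ∈
      twistSpan (fun k => (D k : Module.End ℂ R)) (shiftNeg (fun k => D k) τ) :=
    Submodule.subset_span ⟨[n], by simpa using hn, rfl⟩
  have key := h.finsum_eq_zero hmem
  -- The exponents run over $-1,\dots,n$. The derivative term contributes only at $-1$ and $0$ and
  -- yields the right-hand side; the terms with the factor $\nu^n$ form the left-hand side.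
  rw [finsum_eq_sum_of_support_subset (s := (range (n + 2)).image fun j : ℕ => (j : ℤ) - 1),
    sum_image (fun a _ b _ hab => by simpa using hab), sum_range_succ', sum_range_succ'] at key
  · have h2 : ∑ p ∈ antidiagonal (n + 1),
        ev (expOp (-1) (fun k => (D k : Module.End ℂ R)) p.1 τ) *
          ev (expOp 1 (fun k => (D k : Module.End ℂ R)) p.2 τ) =
        ∑ j ∈ range (n + 2), ev (shiftNeg (fun k => (D k : Module.End ℂ R)) τ ((j : ℤ) - 1 - n)) *
          ev (shiftPos (fun k => (D k : Module.End ℂ R)) τ (-1 - ((j : ℤ) - 1))) := by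
      rw [← Nat.sum_antidiagonal_swap, Nat.sum_antidiagonal_eq_sum_range_succ_mk]
      refine sum_congr rfl fun j hj => ?_
      have : j ≤ n + 1 := by simpa [Nat.lt_succ_iff] using hj
      rw [show ((j : ℤ) - 1 - n) = -((n + 1 - j : ℕ) : ℤ) by omega,
        show (-1 - ((j : ℤ) - 1)) = -(j : ℤ) by ring, shiftNeg_neg, shiftPos_neg]
      rfl
    rw [h2, sum_range_succ', sum_range_succ']
    have h3 : ∀ j ∈ range n,
        ev (twistOp 1 (fun k => (D k : Module.End ℂ R)) n (shiftNeg (fun k => D k) τ)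
          (((j + 1 + 1 : ℕ) : ℤ) - 1)) =
        ev (shiftNeg (fun k => (D k : Module.End ℂ R)) τ (((j + 1 + 1 : ℕ) : ℤ) - 1 - n)) := by
      intro j _
      rw [twistOp_apply, shiftNeg_of_pos (i := ((j + 1 + 1 : ℕ) : ℤ) - 1) (by push_cast; omega)]
      simp
    rw [sum_congr rfl fun j hj => by rw [h3 j hj]] at key
    have e0 : ((0 : ℕ) : ℤ) - 1 = -((1 : ℕ) : ℤ) := by simp
    have e1 : ((0 + 1 : ℕ) : ℤ) - 1 = -((0 : ℕ) : ℤ) := by simp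
    have f0 : -1 - -((1 : ℕ) : ℤ) = -((0 : ℕ) : ℤ) := by simp
    have f1 : -1 - -((0 : ℕ) : ℤ) = -((1 : ℕ) : ℤ) := by simp
    simp only [twistOp_apply, e0, e1, f0, f1, shiftNeg_neg, shiftPos_neg, expOp_one, expOp_zero,
      map_add, add_mul, one_smul, Module.End.one_apply, LinearMap.smul_apply, neg_smul, map_neg,
      Derivation.coeFn_coe] at key ⊢
    linear_combination key
  · intro i hi
    by_contra hi'
    apply hi
    have hi'' : i < -1 ∨ n < i := by
      by_contra h4
      apply hi'
      refine mem_coe.2 (mem_image.2 ⟨(i + 1).toNat, mem_range.2 (by omega), by omega⟩)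
    rcases hi'' with h4 | h4
    · simp [shiftPos_of_pos (show 0 < -1 - i by omega)]
    · beta_reduce
      rw [twistOp_apply, shiftNeg_of_pos (by omega), shiftNeg_of_pos (by omega)]
      simp

end DifferentialFay

/-! ### Analyticity in finitely many times -/

section Analytic

/-- The displacement `∑ s_i e_{i+1}` of the times `t_1, …, t_n`. -/
def displacement (n : ℕ) : (Fin n → ℂ) →ₗ[ℂ] Times where
  toFun s := ∑ i, s i • e ((i : ℕ) + 1)
  map_add' s s' := by simp [add_smul, Finset.sum_add_distrib]
  map_smul' c s := by simp [mul_smul, Finset.smul_sum]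

lemma displacement_apply (n : ℕ) (s : Fin n → ℂ) :
    displacement n s = ∑ i, s i • e ((i : ℕ) + 1) := rfl

lemma displacement_single {n k : ℕ} (hk : k < n) :
    displacement n (Pi.single ⟨k, hk⟩ 1) = e (k + 1) := by
  rw [displacement_apply, Finset.sum_eq_single ⟨k, hk⟩]
  · simp
  · intro j _ hj
    simp [hj]
  · simp

/-- Analyticity at `t` in any finite number of the times `t_1, t_2, …`. -/
def AnalyticTimesAt (F : Times → ℂ) (t : Times) : Prop :=
  ∀ n : ℕ, AnalyticAt ℂ (fun s => F (t + displacement n s)) 0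

/-- A set that is open in any finite number of the times `t_1, t_2, …`. -/
def OpenTimes (U : Set Times) : Prop :=
  ∀ t ∈ U, ∀ n : ℕ, ∀ᶠ s in 𝓝 0, t + displacement n s ∈ U

lemma tendsto_smul_single {n : ℕ} (i : Fin n) :
    Tendsto (fun z : ℂ => z • (Pi.single i 1 : Fin n → ℂ)) (𝓝 0) (𝓝 0) := by
  have : Continuous fun z : ℂ => z • (Pi.single i 1 : Fin n → ℂ) := by fun_prop
  simpa using this.tendsto 0

lemma displacement_smul_single (k : ℕ) (z : ℂ) :
    displacement (k + 1) (z • Pi.single ⟨k, k.lt_succ_self⟩ 1) = z • e (k + 1) := by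
  rw [map_smul, displacement_single]

lemma OpenTimes.eventually_line {U : Set Times} (hU : OpenTimes U) {t : Times} (ht : t ∈ U)
    (k : ℕ) : ∀ᶠ z : ℂ in 𝓝 0, t + z • e (k + 1) ∈ U := by
  filter_upwards [(tendsto_smul_single ⟨k, k.lt_succ_self⟩).eventually (hU t ht (k + 1))] with z hz
  rwa [displacement_smul_single] at hz

lemma AnalyticTimesAt.analyticAt_line {F : Times → ℂ} {t : Times} (hF : AnalyticTimesAt F t)
    (k : ℕ) : AnalyticAt ℂ (fun z : ℂ => F (t + z • e (k + 1))) 0 := by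
  have h1 : AnalyticAt ℂ (fun z : ℂ => z • (Pi.single ⟨k, k.lt_succ_self⟩ 1 : Fin (k + 1) → ℂ)) 0 :=
    (ContinuousLinearMap.toSpanSingleton ℂ
      (Pi.single ⟨k, k.lt_succ_self⟩ 1 : Fin (k + 1) → ℂ)).analyticAt 0
  have h2 : AnalyticAt ℂ (fun s => F (t + displacement (k + 1) s))
      ((0 : ℂ) • (Pi.single ⟨k, k.lt_succ_self⟩ 1 : Fin (k + 1) → ℂ)) := by
    rw [zero_smul]; exact hF (k + 1)
  have := h2.comp_of_eq h1 rfl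
  simpa only [Function.comp_def, displacement_smul_single] using this

lemma AnalyticTimesAt.hasLineDerivAt {F : Times → ℂ} {t : Times} (hF : AnalyticTimesAt F t)
    (k : ℕ) : HasLineDerivAt ℂ F (pd (k + 1) F t) t (e (k + 1)) :=
  LineDifferentiableAt.hasLineDerivAt (hF.analyticAt_line k).differentiableAt

lemma AnalyticTimesAt.congr {U : Set Times} (hU : OpenTimes U) {F G : Times → ℂ} {t : Times}
    (hF : AnalyticTimesAt F t) (ht : t ∈ U) (h : ∀ s ∈ U, F s = G s) : AnalyticTimesAt G t :=
  fun n => (hF n).congr ((hU t ht n).mono fun _ hs => h _ hs)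

/-- Precomposition with the linear inclusion $\mathbb C^n\to\mathbb C^m$ that pads with zeros. -/
lemma analyticAt_displacement_of_le {F : Times → ℂ} {t : Times} {n m : ℕ} (hnm : n ≤ m)
    (h : AnalyticAt ℂ (fun s => F (t + displacement m s)) 0) :
    AnalyticAt ℂ (fun s => F (t + displacement n s)) 0 := by
  let L : (Fin n → ℂ) →ₗ[ℂ] (Fin m → ℂ) :=
    { toFun := fun s j => if hj : (j : ℕ) < n then s ⟨j, hj⟩ else 0
      map_add' := fun s s' => by
        ext j
        simp only [Pi.add_apply]
        split_ifs <;> simp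
      map_smul' := fun c s => by
        ext j
        simp only [Pi.smul_apply, RingHom.id_apply]
        split_ifs <;> simp }
  have hL : ∀ s, displacement m (L s) = displacement n s := by
    intro s
    rw [displacement_apply, displacement_apply]
    simp only [L, LinearMap.coe_mk, AddHom.coe_mk]
    have h1 : ∀ j : Fin m, (if hj : (j : ℕ) < n then s ⟨j, hj⟩ else 0) • e ((j : ℕ) + 1) =
        (fun j : ℕ => (if hj : j < n then s ⟨j, hj⟩ else 0) • e (j + 1)) j := fun j => rfl
    have h2 : ∀ j : Fin n, s j • e ((j : ℕ) + 1) =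
        (fun j : ℕ => (if hj : j < n then s ⟨j, hj⟩ else 0) • e (j + 1)) j := fun j => by simp
    rw [Finset.sum_congr rfl fun j _ => h1 j, Finset.sum_congr rfl fun j _ => h2 j,
      Fin.sum_univ_eq_sum_range (fun j : ℕ => (if hj : j < n then s ⟨j, hj⟩ else 0) • e (j + 1)) m,
      Fin.sum_univ_eq_sum_range (fun j : ℕ => (if hj : j < n then s ⟨j, hj⟩ else 0) • e (j + 1)) n]
    refine (Finset.sum_subset (Finset.range_subset_range.2 hnm) fun j _ hj => ?_).symm
    rw [dif_neg (by simpa using hj), zero_smul]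
  have h2 := AnalyticAt.comp_of_eq h (L.toContinuousLinearMap.analyticAt 0) (map_zero _)
  simpa only [Function.comp_def, LinearMap.coe_toContinuousLinearMap', hL] using h2

lemma pd_displacement {F : Times → ℂ} {t : Times} {n k : ℕ} (hk : k < n) (s : Fin n → ℂ) :
    pd (k + 1) F (t + displacement n s) =
      lineDeriv ℂ (fun s => F (t + displacement n s)) s (Pi.single ⟨k, hk⟩ 1) := by
  simp only [pd, lineDeriv, map_add, map_smul, displacement_single, add_assoc]

lemma AnalyticTimesAt.pd_eventuallyEq {F : Times → ℂ} {t : Times} (hF : AnalyticTimesAt F t)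
    {n k : ℕ} (hk : k < n) : (fun s => pd (k + 1) F (t + displacement n s)) =ᶠ[𝓝 0]
      fun s => fderiv ℂ (fun s => F (t + displacement n s)) s (Pi.single ⟨k, hk⟩ 1) := by
  filter_upwards [(hF n).eventually_analyticAt] with s hs
  rw [pd_displacement hk, hs.differentiableAt.lineDeriv_eq_fderiv]

lemma AnalyticTimesAt.pd {F : Times → ℂ} {t : Times} (hF : AnalyticTimesAt F t) (k : ℕ) :
    AnalyticTimesAt (pd (k + 1) F) t := by
  intro n
  -- The number of variables is enlarged until $t_{k+1}$ is among them; the partial derivative is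
  -- then a component of the Fréchet derivative.
  refine analyticAt_displacement_of_le (Nat.le_add_right n (k + 1)) ?_
  have hk : k < n + (k + 1) := by omega
  exact (((ContinuousLinearMap.apply ℂ ℂ (Pi.single ⟨k, hk⟩ 1 : Fin (n + (k + 1)) → ℂ)).analyticAt
    _).comp (hF (n + (k + 1))).fderiv).congr (hF.pd_eventuallyEq hk).symm

lemma AnalyticTimesAt.pd_comm {F : Times → ℂ} {t : Times} (hF : AnalyticTimesAt F t) (j k : ℕ) :
    KP.pd (j + 1) (KP.pd (k + 1) F) t = KP.pd (k + 1) (KP.pd (j + 1) F) t := by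
  have key : ∀ n j k : ℕ, ∀ (hj : j < n) (hk : k < n),
      KP.pd (j + 1) (KP.pd (k + 1) F) t =
        fderiv ℂ (fderiv ℂ fun s => F (t + displacement n s)) 0
          (Pi.single ⟨j, hj⟩ 1) (Pi.single ⟨k, hk⟩ 1) := by
    intro n j k hj hk
    have h1 := pd_displacement (F := KP.pd (k + 1) F) (t := t) hj 0
    rw [map_zero, add_zero] at h1
    have hd : DifferentiableAt ℂ (fderiv ℂ fun s => F (t + displacement n s)) 0 :=
      (hF _).fderiv.differentiableAt
    rw [h1, (hF.pd_eventuallyEq hk).lineDeriv_eq,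
      (hd.clm_apply (differentiableAt_const _)).lineDeriv_eq_fderiv,
      fderiv_clm_apply hd (differentiableAt_const _)]
    simp
  have hsymm : IsSymmSndFDerivAt ℂ (fun s => F (t + displacement (j + k + 1) s)) 0 :=
    (hF _).contDiffAt.isSymmSndFDerivAt (n := ⊤) (by simp)
  rw [key (j + k + 1) j k (by omega) (by omega), hsymm.eq, key (j + k + 1) k j]

end Analytic

/-! ### The differential algebra of analytic functions on the domain -/

section Functions

open scoped Classical in
/-- The extension by zero of a function on `U`. -/
def extendZero {U : Set Times} (f : U → ℂ) (t : Times) : ℂ := if h : t ∈ U then f ⟨t, h⟩ else 0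

lemma extendZero_of_mem {U : Set Times} (f : U → ℂ) {t : Times} (h : t ∈ U) :
    extendZero f t = f ⟨t, h⟩ := dif_pos h

@[simp]
lemma extendZero_coe {U : Set Times} (f : U → ℂ) (u : U) : extendZero f u = f u :=
  extendZero_of_mem f u.2

variable {U : Set Times} (hU : OpenTimes U)

/-- The algebra of functions on `U` that are analytic in any finite number of the times. -/
def analyticFunctions : Subalgebra ℂ (U → ℂ) where
  carrier := {f | ∀ t ∈ U, AnalyticTimesAt (extendZero f) t}
  mul_mem' {f g} hf hg t ht n := by
    refine ((hf t ht n).mul (hg t ht n)).congr (.of_forall fun s => ?_)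
    by_cases h : t + displacement n s ∈ U <;> simp [extendZero, h]
  add_mem' {f g} hf hg t ht n := by
    refine ((hf t ht n).add (hg t ht n)).congr (.of_forall fun s => ?_)
    by_cases h : t + displacement n s ∈ U <;> simp [extendZero, h]
  algebraMap_mem' c t ht :=
    AnalyticTimesAt.congr hU (F := fun _ => c) (fun _ => analyticAt_const) ht fun s hs => by
      simp [extendZero_of_mem _ hs]

lemma analyticTimesAt_extendZero (f : analyticFunctions hU) {t : Times} (ht : t ∈ U) :
    AnalyticTimesAt (extendZero f.1) t := f.2 t ht

/-- The restriction to `U` of a function that is analytic in any finite number of the times. -/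
def ofAnalytic (F : Times → ℂ) (hF : ∀ t ∈ U, AnalyticTimesAt F t) : analyticFunctions hU :=
  ⟨fun u => F u, fun t ht => (hF t ht).congr hU ht fun s hs => by simp [extendZero_of_mem _ hs]⟩

/-- `F` is on `U - v` the translation of `f`. -/
def Represents (v : Times) (f : analyticFunctions hU) (F : Times → ℂ) : Prop :=
  ∀ u : U, F (u - v) = f.1 u

variable {hU}

lemma Represents.eventuallyEq {v : Times} {f : analyticFunctions hU} {F : Times → ℂ}
    (h : Represents hU v f F) {t : Times} (ht : t ∈ U) (k : ℕ) :
    (fun z : ℂ => F (t - v + z • e (k + 1))) =ᶠ[𝓝 0]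
      fun z : ℂ => extendZero f.1 (t + z • e (k + 1)) := by
  filter_upwards [hU.eventually_line ht k] with z hz
  rw [extendZero_of_mem _ hz, ← h ⟨_, hz⟩]
  exact congrArg F (sub_add_eq_add_sub _ _ _)

/-- A partial derivative sees only a germ along a line, which stays in $U-v$. Hence uncontrolled
values of $F$ off this set do no harm, and identities of the algebra pass to functions of all times.
-/
lemma Represents.pd_eq {v : Times} {f : analyticFunctions hU} {F : Times → ℂ}
    (h : Represents hU v f F) {t : Times} (ht : t ∈ U) (k : ℕ) :
    pd (k + 1) F (t - v) = pd (k + 1) (extendZero f.1) t :=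
  (h.eventuallyEq ht k).deriv_eq

/-- The partial derivatives as linear operators on the analytic functions on `U`. -/
def pdLinear (hU : OpenTimes U) (k : ℕ) : analyticFunctions hU →ₗ[ℂ] analyticFunctions hU where
  toFun f := ofAnalytic hU (pd (k + 1) (extendZero f.1)) fun t ht =>
    (analyticTimesAt_extendZero hU f ht).pd k
  map_add' f g := by
    apply Subtype.ext
    funext u
    have h1 := (analyticTimesAt_extendZero hU f u.2).hasLineDerivAt k
    have h2 := (analyticTimesAt_extendZero hU g u.2).hasLineDerivAt k
    have h3 := (HasDerivAt.add h1 h2).deriv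
    rw [show (ofAnalytic hU (pd (k + 1) (extendZero (f + g).1)) fun t ht =>
      (analyticTimesAt_extendZero hU (f + g) ht).pd k).1 u =
      pd (k + 1) (extendZero (f + g).1) u from rfl]
    refine Eq.trans (Filter.EventuallyEq.deriv_eq ?_) h3
    filter_upwards [hU.eventually_line u.2 k] with z hz
    simp [extendZero_of_mem _ hz]
  map_smul' c f := by
    apply Subtype.ext
    funext u
    have h1 := (analyticTimesAt_extendZero hU f u.2).hasLineDerivAt k
    have h3 := (HasDerivAt.const_mul c h1).deriv
    refine Eq.trans (Filter.EventuallyEq.deriv_eq ?_) h3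
    filter_upwards [hU.eventually_line u.2 k] with z hz
    simp [extendZero_of_mem _ hz]

lemma pdLinear_apply (k : ℕ) (f : analyticFunctions hU) (u : U) :
    (pdLinear hU k f).1 u = pd (k + 1) (extendZero f.1) u := rfl

/-- The partial derivatives `∂_k`, `k ≥ 1`, as derivations of the analytic functions on `U`. -/
def pdDeriv (hU : OpenTimes U) : ℕ → Derivation ℂ (analyticFunctions hU) (analyticFunctions hU)
  | 0 => 0
  | k + 1 => Derivation.mk' (pdLinear hU k) fun f g => by
      apply Subtype.ext
      funext u
      have h1 := (analyticTimesAt_extendZero hU f u.2).hasLineDerivAt k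
      have h2 := (analyticTimesAt_extendZero hU g u.2).hasLineDerivAt k
      have h3 := (HasDerivAt.mul h1 h2).deriv
      refine Eq.trans (Filter.EventuallyEq.deriv_eq ?_) (h3.trans ?_)
      · filter_upwards [hU.eventually_line u.2 k] with z hz
        simp [extendZero_of_mem _ hz]
      · simp [pdLinear_apply]
        ring

lemma pdDeriv_succ_apply (k : ℕ) (f : analyticFunctions hU) (u : U) :
    (pdDeriv hU (k + 1) f).1 u = pd (k + 1) (extendZero f.1) u := rfl

lemma commute_pdDeriv (j k : ℕ) :
    Commute (pdDeriv hU j : Module.End ℂ (analyticFunctions hU))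
      (pdDeriv hU k : Module.End ℂ (analyticFunctions hU)) := by
  cases j with
  | zero => simp [pdDeriv]
  | succ j =>
    cases k with
    | zero => simp [pdDeriv]
    | succ k =>
      ext f u
      have h1 : ∀ k, Represents hU 0 (pdDeriv hU (k + 1) f) (pd (k + 1) (extendZero f.1)) :=
        fun k u => by rw [sub_zero, pdDeriv_succ_apply]
      have h2 : ∀ j k, (pdDeriv hU (j + 1) (pdDeriv hU (k + 1) f)).1 u =
          pd (j + 1) (pd (k + 1) (extendZero f.1)) u := fun j k => by
        rw [pdDeriv_succ_apply, ← (h1 k).pd_eq u.2, sub_zero]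
      exact ((h2 j k).trans ((analyticTimesAt_extendZero hU f u.2).pd_comm j k)).trans (h2 k j).symm

lemma Represents.pd {v : Times} {f : analyticFunctions hU} {F : Times → ℂ}
    (h : Represents hU v f F) (k : ℕ) :
    Represents hU v (pdDeriv hU (k + 1) f) (KP.pd (k + 1) F) :=
  fun u => h.pd_eq u.2 k

lemma Represents.zero (v : Times) : Represents hU v 0 0 := fun _ => rfl

lemma Represents.add {v : Times} {f g : analyticFunctions hU} {F G : Times → ℂ}
    (hf : Represents hU v f F) (hg : Represents hU v g G) : Represents hU v (f + g) (F + G) :=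
  fun u => congrArg₂ (· + ·) (hf u) (hg u)

lemma Represents.smul {v : Times} {f : analyticFunctions hU} {F : Times → ℂ}
    (hf : Represents hU v f F) (c : ℂ) : Represents hU v (c • f) (c • F) :=
  fun u => congrArg (c • ·) (hf u)

/-- Evaluation at a point of `U`. -/
def evalAt (hU : OpenTimes U) (u : U) : analyticFunctions hU →ₐ[ℂ] ℂ :=
  (Pi.evalAlgHom ℂ (fun _ : U => ℂ) u).comp (analyticFunctions hU).val

lemma evalAt_apply (u : U) (f : analyticFunctions hU) : evalAt hU u f = f.1 u := rfl

lemma Represents.hasLineDerivAt {f : analyticFunctions hU} {F : Times → ℂ}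
    (h : Represents hU 0 f F) (u : U) (k : ℕ) :
    HasLineDerivAt ℂ F (evalAt hU u (pdDeriv hU (k + 1) f)) u (e (k + 1)) := by
  have h1 := h.eventuallyEq u.2 k
  simp only [sub_zero] at h1
  exact HasDerivAt.congr_of_eventuallyEq
    ((analyticTimesAt_extendZero hU f u.2).hasLineDerivAt k) h1

lemma Represents.expShift {v : Times} {f : analyticFunctions hU} {F : Times → ℂ}
    (h : Represents hU v f F) (c : ℂ) (n : ℕ) :
    Represents hU v (expOp c (fun k => (pdDeriv hU k : Module.End ℂ (analyticFunctions hU))) n f)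
      (KP.expShift c KP.pd n F) := by
  rw [expOp_apply]
  exact expShift_rel (Represents hU v) (.zero v) (fun _ _ _ _ => .add) (fun c _ _ h => h.smul c)
    (fun k _ _ h => h.pd k) c n h

lemma Represents.twist {v : Times} {b : ℤ → analyticFunctions hU} {B : ℤ → Times → ℂ}
    (h : ∀ i, Represents hU v (b i) (B i)) (c : ℂ) (k : ℕ) (i : ℤ) :
    Represents hU v
      (twistOp c (fun k => (pdDeriv hU k : Module.End ℂ (analyticFunctions hU))) (k + 1) b i)
      (KP.twist c (k + 1) B i) := by
  rw [twistOp_apply]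
  exact (h i).pd k |>.add ((h _).smul c)

lemma Represents.expShift_twist {v : Times} {b : ℤ → analyticFunctions hU} {B : ℤ → Times → ℂ}
    (h : ∀ i, Represents hU v (b i) (B i)) (ε c : ℂ) (n : ℕ) (i : ℤ) :
    Represents hU v (expOp ε (twistOp c fun k =>
        (pdDeriv hU k : Module.End ℂ (analyticFunctions hU))) n b i)
      (KP.expShift ε (KP.twist c) n B i) := by
  rw [expOp_apply]
  exact expShift_rel
    (fun (b : ℤ → analyticFunctions hU) (B : ℤ → Times → ℂ) => ∀ i, Represents hU v (b i) (B i))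
    (fun _ => .zero v) (fun _ _ _ _ h h' i => (h i).add (h' i)) (fun c _ _ h i => (h i).smul c)
    (fun k _ _ h => Represents.twist h c k) ε n h i

end Functions

/-! ### The tau function in the algebra; Fay and residue identities for $\varphi$, $\varphi^*$ -/

section TauFunction

open Finset hiding antidiagonal mem_antidiagonal
open Finset.HasAntidiagonal (antidiagonal mem_antidiagonal)

variable {U : Set Times} {τ : Times → ℂ}

lemma IsTau.openTimes (hτ : IsTau U τ) : OpenTimes U := hτ.isOpen

lemma IsTau.analyticTimesAt (hτ : IsTau U τ) {t : Times} (ht : t ∈ U) : AnalyticTimesAt τ t :=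
  hτ.analytic t ht

/-- The tau function as an element of the algebra of analytic functions on `U`. -/
def IsTau.toFunctions (hτ : IsTau U τ) : analyticFunctions hτ.openTimes :=
  ofAnalytic hτ.openTimes τ fun _ ht => hτ.analyticTimesAt ht

/-- The inverse of the tau function as an element of the algebra of analytic functions on `U`. -/
def IsTau.invFunctions (hτ : IsTau U τ) : analyticFunctions hτ.openTimes :=
  ofAnalytic hτ.openTimes (fun t => (τ t)⁻¹) fun t ht n =>
    (hτ.analyticTimesAt ht n).inv (by simpa using hτ.ne_zero t ht)

/-- The partial derivatives on the analytic functions on the domain of a tau function. -/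
def IsTau.deriv (hτ : IsTau U τ) (k : ℕ) : Module.End ℂ (analyticFunctions hτ.openTimes) :=
  (pdDeriv hτ.openTimes k : Module.End ℂ (analyticFunctions hτ.openTimes))

variable (hτ : IsTau U τ)

lemma IsTau.deriv_eq : hτ.deriv =
    fun k => (pdDeriv hτ.openTimes k : Module.End ℂ (analyticFunctions hτ.openTimes)) := rfl

lemma IsTau.represents : Represents hτ.openTimes 0 hτ.toFunctions τ :=
  fun u => by rw [sub_zero]; rfl

lemma IsTau.toFunctions_mul_inv : hτ.toFunctions * hτ.invFunctions = 1 := by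
  apply Subtype.ext
  funext u
  exact mul_inv_cancel₀ (hτ.ne_zero u u.2)

lemma IsTau.represents_wave (i : ℤ) : Represents hτ.openTimes 0
    (hτ.invFunctions * shiftNeg hτ.deriv hτ.toFunctions i) (wave τ i) := by
  intro u
  by_cases hi : i ≤ 0
  · have := hτ.represents.expShift (-1) (-i).toNat u
    simp only [sub_zero] at this ⊢
    simp only [wave, shiftNeg, hi, if_true, this, div_eq_inv_mul]
    rfl
  · simp [wave, shiftNeg, hi]

lemma IsTau.wave_eq (i : ℤ) (u : U) :
    wave τ i u = evalAt hτ.openTimes u (shiftNeg hτ.deriv hτ.toFunctions i) / τ u := by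
  have := hτ.represents_wave i u
  rw [sub_zero] at this
  rw [this, div_eq_inv_mul]
  rfl

lemma IsTau.represents_shiftPos (i : ℤ) (hi : i ≤ 0) : Represents hτ.openTimes 0
    (shiftPos hτ.deriv hτ.toFunctions i) (expShift 1 pd (-i).toNat τ) := by
  rw [shiftPos, if_pos hi]
  exact hτ.represents.expShift 1 (-i).toNat

lemma IsTau.waveStar_eq (i : ℤ) (u : U) :
    waveStar τ i u = evalAt hτ.openTimes u (shiftPos hτ.deriv hτ.toFunctions i) / τ u := by
  by_cases hi : i ≤ 0
  · have := hτ.represents_shiftPos i hi u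
    rw [sub_zero] at this
    rw [waveStar, if_pos hi, this, evalAt_apply]
  · rw [waveStar, if_neg hi, shiftPos, if_neg hi]
    simp

lemma IsTau.represents_foldr (l : List ℕ) (hl : ∀ k ∈ l, 1 ≤ k) (i : ℤ) :
    Represents hτ.openTimes 0
      (l.foldr (fun k b => twistOp 1 hτ.deriv k b)
        (hτ.invFunctions • shiftNeg hτ.deriv hτ.toFunctions) i)
      (l.foldr (twist 1) (wave τ) i) := by
  induction l generalizing i with
  | nil => exact hτ.represents_wave i
  | cons k l ih =>
    obtain ⟨k, rfl⟩ := Nat.exists_eq_succ_of_ne_zero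
      (Nat.one_le_iff_ne_zero.1 (hl k List.mem_cons_self))
    exact Represents.twist (ih fun j hj => hl j (List.mem_cons_of_mem _ hj)) 1 k i

lemma IsTau.bilinearAt (u : U) :
    BilinearAt (pdDeriv hτ.openTimes) (evalAt hτ.openTimes u) hτ.toFunctions hτ.invFunctions where
  comm := commute_pdDeriv
  mul_eq_one := hτ.toFunctions_mul_inv
  bilinear l hl := by
    rw [← hτ.bilinear u u.2 l hl]
    refine finsum_congr fun i => ?_
    have := hτ.represents_foldr l hl i u
    rw [sub_zero] at this
    rw [this, hτ.waveStar_eq]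
    rfl

lemma IsTau.represents_vertexStar (m : ℤ) : Represents hτ.openTimes (e 0)
    (shiftPos hτ.deriv hτ.toFunctions (m + 1)) (vertexStar τ m) := by
  intro u
  by_cases hm : m < 0
  · rw [vertexStar, if_pos hm, sub_add_cancel, show -1 - m = -(m + 1) by ring]
    simpa using hτ.represents_shiftPos (m + 1) (by omega) u
  · rw [vertexStar, if_neg hm, shiftPos_of_pos (by omega)]
    rfl

/-- This is the normal ordering of $X(\lambda)X^*(\mu)\tau$: the two shifts of $t_0$ cancel in
$\tau$, and the shift of $\zeta(\mu,t)$ by $-[\lambda^{-1}]$ produces $1/(1-\mu/\lambda)$, here with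
$\varepsilon\kappa=(-1)(-1)=1$. -/
lemma IsTau.represents_vertex (n : ℕ) (m : ℤ) : Represents hτ.openTimes 0
    (fayQuotient (pdDeriv hτ.openTimes) hτ.toFunctions n m)
    (vertex (vertexStar τ) (-1 - n) m) := by
  intro u
  have := Represents.expShift_twist hτ.represents_vertexStar (-1) (-1) n (m - 1) u
  rw [sub_zero, vertex, if_pos (by omega), show (-1 - (-1 - (n : ℤ))).toNat = n by omega, this,
    expOp_twistOp_of_mul_eq_one (by norm_num), fayQuotient]
  congr! 4
  ring

lemma coeff_zero_vertexSeries (m : ℤ) (t : Times) :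
    coeff 0 (vertexSeries τ m t) = 0 := by
  simp [vertexSeries, vertex]

lemma IsTau.coeff_succ_vertexSeries (n : ℕ) (m : ℤ) (u : U) :
    coeff (n + 1) (vertexSeries τ m u) = evalAt hτ.openTimes u
      (fayQuotient (pdDeriv hτ.openTimes) hτ.toFunctions n m) := by
  have := hτ.represents_vertex n m u
  rw [sub_zero] at this
  rw [vertexSeries, coeff_mk, show (-((n + 1 : ℕ) : ℤ)) = -1 - n by push_cast; ring, this]
  rfl

lemma IsTau.coeff_waveSeries (n : ℕ) (u : U) : coeff n (waveSeries τ u) =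
    evalAt hτ.openTimes u (expOp (-1) hτ.deriv n hτ.toFunctions) / τ u := by
  rw [waveSeries, coeff_mk, hτ.wave_eq, shiftNeg_neg]

lemma IsTau.evalAt_toFunctions (u : U) : evalAt hτ.openTimes u hτ.toFunctions = τ u := rfl

lemma IsTau.hasLineDerivAt_div (hτ : IsTau U τ) {f : analyticFunctions hτ.openTimes} {F : Times → ℂ}
    (h : Represents hτ.openTimes 0 f F) (u : U) (k : ℕ) :
    HasLineDerivAt ℂ (fun t => F t / τ t)
      ((evalAt hτ.openTimes u (pdDeriv hτ.openTimes (k + 1) f) * τ u -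
        evalAt hτ.openTimes u f *
          evalAt hτ.openTimes u (pdDeriv hτ.openTimes (k + 1) hτ.toFunctions)) / τ u ^ 2)
      u (e (k + 1)) := by
  have h1 := h u
  rw [sub_zero] at h1
  have h0 : τ (u + (0 : ℂ) • e (k + 1)) = τ u := by simp
  have h2 := HasDerivAt.div (h.hasLineDerivAt u k) (hτ.represents.hasLineDerivAt u k)
    (by rw [h0]; exact hτ.ne_zero u u.2)
  rw [h0] at h2
  simp only [zero_smul, add_zero, h1] at h2
  exact h2

/-- The differential Fay identity `∂_x (X(λ) X*(μ) τ / τ) = φ(λ) φ*(μ)`. -/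
lemma IsTau.hasLineDerivAt_vertexSeries (hτ : IsTau U τ) {t : Times} (ht : t ∈ U) (n : ℕ) (m : ℤ) :
    HasLineDerivAt ℂ (fun s => coeff n (vertexSeries τ m s) / τ s)
      (coeff n (waveSeries τ t) * waveStar τ m t - coeff (n + 1) (vertexSeries τ m t) / τ t +
        coeff n (vertexSeries τ (m - 1) t) / τ t) t (e 1) := by
  have hne := hτ.ne_zero t ht
  have h1 := hτ.coeff_waveSeries n ⟨t, ht⟩
  have h2 := hτ.coeff_succ_vertexSeries n m ⟨t, ht⟩
  have h3 := hτ.waveStar_eq m ⟨t, ht⟩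
  cases n with
  | zero =>
    simp only [coeff_zero_vertexSeries, zero_div, add_zero]
    rw [h1, h2, h3]
    have : fayQuotient (pdDeriv hτ.openTimes) hτ.toFunctions 0 m =
      shiftPos hτ.deriv hτ.toFunctions m := by simp [fayQuotient]; rfl
    rw [this, expOp_zero, Module.End.one_apply, hτ.evalAt_toFunctions]
    simp only [div_self hne, one_mul, sub_self]
    exact hasDerivAt_const _ _
  | succ n =>
    have h4 := hτ.coeff_succ_vertexSeries n (m - 1) ⟨t, ht⟩
    rw [h1, h2, h3, h4, fayQuotient_succ, map_add]
    have h5 := hτ.hasLineDerivAt_div (hτ.represents_vertex n m) ⟨t, ht⟩ 0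
    have h6 : (fun s => coeff (n + 1) (vertexSeries τ m s) / τ s) =
        fun s => vertex (vertexStar τ) (-1 - n) m s / τ s := by
      funext s
      rw [vertexSeries, coeff_mk, show (-((n + 1 : ℕ) : ℤ)) = -1 - n by push_cast; ring]
    rw [h6]
    have h7 := (hτ.bilinearAt ⟨t, ht⟩).ev_wronskian_fayQuotient n m
    rw [wronskian_apply, fayDefect] at h7
    simp only [map_sub, map_mul, hτ.evalAt_toFunctions] at h7
    convert h5 using 1
    simp only [zero_add, hτ.deriv_eq]
    field_simp
    linear_combination -h7

lemma IsTau.coeff_zero_waveSeries (hτ : IsTau U τ) {t : Times} (ht : t ∈ U) :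
    coeff 0 (waveSeries τ t) = 1 := by
  rw [hτ.coeff_waveSeries 0 ⟨t, ht⟩, expOp_zero]
  exact div_self (hτ.ne_zero t ht)

lemma IsTau.waveStar_zero (hτ : IsTau U τ) {t : Times} (ht : t ∈ U) : waveStar τ 0 t = 1 := by
  simp [waveStar, div_self (hτ.ne_zero t ht)]

lemma IsTau.field_eq (u : U) : field τ u =
    2 * evalAt hτ.openTimes u (pdDeriv hτ.openTimes 1 hτ.toFunctions) / τ u := by
  rw [field, (hτ.represents.hasLineDerivAt u 0).lineDeriv.symm]
  rfl

lemma IsTau.coeff_one_waveSeries (hτ : IsTau U τ) {t : Times} (ht : t ∈ U) :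
    coeff 1 (waveSeries τ t) = -(field τ t / 2) := by
  rw [hτ.coeff_waveSeries 1 ⟨t, ht⟩, expOp_one, hτ.field_eq ⟨t, ht⟩, IsTau.deriv]
  simp
  ring

lemma IsTau.waveStar_neg_one (hτ : IsTau U τ) {t : Times} (ht : t ∈ U) :
    waveStar τ (-1) t = field τ t / 2 := by
  have : (-1 : ℤ) = -((1 : ℕ) : ℤ) := by simp
  rw [this, hτ.waveStar_eq _ ⟨t, ht⟩, shiftPos_neg, expOp_one, hτ.field_eq ⟨t, ht⟩, IsTau.deriv]
  simp
  ring

/-- `res λ ^ n φ φ* = ∂_n w / 2`. -/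
lemma IsTau.sum_antidiagonal_eq (hτ : IsTau U τ) {t : Times} (ht : t ∈ U) (n : ℕ) :
    ∑ p ∈ antidiagonal (n + 2), coeff p.1 (waveSeries τ t) * waveStar τ (-p.2) t =
      pd (n + 1) (field τ) t / 2 := by
  have h1 := (hτ.bilinearAt ⟨t, ht⟩).sum_antidiagonal_eq (n + 1) (by omega)
  have h2 := (hτ.hasLineDerivAt_div (hτ.represents.pd 0) ⟨t, ht⟩ n).lineDeriv
  have h3 : pd (n + 1) (field τ) t =
      2 * lineDeriv ℂ (fun s => pd 1 τ s / τ s) t (e (n + 1)) := by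
    simp only [pd, field, lineDeriv, mul_div_assoc]
    exact deriv_const_mul_field _
  have hne := hτ.ne_zero t ht
  rw [h3]
  simp only [zero_add] at h2
  rw [h2]
  simp only [hτ.coeff_waveSeries _ ⟨t, ht⟩, hτ.waveStar_eq _ ⟨t, ht⟩, shiftPos_neg,
    div_mul_div_comm]
  rw [← sum_div, hτ.deriv_eq, h1, hτ.evalAt_toFunctions]
  field_simp

end TauFunction

/-! ### Power series in an operator that raises the order -/

section OperatorSeries

open Finset (range)

/-- An operator on power series that raises the order. -/
def RaisesOrder (D : Module.End ℂ ℂ⟦X⟧) : Prop :=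
  ∀ n A, (∀ j < n, coeff j A = 0) → coeff n (D A) = 0

variable {D : Module.End ℂ ℂ⟦X⟧}

lemma RaisesOrder.coeff_pow (hD : RaisesOrder D) {n k : ℕ} {A : ℂ⟦X⟧}
    (hA : ∀ j, j + k ≤ n → coeff j A = 0) : coeff n ((D ^ k) A) = 0 := by
  induction k generalizing A with
  | zero => exact hA n le_rfl
  | succ k ih =>
    rw [pow_succ, Module.End.mul_apply]
    exact ih fun j hj => hD j A fun i hi => hA i (by omega)

lemma RaisesOrder.coeff_pow_of_lt (hD : RaisesOrder D) {n k : ℕ} (h : n < k) (A : ℂ⟦X⟧) :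
    coeff n ((D ^ k) A) = 0 :=
  hD.coeff_pow fun j hj => by omega

lemma RaisesOrder.coeff_congr (hD : RaisesOrder D) {n : ℕ} {A B : ℂ⟦X⟧}
    (h : ∀ j < n, coeff j A = coeff j B) : coeff n (D A) = coeff n (D B) := by
  rw [← sub_eq_zero, ← map_sub, ← map_sub]
  exact hD n _ fun j hj => by rw [map_sub, h j hj, sub_self]

/-- The operator `∑ c_k D ^ k`, where `D` raises the order. -/
def opSeries (c : ℕ → ℂ) (D : Module.End ℂ ℂ⟦X⟧) : Module.End ℂ ℂ⟦X⟧ where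
  toFun A := PowerSeries.mk fun n => ∑ k ∈ range (n + 1), c k * coeff n ((D ^ k) A)
  map_add' A B := by
    ext n
    simp [mul_add, Finset.sum_add_distrib]
  map_smul' r A := by
    ext n
    simp [Finset.mul_sum, mul_left_comm]

lemma coeff_opSeries (c : ℕ → ℂ) (n : ℕ) (A : ℂ⟦X⟧) :
    coeff n (opSeries c D A) = ∑ k ∈ range (n + 1), c k * coeff n ((D ^ k) A) := by
  simp [opSeries]

lemma RaisesOrder.coeff_opSeries_of_le (hD : RaisesOrder D) (c : ℕ → ℂ) {n K : ℕ} (h : n ≤ K)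
    (A : ℂ⟦X⟧) :
    coeff n (opSeries c D A) = ∑ k ∈ range (K + 1), c k * coeff n ((D ^ k) A) := by
  rw [coeff_opSeries]
  refine Finset.sum_subset (Finset.range_subset_range.2 (by omega)) fun k _ hk => ?_
  rw [hD.coeff_pow_of_lt (by simpa using hk), mul_zero]

/-- Multiplication of a series by its variable. -/
def shiftSeq (c : ℕ → ℂ) : ℕ → ℂ
  | 0 => 0
  | k + 1 => c k

lemma RaisesOrder.opSeries_mul (hD : RaisesOrder D) (c : ℕ → ℂ) :
    opSeries c D * D = opSeries (shiftSeq c) D := by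
  ext A n
  rw [Module.End.mul_apply, coeff_opSeries, hD.coeff_opSeries_of_le _ (Nat.le_succ n),
    Finset.sum_range_succ' _ (n + 1)]
  simp [shiftSeq, pow_succ]

lemma RaisesOrder.mul_opSeries (hD : RaisesOrder D) (c : ℕ → ℂ) :
    D * opSeries c D = opSeries (shiftSeq c) D := by
  ext A n
  -- The coefficient $n$ of $D(\cdot)$ depends only on lower coefficients, so the series may be
  -- replaced by a finite sum before $D$ is applied.
  have h1 : coeff n (D (opSeries c D A)) =
      coeff n (D (∑ k ∈ range (n + 1), c k • (D ^ k) A)) := by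
    refine hD.coeff_congr fun j hj => ?_
    rw [hD.coeff_opSeries_of_le c hj.le]
    simp
  rw [Module.End.mul_apply, h1, hD.coeff_opSeries_of_le _ (Nat.le_succ n),
    Finset.sum_range_succ' _ (n + 1)]
  simp [shiftSeq, pow_succ']

lemma opSeries_add (c c' : ℕ → ℂ) : opSeries (c + c') D = opSeries c D + opSeries c' D := by
  ext A n
  simp [coeff_opSeries, add_mul, Finset.sum_add_distrib]

lemma opSeries_smul (r : ℂ) (c : ℕ → ℂ) : opSeries (r • c) D = r • opSeries c D := by
  ext A n
  simp [coeff_opSeries, mul_assoc, Finset.mul_sum]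

/-- The falling factorial `j (j - 1) ⋯ (j - k + 1)`. -/
def falling (k : ℕ) (j : ℤ) : ℂ := ∏ i ∈ range k, ((j : ℂ) - i)

lemma falling_succ (k : ℕ) (j : ℤ) : falling (k + 1) j = falling k j * (j - k) :=
  Finset.prod_range_succ _ _

lemma falling_succ_add_one (k : ℕ) (j : ℤ) : falling (k + 1) (j + 1) = (j + 1) * falling k j := by
  rw [falling, Finset.prod_range_succ']
  simp [falling, mul_comm]

lemma falling_natCast_of_lt {k n : ℕ} (h : n < k) : falling k n = 0 :=
  Finset.prod_eq_zero (Finset.mem_range.2 h) (by simp)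

/-- The Taylor coefficients of `z ^ j`. -/
def zpowTaylor (z : ℂ) (j : ℤ) (k : ℕ) : ℂ := falling k j * z ^ (j - k) / k.factorial

lemma zpowTaylor_zero (z : ℂ) (k : ℕ) : zpowTaylor z 0 k = if k = 0 then 1 else 0 := by
  cases k with
  | zero => simp [zpowTaylor, falling]
  | succ k =>
    have := falling_natCast_of_lt k.succ_pos
    rw [Nat.cast_zero] at this
    simp [zpowTaylor, this]

/-- Pascal's rule for generalized binomial coefficients, from $(z+D)^{j+1}=(z+D)(z+D)^j$. The
hypothesis excludes negative powers of $0$, which have the default value $0$. -/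
lemma zpowTaylor_add_one {z : ℂ} {j : ℤ} (h : z ≠ 0 ∨ 0 ≤ j) :
    zpowTaylor z (j + 1) = z • zpowTaylor z j + shiftSeq (zpowTaylor z j) := by
  funext k
  cases k with
  | zero =>
    simp only [zpowTaylor, falling, Pi.add_apply, Pi.smul_apply, shiftSeq, smul_eq_mul]
    have : z ^ (j + 1) = z ^ j * z := by
      rcases h with h | h
      · exact zpow_add_one₀ h j
      · obtain ⟨n, rfl⟩ := Int.eq_ofNat_of_zero_le h
        exact_mod_cast pow_succ z n
    simp [this, mul_comm]
  | succ k =>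
    simp only [zpowTaylor, Pi.add_apply, Pi.smul_apply, shiftSeq, smul_eq_mul]
    have hk : ((k + 1).factorial : ℂ) = (k + 1) * k.factorial := by
      push_cast [Nat.factorial_succ]; ring
    have h0 : (k.factorial : ℂ) ≠ 0 := by exact_mod_cast k.factorial_ne_zero
    have h1 : (k + 1 : ℂ) ≠ 0 := by exact_mod_cast k.succ_ne_zero
    have key : falling (k + 1) j * (z * z ^ (j - (k + 1 : ℕ))) =
        falling (k + 1) j * z ^ (j - k) := by
      rcases eq_or_ne z 0 with rfl | hz
      -- At $z=0$ the sides could differ only through $0^0$ at $j=k$, where the falling factorial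
      -- vanishes.
      · rcases eq_or_ne j k with rfl | hj
        · rw [falling_natCast_of_lt k.lt_succ_self]; simp
        · rw [zero_zpow (j - k) (sub_ne_zero.2 hj)]; simp
      · rw [← zpow_one_add₀ hz]
        congr 2
        push_cast
        ring
    have e1 : j + 1 - ((k + 1 : ℕ) : ℤ) = j - k := by push_cast; ring
    rw [e1, falling_succ_add_one, ← mul_div_assoc, ← mul_left_comm, key, falling_succ, hk]
    field_simp
    ring

lemma RaisesOrder.smul_one_add_mul_opSeries (hD : RaisesOrder D) {z : ℂ} {j : ℤ}
    (h : z ≠ 0 ∨ 0 ≤ j) : (z • 1 + D) * opSeries (zpowTaylor z j) D =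
      opSeries (zpowTaylor z (j + 1)) D := by
  rw [zpowTaylor_add_one h, opSeries_add, opSeries_smul, ← hD.mul_opSeries, add_mul,
    smul_mul_assoc, one_mul]

lemma RaisesOrder.opSeries_mul_smul_one_add (hD : RaisesOrder D) {z : ℂ} {j : ℤ}
    (h : z ≠ 0 ∨ 0 ≤ j) : opSeries (zpowTaylor z j) D * (z • 1 + D) =
      opSeries (zpowTaylor z (j + 1)) D := by
  rw [zpowTaylor_add_one h, opSeries_add, opSeries_smul, ← hD.opSeries_mul, mul_add,
    mul_smul_comm, mul_one]

lemma opSeries_zpowTaylor_zero (z : ℂ) : opSeries (zpowTaylor z 0) D = 1 := by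
  ext A n
  rw [coeff_opSeries, Finset.sum_eq_single 0]
  · simp [zpowTaylor_zero]
  · intro k _ hk
    simp [zpowTaylor_zero, hk]
  · simp

end OperatorSeries

/-! ### Splitting $\partial_{\lambda^N}$ as $t_N$ plus an order-raising part -/

section NilpotentPart

open Finset (range Icc)

/-- The part of `dE` that raises the order. -/
def dENil (N : ℕ) (t : Times) : Module.End ℂ ℂ⟦X⟧ := dE N t - t N • 1

lemma coeff_dE (N : ℕ) (t : Times) (n : ℕ) (A : ℂ⟦X⟧) :
    coeff n (dE N t A) = (N : ℂ)⁻¹ * (∑ k ∈ Icc 1 N,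
      (if N - k ≤ n then (k * t k) * coeff (n - (N - k)) A else 0) +
      if N ≤ n then (t 0 - (n - N : ℕ)) * coeff (n - N) A else 0) := by
  have h1 : coeff n (X ^ (N + 1) * derivative ℂ A) =
      if N ≤ n then ((n - N : ℕ) : ℂ) * coeff (n - N) A else 0 := by
    rw [coeff_X_pow_mul']
    rcases lt_trichotomy n N with h | h | h
    · rw [if_neg (by omega), if_neg (by omega)]
    · rw [if_neg (by omega), if_pos h.ge]
      simp [h]
    · obtain ⟨m, rfl⟩ := Nat.exists_eq_add_of_lt h
      rw [if_pos (by omega), if_pos (by omega), show N + m + 1 - (N + 1) = m by omega,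
        show N + m + 1 - N = m + 1 by omega, coeff_derivative]
      push_cast
      ring
  have h3 : ∀ (a : ℂ) (b : ℕ), C a * X ^ b * A = X ^ b * (C a * A) := fun a b => by ring
  have h2 : coeff n (dE N t A) = (N : ℂ)⁻¹ * (∑ k ∈ Icc 1 N,
      coeff n (X ^ (N - k) * (C (k * t k) * A)) + coeff n (X ^ N * (C (t 0) * A)) -
        coeff n (X ^ (N + 1) * derivative ℂ A)) := by
    rw [← map_sum, ← map_add, ← map_sub, ← smul_eq_mul, ← map_smul]
    congr 1
    simp only [dE, LinearMap.smul_apply, LinearMap.sub_apply, LinearMap.mulLeft_apply,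
      LinearMap.comp_apply, add_mul, Finset.sum_mul, h3]
    rfl
  rw [h2, h1]
  simp only [coeff_X_pow_mul', coeff_C_mul]
  rw [add_sub_assoc]
  congr 2
  split_ifs <;> ring

lemma coeff_dENil {N : ℕ} (hN : 1 ≤ N) (t : Times) (n : ℕ) (A : ℂ⟦X⟧) :
    coeff n (dENil N t A) = (N : ℂ)⁻¹ * (∑ k ∈ Icc 1 (N - 1),
      (if N - k ≤ n then (k * t k) * coeff (n - (N - k)) A else 0) +
      if N ≤ n then (t 0 - (n - N : ℕ)) * coeff (n - N) A else 0) := by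
  obtain ⟨M, rfl⟩ := Nat.exists_eq_add_of_le' hN
  have h0 : ((M + 1 : ℕ) : ℂ) ≠ 0 := by exact_mod_cast M.succ_ne_zero
  rw [dENil, LinearMap.sub_apply, map_sub, coeff_dE, Finset.sum_Icc_succ_top (by omega)]
  simp only [LinearMap.smul_apply, Module.End.one_apply, coeff_smul, Nat.sub_self, Nat.zero_le,
    if_true, Nat.sub_zero, smul_eq_mul, Nat.add_sub_cancel]
  field_simp
  ring

/-- The only part of $\partial_{\lambda^N}$ that preserves the order is the summand $k=N$, and it
has been subtracted. -/
lemma raisesOrder_dENil {N : ℕ} (hN : 1 ≤ N) (t : Times) : RaisesOrder (dENil N t) := by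
  intro n A hA
  rw [coeff_dENil hN, Finset.sum_eq_zero, zero_add]
  · split_ifs with h
    · rw [hA _ (by omega), mul_zero, mul_zero]
    · simp
  · intro k hk
    rw [Finset.mem_Icc] at hk
    split_ifs with h
    · rw [hA _ (by omega), mul_zero]
    · rfl

lemma dE_eq (N : ℕ) (t : Times) : dE N t = t N • 1 + dENil N t := by
  rw [dENil]; abel

/-- The inverse is the Neumann series of $(t_N+D)^{-1}$, finite in every coefficient. -/
lemma isUnit_dE {N : ℕ} (hN : 1 ≤ N) {t : Times} (ht : t N ≠ 0) : IsUnit (dE N t) := by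
  have hD := raisesOrder_dENil hN t
  refine ⟨⟨dE N t, opSeries (zpowTaylor (t N) (-1)) (dENil N t), ?_, ?_⟩, rfl⟩
  · rw [dE_eq, hD.smul_one_add_mul_opSeries (Or.inl ht), neg_add_cancel, opSeries_zpowTaylor_zero]
  · rw [dE_eq, hD.opSeries_mul_smul_one_add (Or.inl ht), neg_add_cancel, opSeries_zpowTaylor_zero]

lemma dEpow_eq_opSeries {N : ℕ} (hN : 1 ≤ N) {t : Times} {j : ℤ} (h : t N ≠ 0 ∨ 0 ≤ j) :
    dEpow N t j = opSeries (zpowTaylor (t N) j) (dENil N t) := by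
  have hD := raisesOrder_dENil hN t
  cases j with
  | ofNat n =>
    have key : ∀ m : ℕ, dE N t ^ m = opSeries (zpowTaylor (t N) m) (dENil N t) := by
      intro m
      induction m with
      | zero => rw [pow_zero, Nat.cast_zero, opSeries_zpowTaylor_zero]
      | succ m ih =>
        rw [pow_succ', ih, dE_eq, hD.smul_one_add_mul_opSeries (Or.inr (Int.natCast_nonneg m)),
          Nat.cast_succ]
    exact key n
  | negSucc n =>
    have ht : t N ≠ 0 := h.resolve_right (by simp)
    have hinv : ∀ j : ℤ, Ring.inverse (dE N t) * opSeries (zpowTaylor (t N) j) (dENil N t) =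
        opSeries (zpowTaylor (t N) (j - 1)) (dENil N t) := by
      intro j
      have := hD.smul_one_add_mul_opSeries (j := j - 1) (Or.inl ht)
      rw [sub_add_cancel, ← dE_eq] at this
      rw [← this, ← mul_assoc, Ring.inverse_mul_cancel _ (isUnit_dE hN ht), one_mul]
    rw [dEpow]
    have key : ∀ m : ℕ, Ring.inverse (dE N t) ^ m =
        opSeries (zpowTaylor (t N) (-m)) (dENil N t) := by
      intro m
      induction m with
      | zero => rw [pow_zero, Nat.cast_zero, neg_zero, opSeries_zpowTaylor_zero]
      | succ m ih => rw [pow_succ', ih, hinv, Nat.cast_succ, neg_add']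
    rw [key]
    rfl

lemma mul_dEpow_neg_one {N : ℕ} (hN : 1 ≤ N) {t : Times} (ht : t N ≠ 0) (A : ℂ⟦X⟧) :
    dE N t (dEpow N t (-1) A) = A := by
  change dE N t ((Ring.inverse (dE N t) ^ (0 + 1)) A) = A
  rw [zero_add, pow_one, ← Module.End.mul_apply, Ring.mul_inverse_cancel _ (isUnit_dE hN ht),
    Module.End.one_apply]

end NilpotentPart

/-! ### Termwise differentiation of $h$ and the Taylor formula for $h(\partial_{\lambda^N})$ -/

section LaurentSeries

open Finset (range)

lemma norm_falling_natCast_le {k n : ℕ} (h : k ≤ n) : ‖falling k n‖ ≤ (n : ℝ) ^ k := by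
  rw [falling, norm_prod]
  refine (Finset.prod_le_prod (g := fun _ => (n : ℝ)) (fun _ _ => norm_nonneg _)
    fun i hi => ?_).trans_eq (by simp)
  have hi' : i ≤ n := by have := Finset.mem_range.1 hi; omega
  rw [Int.cast_natCast, ← Nat.cast_sub hi', Complex.norm_natCast]
  exact_mod_cast Nat.sub_le n i

lemma norm_falling_negSucc_le (k n : ℕ) :
    ‖falling k (Int.negSucc n)‖ ≤ ((k + 1 : ℕ) : ℝ) ^ k * ((n + 1 : ℕ) : ℝ) ^ k := by
  rw [falling, norm_prod, ← mul_pow]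
  refine (Finset.prod_le_prod (g := fun _ => ((k + 1 : ℕ) : ℝ) * ((n + 1 : ℕ) : ℝ))
    (fun _ _ => norm_nonneg _) fun i hi => ?_).trans_eq (by simp)
  have hi' := Finset.mem_range.1 hi
  have : ((Int.negSucc n : ℤ) : ℂ) - i = -((n + 1 + i : ℕ) : ℂ) := by
    push_cast [Int.negSucc_eq]; ring
  rw [this, norm_neg, Complex.norm_natCast]
  have h2 : n + 1 + i ≤ (k + 1) * (n + 1) := by nlinarith
  exact_mod_cast h2

lemma exists_norm_le_of_summable {f : ℕ → ℂ} (hf : Summable f) : ∃ B, 0 ≤ B ∧ ∀ n, ‖f n‖ ≤ B := by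
  obtain ⟨B, hB⟩ := (Metric.isBounded_range_of_tendsto f hf.tendsto_atTop_zero).exists_norm_le
  exact ⟨B, (norm_nonneg _).trans (hB (f 0) ⟨0, rfl⟩), fun n => hB _ ⟨n, rfl⟩⟩

lemma ConvergesAround.eventually {h : ℤ → ℂ} {z : ℂ} (hh : ConvergesAround h z) :
    ∀ᶠ y in 𝓝 z, ConvergesAround h y := by
  obtain ⟨⟨z₂, hz₂, h₂⟩, h₁⟩ := hh
  have h₃ : ∀ᶠ y in 𝓝 z, ((∀ n : ℤ, n < 0 → h n = 0) ∨ ∃ z₁ : ℂ, z₁ ≠ 0 ∧ ‖z₁‖ < ‖y‖ ∧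
      Summable fun n : ℕ => h (-n) * z₁⁻¹ ^ n) := by
    rcases h₁ with h₁ | ⟨z₁, h0, hz₁, h₁⟩
    · exact .of_forall fun _ => Or.inl h₁
    · filter_upwards [continuous_norm.continuousAt.eventually_const_lt hz₁] with y hy
      exact Or.inr ⟨z₁, h0, hy, h₁⟩
  filter_upwards [continuous_norm.continuousAt.eventually_lt_const hz₂, h₃] with y hy hy'
  exact ⟨⟨z₂, hy, h₂⟩, hy'⟩

/-- The terms of the `k`-th derivative of a Laurent series. -/
def laurentTerm (h : ℤ → ℂ) (k : ℕ) (j : ℤ) (z : ℂ) : ℂ := h j * (falling k j * z ^ (j - k))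

lemma laurentTerm_natCast_bound {h : ℤ → ℂ} {z z₂ : ℂ} (hz : ‖z‖ < ‖z₂‖)
    (hs : Summable fun n : ℕ => h n * z₂ ^ n) (k : ℕ) :
    ∃ u : ℕ → ℝ, Summable u ∧ ∀ᶠ y in 𝓝 z, ∀ n : ℕ, ‖laurentTerm h k n y‖ ≤ u n := by
  obtain ⟨B, hB0, hB⟩ := exists_norm_le_of_summable hs
  obtain ⟨ρ, hρ, hρ'⟩ := exists_between hz
  have hρ0 : 0 < ρ := (norm_nonneg z).trans_lt hρ
  have hz0 : 0 < ‖z₂‖ := hρ0.trans hρ'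
  -- Bounded terms at $z_2$ give $|h_n|\le B|z_2|^{-n}$; near $z$ one has $|y|<\rho<|z_2|$, and $k$
  -- derivatives cost at most $n^k\rho^{-k}$.
  refine ⟨fun n => B * (ρ ^ k)⁻¹ * ((n : ℝ) ^ k * (ρ / ‖z₂‖) ^ n), ?_, ?_⟩
  · have hr : ‖ρ / ‖z₂‖‖ < 1 := by
      rw [Real.norm_of_nonneg (by positivity)]
      exact (div_lt_one hz0).2 hρ'
    have hgeom := summable_pow_mul_geometric_of_norm_lt_one k hr
    exact hgeom.mul_left _
  · filter_upwards [continuous_norm.continuousAt.eventually_lt_const hρ] with y hy n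
    rcases lt_or_ge n k with hn | hn
    · rw [laurentTerm, falling_natCast_of_lt hn]
      simp only [zero_mul, mul_zero, norm_zero]
      positivity
    · have h1 : ‖h n‖ ≤ B / ‖z₂‖ ^ n := by
        rw [le_div_iff₀ (by positivity), ← norm_pow, ← norm_mul]
        exact hB n
      have h2 : ‖y ^ ((n : ℤ) - k)‖ ≤ ρ ^ n / ρ ^ k := by
        rw [← Nat.cast_sub hn, zpow_natCast, norm_pow, div_eq_mul_inv, ← pow_sub₀ _ hρ0.ne' hn]
        exact pow_le_pow_left₀ (norm_nonneg y) hy.le _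
      rw [laurentTerm, norm_mul, norm_mul]
      calc _ ≤ B / ‖z₂‖ ^ n * ((n : ℝ) ^ k * (ρ ^ n / ρ ^ k)) := by
            gcongr
            exact norm_falling_natCast_le hn
        _ = _ := by rw [div_pow]; ring

lemma laurentTerm_negSucc_bound {h : ℤ → ℂ} {z z₁ : ℂ} (h0 : z₁ ≠ 0) (hz : ‖z₁‖ < ‖z‖)
    (hs : Summable fun n : ℕ => h (-n) * z₁⁻¹ ^ n) (k : ℕ) :
    ∃ u : ℕ → ℝ, Summable u ∧ ∀ᶠ y in 𝓝 z, ∀ n : ℕ, ‖laurentTerm h k (Int.negSucc n) y‖ ≤ u n := by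
  obtain ⟨B, hB0, hB⟩ := exists_norm_le_of_summable hs
  obtain ⟨ρ, hρ, hρ'⟩ := exists_between hz
  have hz0 : 0 < ‖z₁‖ := norm_pos_iff.2 h0
  have hρ0 : 0 < ρ := hz0.trans hρ
  let v : ℕ → ℝ := fun n => B * ((k + 1 : ℕ) : ℝ) ^ k * (ρ ^ k)⁻¹ *
    ((n : ℝ) ^ k * (‖z₁‖ / ρ) ^ n)
  refine ⟨fun n => v (n + 1), (summable_nat_add_iff (f := v) 1).2 ?_, ?_⟩
  · have hr : ‖‖z₁‖ / ρ‖ < 1 := by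
      rw [Real.norm_of_nonneg (by positivity)]
      exact (div_lt_one hρ0).2 hρ
    have hgeom := summable_pow_mul_geometric_of_norm_lt_one k hr
    exact hgeom.mul_left _
  · filter_upwards [continuous_norm.continuousAt.eventually_const_lt hρ'] with y hy n
    have h1 : ‖h (Int.negSucc n)‖ ≤ B * ‖z₁‖ ^ (n + 1) := by
      have := hB (n + 1)
      rw [norm_mul, norm_pow, norm_inv, inv_pow, ← div_eq_mul_inv,
        div_le_iff₀ (by positivity)] at this
      exact this
    have h2 : ‖y ^ (Int.negSucc n - (k : ℤ))‖ ≤ (ρ ^ (n + 1) * ρ ^ k)⁻¹ := by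
      rw [show Int.negSucc n - (k : ℤ) = -((n + 1 + k : ℕ) : ℤ) by
        push_cast [Int.negSucc_eq]; ring, zpow_neg, zpow_natCast, norm_inv, norm_pow, ← pow_add]
      gcongr
    rw [laurentTerm, norm_mul, norm_mul]
    calc _ ≤ B * ‖z₁‖ ^ (n + 1) * ((((k + 1 : ℕ) : ℝ) ^ k * ((n + 1 : ℕ) : ℝ) ^ k) *
          (ρ ^ (n + 1) * ρ ^ k)⁻¹) := by
          gcongr
          exact norm_falling_negSucc_le k n
      _ = v (n + 1) := by simp only [v]; rw [div_pow, mul_inv]; ring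

lemma ConvergesAround.exists_bound {h : ℤ → ℂ} {z : ℂ} (hh : ConvergesAround h z) (k : ℕ) :
    ∃ u : ℤ → ℝ, Summable u ∧ ∀ᶠ y in 𝓝 z, ∀ j : ℤ, ‖laurentTerm h k j y‖ ≤ u j := by
  obtain ⟨⟨z₂, hz₂, h₂⟩, h₁⟩ := hh
  obtain ⟨u, hu, hu'⟩ := laurentTerm_natCast_bound hz₂ h₂ k
  obtain ⟨v, hv, hv'⟩ : ∃ v : ℕ → ℝ, Summable v ∧
      ∀ᶠ y in 𝓝 z, ∀ n : ℕ, ‖laurentTerm h k (Int.negSucc n) y‖ ≤ v n := by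
    rcases h₁ with h₁ | ⟨z₁, h0, hz₁, h₁⟩
    · exact ⟨0, summable_zero, .of_forall fun y n => by
        simp [laurentTerm, h₁ _ (Int.negSucc_lt_zero n)]⟩
    · exact laurentTerm_negSucc_bound h0 hz₁ h₁ k
  refine ⟨fun j => Int.rec u v j, hu.int_rec hv, ?_⟩
  filter_upwards [hu', hv'] with y hy hy' j
  cases j with
  | ofNat n => exact hy n
  | negSucc n => exact hy' n

lemma ConvergesAround.summable {h : ℤ → ℂ} {z : ℂ} (hh : ConvergesAround h z) (k : ℕ) :
    Summable fun j => laurentTerm h k j z := by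
  obtain ⟨u, hu, hu'⟩ := hh.exists_bound k
  exact hu.of_norm_bounded hu'.self_of_nhds

/-- The point $z=0$ is allowed only when $h$ has no negative powers, so every power that occurs is a
genuine one. -/
lemma ConvergesAround.nonneg {h : ℤ → ℂ} {z : ℂ} (hh : ConvergesAround h z) {j : ℤ}
    (hj : h j ≠ 0) : z ≠ 0 ∨ 0 ≤ j := by
  rcases hh.2 with h₁ | ⟨z₁, _, hz₁, _⟩
  · right
    by_contra h2
    exact hj (h₁ j (by omega))
  · left
    rintro rfl
    simp at hz₁
    exact absurd hz₁ (norm_nonneg z₁).not_gt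

lemma hasDerivAt_laurentTerm {h : ℤ → ℂ} {z : ℂ} (hh : ConvergesAround h z) (k : ℕ) (j : ℤ) :
    HasDerivAt (laurentTerm h k j) (laurentTerm h (k + 1) j z) z := by
  by_cases hj : h j = 0
  · have : laurentTerm h k j = fun _ => 0 := by funext y; simp [laurentTerm, hj]
    rw [this, laurentTerm, hj, zero_mul]
    exact hasDerivAt_const _ _
  by_cases hf : falling k j = 0
  · have : laurentTerm h k j = fun _ => 0 := by funext y; simp [laurentTerm, hf]
    rw [this, laurentTerm, falling_succ, hf]
    simpa using hasDerivAt_const z (0 : ℂ)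
  have hz : z ≠ 0 ∨ 0 ≤ j - k := by
    rcases hh.nonneg hj with h1 | h1
    · exact Or.inl h1
    · right
      obtain ⟨n, rfl⟩ := Int.eq_ofNat_of_zero_le h1
      have : ¬ n < k := fun h2 => hf (falling_natCast_of_lt h2)
      omega
  have := ((hasDerivAt_zpow (j - k) z hz).const_mul (falling k j)).const_mul (h j)
  refine this.congr_deriv ?_
  rw [laurentTerm, falling_succ]
  push_cast
  rw [show j - ((k : ℤ) + 1) = j - k - 1 by ring]
  ring

/-- The `k`-th derivative of a Laurent series, summed termwise. -/
def laurentDeriv (h : ℤ → ℂ) (k : ℕ) (z : ℂ) : ℂ := ∑' j : ℤ, laurentTerm h k j z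

lemma ConvergesAround.hasDerivAt {h : ℤ → ℂ} {z : ℂ} (hh : ConvergesAround h z) (k : ℕ) :
    HasDerivAt (laurentDeriv h k) (laurentDeriv h (k + 1) z) z := by
  obtain ⟨u, hu, hu'⟩ := hh.exists_bound (k + 1)
  obtain ⟨ε, hε, hball⟩ := Metric.eventually_nhds_iff_ball.1 (hu'.and hh.eventually)
  exact hasDerivAt_tsum_of_isPreconnected hu Metric.isOpen_ball
    (convex_ball z ε).isPreconnected (fun j y hy => hasDerivAt_laurentTerm (hball y hy).2 k j)
    (fun j y hy => (hball y hy).1 j) (Metric.mem_ball_self hε) (hh.summable k)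
    (Metric.mem_ball_self hε)

lemma laurentDeriv_zero (h : ℤ → ℂ) : laurentDeriv h 0 = laurentFun h := by
  funext z
  simp [laurentDeriv, laurentFun, laurentTerm, falling]

lemma ConvergesAround.iteratedDeriv_eq {h : ℤ → ℂ} {z : ℂ} (hh : ConvergesAround h z) (k : ℕ) :
    iteratedDeriv k (laurentFun h) z = laurentDeriv h k z := by
  induction k generalizing z with
  | zero => rw [iteratedDeriv_zero, laurentDeriv_zero]
  | succ k ih =>
    rw [iteratedDeriv_succ, ← (hh.hasDerivAt k).deriv]
    exact Filter.EventuallyEq.deriv_eq (hh.eventually.mono fun y hy => ih hy)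

lemma ConvergesAround.mul_coeff_dEpow {h : ℤ → ℂ} {N : ℕ} (hN : 1 ≤ N) {t : Times}
    (hh : ConvergesAround h (t N)) (n : ℕ) (A : ℂ⟦X⟧) (j : ℤ) :
    h j * coeff n (dEpow N t j A) = ∑ k ∈ range (n + 1),
      laurentTerm h k j (t N) * ((k.factorial : ℂ)⁻¹ * coeff n ((dENil N t ^ k) A)) := by
  -- A negative power of a non-invertible operator has a default value; it can occur only with
  -- coefficient zero.
  by_cases hj : h j = 0
  · simp [hj, laurentTerm]
  · rw [dEpow_eq_opSeries hN (hh.nonneg hj), coeff_opSeries, Finset.mul_sum]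
    refine Finset.sum_congr rfl fun k _ => ?_
    rw [laurentTerm, zpowTaylor]
    ring

lemma ConvergesAround.summable_coeff_dEpow {h : ℤ → ℂ} {N : ℕ} (hN : 1 ≤ N) {t : Times}
    (hh : ConvergesAround h (t N)) (n : ℕ) (A : ℂ⟦X⟧) :
    Summable fun j => h j * coeff n (dEpow N t j A) := by
  simp_rw [hh.mul_coeff_dEpow hN]
  exact summable_sum fun k _ => (hh.summable k).mul_right _

/-- The operator `h(∂_E)` as a series in the part of `∂_E` that raises the order. -/
lemma ConvergesAround.hApply_eq {h : ℤ → ℂ} {N : ℕ} (hN : 1 ≤ N) {t : Times}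
    (hh : ConvergesAround h (t N)) (n : ℕ) (A : ℂ⟦X⟧) :
    hApply h N t A (-n) = coeff n
      (opSeries (fun k => laurentDeriv h k (t N) / k.factorial) (dENil N t) A) := by
  rw [hApply, if_pos (by simp), neg_neg, Int.toNat_natCast]
  simp_rw [hh.mul_coeff_dEpow hN]
  rw [Summable.tsum_finsetSum fun k _ => (hh.summable k).mul_right _, coeff_opSeries]
  refine Finset.sum_congr rfl fun k _ => ?_
  rw [tsum_mul_right, laurentDeriv]
  ring

lemma hApply_of_pos (h : ℤ → ℂ) (N : ℕ) (t : Times) (A : ℂ⟦X⟧) {i : ℤ} (hi : 0 < i) :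
    hApply h N t A i = 0 := if_neg hi.not_ge

end LaurentSeries

/-! ### $h(\partial_{\lambda^N})$ commutes with $\partial_x$ -/

section DerivativeInX

open Finset (range Icc)

/-- `G` is `exp (-ζ) ∂_x (exp (ζ) A)` at `z = 0`, where `z` is the displacement of `x`, and
`A` has no constant coefficient. -/
structure HasTwistedDeriv (A : ℂ → ℂ⟦X⟧) (G : ℂ⟦X⟧) : Prop where
  coeff_zero : coeff 0 (A 0) = 0
  hasDerivAt : ∀ n, HasDerivAt (fun z => coeff n (A z)) (coeff n G - coeff (n + 1) (A 0)) 0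

lemma add_smul_e_one_apply (t : Times) (z : ℂ) (k : ℕ) :
    (t + z • e 1) k = t k + z * if k = 1 then 1 else 0 := by
  by_cases hk : k = 1
  · subst hk; simp [e]
  · simp [e, hk]

/-- The operators $\partial_x$ and $\partial_{\lambda^N}$ commute, and $D=\partial_{\lambda^N}-t_N$.
The correction appears only for $N=1$, where $t_N=x$ and $[\partial_x,D]=-1$. -/
lemma HasTwistedDeriv.dENil {A : ℂ → ℂ⟦X⟧} {G : ℂ⟦X⟧} (hA : HasTwistedDeriv A G) {N : ℕ}
    (hN : 1 ≤ N) (t : Times) :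
    HasTwistedDeriv (fun z => dENil N (t + z • e 1) (A z))
      (dENil N t G - (if N = 1 then (1 : ℂ) else 0) • A 0) := by
  have ht : t + (0 : ℂ) • e 1 = t := by simp
  refine ⟨?_, fun n => ?_⟩
  · rw [ht]
    exact raisesOrder_dENil hN t 0 _ (by simp)
  · rw [ht]
    simp only [coeff_dENil hN, map_sub, coeff_smul, smul_eq_mul]
    have h1 : HasDerivAt (fun z : ℂ => ∑ k ∈ Icc 1 (N - 1), (if N - k ≤ n then
        (k * (t + z • e 1) k) * coeff (n - (N - k)) (A z) else 0)) (∑ k ∈ Icc 1 (N - 1),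
          ((if k = 1 then if N - 1 ≤ n then coeff (n - (N - 1)) (A 0) else 0 else 0) +
            (if N - k ≤ n then (k * t k) * coeff (n - (N - k)) G else 0) -
            (if N - k ≤ n + 1 then (k * t k) * coeff (n + 1 - (N - k)) (A 0) else 0))) 0 := by
      refine HasDerivAt.fun_sum fun k hk => ?_
      rw [Finset.mem_Icc] at hk
      by_cases h : N - k ≤ n
      · simp only [if_pos h, if_pos (show N - k ≤ n + 1 by omega), add_smul_e_one_apply]
        have h3 : HasDerivAt (fun z : ℂ => (k : ℂ) * (t k + z * if k = 1 then 1 else 0))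
            (k * (1 * if k = 1 then 1 else 0)) 0 :=
          (((hasDerivAt_id (0 : ℂ)).mul_const _).const_add (t k)).const_mul (k : ℂ)
        refine (h3.mul (hA.hasDerivAt (n - (N - k)))).congr_deriv ?_
        rw [show n - (N - k) + 1 = n + 1 - (N - k) by omega]
        by_cases hk1 : k = 1
        · subst hk1
          simp [h]
          ring
        · simp [hk1]
          ring
      · have h4 : (if N - k ≤ n + 1 then (k * t k) * coeff (n + 1 - (N - k)) (A 0) else 0) = 0 := by
          split_ifs with h5
          · rw [show n + 1 - (N - k) = 0 by omega, hA.coeff_zero, mul_zero]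
          · rfl
        have h6 : (if k = 1 then if N - 1 ≤ n then coeff (n - (N - 1)) (A 0) else 0 else 0) =
            0 := by
          split_ifs with h7 h8
          · subst h7; exact absurd h8 h
          · rfl
          · rfl
        simp only [if_neg h, h4, h6, add_zero, sub_zero]
        exact hasDerivAt_const _ _
    have h2 : HasDerivAt (fun z : ℂ => if N ≤ n then
        ((t + z • e 1) 0 - (n - N : ℕ)) * coeff (n - N) (A z) else 0)
          ((if N ≤ n then (t 0 - (n - N : ℕ)) * coeff (n - N) G else 0) -
            (if N ≤ n + 1 then (t 0 - (n + 1 - N : ℕ)) * coeff (n + 1 - N) (A 0) else 0) -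
            (if N ≤ n then coeff (n + 1 - N) (A 0) else 0)) 0 := by
      by_cases h : N ≤ n
      · simp only [if_pos h, if_pos (show N ≤ n + 1 by omega), add_smul_e_one_apply]
        simp only [zero_ne_one, if_false, mul_zero, add_zero]
        refine ((hA.hasDerivAt (n - N)).const_mul _).congr_deriv ?_
        rw [show n + 1 - N = n - N + 1 by omega]
        push_cast
        ring
      · have h4 : (if N ≤ n + 1 then (t 0 - (n + 1 - N : ℕ)) * coeff (n + 1 - N) (A 0) else 0) =
            0 := by
          split_ifs with h5
          · rw [show n + 1 - N = 0 by omega, hA.coeff_zero, mul_zero]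
          · rfl
        simp only [if_neg h, h4, sub_zero]
        exact hasDerivAt_const _ _
    refine ((h1.add h2).const_mul (N : ℂ)⁻¹).congr_deriv ?_
    have h3 : ∑ k ∈ Icc 1 (N - 1),
        (if k = 1 then if N - 1 ≤ n then coeff (n - (N - 1)) (A 0) else 0 else 0) =
        (if N ≤ n then coeff (n + 1 - N) (A 0) else 0) -
          N * ((if N = 1 then 1 else 0) * coeff n (A 0)) := by
      rw [Finset.sum_ite_eq']
      rcases eq_or_ne N 1 with rfl | hN1
      · rcases eq_or_ne n 0 with rfl | hn
        · simpa using hA.coeff_zero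
        · simp [Nat.one_le_iff_ne_zero.2 hn]
      · rw [if_pos (Finset.mem_Icc.2 ⟨le_rfl, by omega⟩), if_neg hN1]
        by_cases h : N ≤ n
        · rw [if_pos h, if_pos (by omega), show n - (N - 1) = n + 1 - N by omega]
          simp
        · rw [if_neg h]
          split_ifs with h5
          · rw [show n - (N - 1) = 0 by omega, hA.coeff_zero]; simp
          · simp
    have hN0 : (N : ℂ) ≠ 0 := by exact_mod_cast (show N ≠ 0 by omega)
    rw [Finset.sum_sub_distrib, Finset.sum_add_distrib, h3]
    field_simp
    ring

lemma HasTwistedDeriv.dENil_pow {A : ℂ → ℂ⟦X⟧} {G : ℂ⟦X⟧} (hA : HasTwistedDeriv A G) {N : ℕ}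
    (hN : 1 ≤ N) (t : Times) (k : ℕ) :
    HasTwistedDeriv (fun z => (KP.dENil N (t + z • e 1) ^ k) (A z))
      ((KP.dENil N t ^ k) G -
        (k * if N = 1 then (1 : ℂ) else 0) • (KP.dENil N t ^ (k - 1)) (A 0)) := by
  induction k with
  | zero => simpa using hA
  | succ k ih =>
    have h := ih.dENil hN t
    have ht : t + (0 : ℂ) • e 1 = t := by simp
    simp only [ht, ← Module.End.mul_apply, ← pow_succ', map_sub, map_smul] at h
    convert h using 1
    rw [Nat.add_sub_cancel, sub_sub]
    congr 1
    cases k with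
    | zero => simp
    | succ k =>
      rw [Nat.add_sub_cancel, ← add_smul]
      congr 1
      push_cast
      ring

lemma hApply_add {h : ℤ → ℂ} {N : ℕ} (hN : 1 ≤ N) {t : Times} (hh : ConvergesAround h (t N))
    (A B : ℂ⟦X⟧) (i : ℤ) : hApply h N t (A + B) i = hApply h N t A i + hApply h N t B i := by
  rcases lt_or_ge 0 i with hi | hi
  · simp [hApply_of_pos h N t _ hi]
  · obtain ⟨n, rfl⟩ := Int.exists_eq_neg_ofNat hi
    simp only [hh.hApply_eq hN, map_add]

lemma hApply_smul (h : ℤ → ℂ) (N : ℕ) (t : Times) (r : ℂ) (A : ℂ⟦X⟧) (i : ℤ) :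
    hApply h N t (r • A) i = r * hApply h N t A i := by
  simp only [hApply]
  split_ifs
  · rw [← tsum_mul_left]
    simp [mul_left_comm]
  · simp

/-- `∂_x` commutes with `h(∂_E)` on `exp (ζ) A`. -/
lemma HasTwistedDeriv.hApply {h : ℤ → ℂ} {A : ℂ → ℂ⟦X⟧} {G : ℂ⟦X⟧} (hA : HasTwistedDeriv A G)
    {N : ℕ} (hN : 1 ≤ N) {t : Times} (hh : ConvergesAround h (t N)) (i : ℤ) :
    HasDerivAt (fun z => KP.hApply h N (t + z • e 1) (A z) i)
      (KP.hApply h N t G i - KP.hApply h N t (A 0) (i - 1)) 0 := by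
  have ht : t + (0 : ℂ) • e 1 = t := by simp
  have hD := raisesOrder_dENil hN t
  rcases lt_or_ge 0 i with hi | hi
  · simp only [hApply_of_pos h N _ _ hi]
    -- At $i=1$ the subtracted term has exponent $0$ and need not vanish formally; it does because
    -- $A$ has no constant coefficient.
    rcases eq_or_lt_of_le (show 1 ≤ i from hi) with rfl | hi
    · have := hh.hApply_eq hN 0 (A 0)
      rw [coeff_opSeries] at this
      simp only [Nat.cast_zero, neg_zero] at this
      rw [sub_self, this]
      simp only [zero_add, Finset.range_one, Finset.sum_singleton, pow_zero,
        Module.End.one_apply, hA.coeff_zero, mul_zero, sub_zero]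
      exact hasDerivAt_const _ _
    · rw [hApply_of_pos h N _ _ (show 0 < i - 1 by omega)]
      simpa using hasDerivAt_const (0 : ℂ) (0 : ℂ)
  · obtain ⟨n, rfl⟩ := Int.exists_eq_neg_ofNat hi
    have hcont : Tendsto (fun z : ℂ => (t + z • e 1) N) (𝓝 0) (𝓝 (t N)) := by
      have : Continuous fun z : ℂ => t N + z * if N = 1 then 1 else 0 := by fun_prop
      have := this.tendsto 0
      simpa only [zero_mul, add_zero, ← add_smul_e_one_apply] using this
    -- One term more than coefficient $n$ requires: its $x$-derivative involves coefficient $n+1$,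
    -- which $D^{n+1}$ can reach.
    have hev : (fun z => KP.hApply h N (t + z • e 1) (A z) (-n)) =ᶠ[𝓝 0] fun z =>
        ∑ k ∈ range (n + 2), laurentDeriv h k ((t + z • e 1) N) / k.factorial *
          coeff n ((KP.dENil N (t + z • e 1) ^ k) (A z)) := by
      filter_upwards [hcont.eventually hh.eventually] with z hz
      rw [hz.hApply_eq hN, (raisesOrder_dENil hN _).coeff_opSeries_of_le _ (Nat.le_succ n)]
    refine HasDerivAt.congr_of_eventuallyEq ?_ hev
    have hc : ∀ k : ℕ, HasDerivAt (fun z : ℂ => laurentDeriv h k ((t + z • e 1) N) / k.factorial)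
        (laurentDeriv h (k + 1) (t N) * (if N = 1 then 1 else 0) / k.factorial) 0 := by
      intro k
      refine HasDerivAt.div_const ?_ _
      have h1 : HasDerivAt (fun z : ℂ => (t + z • e 1) N) (if N = 1 then 1 else 0) 0 := by
        simp only [add_smul_e_one_apply]
        generalize (if N = 1 then (1 : ℂ) else 0) = ε
        simpa using ((hasDerivAt_id (0 : ℂ)).mul_const _).const_add (t N)
      exact (hh.hasDerivAt k).comp_of_eq 0 h1 (by rw [ht])
    have key := HasDerivAt.fun_sum fun k (_ : k ∈ range (n + 2)) =>
      (hc k).mul ((hA.dENil_pow hN t k).hasDerivAt n)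
    refine key.congr_deriv ?_
    rw [show (-(n : ℤ) - 1) = -((n + 1 : ℕ) : ℤ) by push_cast; ring, hh.hApply_eq hN,
      hh.hApply_eq hN, hD.coeff_opSeries_of_le _ (Nat.le_succ n), coeff_opSeries (n := n + 1)]
    simp only [ht, map_sub, coeff_smul, smul_eq_mul]
    -- For $N=1$ the derivative of $h^{(k)}(x)/k!$ cancels the commutator term of $D^{k+1}$. The
    -- boundary term at $M=n+2$ contains $D^{n+1}$ and has no coefficient of order $n$.
    have htel : ∀ M : ℕ, ∑ k ∈ range M,
        (laurentDeriv h (k + 1) (t N) * (if N = 1 then 1 else 0) / k.factorial *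
            coeff n ((KP.dENil N t ^ k) (A 0)) -
          laurentDeriv h k (t N) / k.factorial * ((k * if N = 1 then (1 : ℂ) else 0) *
            coeff n ((KP.dENil N t ^ (k - 1)) (A 0)))) =
        M * (laurentDeriv h M (t N) / M.factorial) * (if N = 1 then (1 : ℂ) else 0) *
            coeff n ((KP.dENil N t ^ (M - 1)) (A 0)) := by
      intro M
      induction M with
      | zero => simp
      | succ M ih =>
        rw [Finset.sum_range_succ, ih]
        have h0 : (M.factorial : ℂ) ≠ 0 := by exact_mod_cast M.factorial_ne_zero
        have h1 : (M + 1 : ℂ) ≠ 0 := by exact_mod_cast M.succ_ne_zero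
        rw [Nat.factorial_succ, Nat.add_sub_cancel]
        push_cast
        field_simp
        ring
    have htel2 := htel (n + 2)
    rw [show n + 2 - 1 = n + 1 by omega, hD.coeff_pow_of_lt (Nat.lt_succ_self n), mul_zero] at htel2
    rw [← Finset.sum_sub_distrib]
    refine sub_eq_zero.1 (Eq.trans ?_ htel2)
    rw [← Finset.sum_sub_distrib]
    refine Finset.sum_congr rfl fun k _ => ?_
    ring

end DerivativeInX

/-! ### The variation of $w$ induced by the vertex operators -/

section FieldAction

variable {U : Set Times} {τ : Times → ℂ} {h : ℤ → ℂ} {N : ℕ} {t : Times}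

/-- The differential Fay identity with only $e^{\zeta(\lambda)}$ absorbed: the factor
$e^{-\zeta(\mu)}$ leaves a term with $\mu$, hence the coefficient $m-1$. Since
$h(\partial_{\lambda^N})$ acts on $\lambda$ alone, each power of $\mu$ can be treated separately. -/
lemma IsTau.hasTwistedDeriv (hτ : IsTau U τ) (ht : t ∈ U) (m : ℤ) :
    HasTwistedDeriv (fun z => (τ (t + z • e 1))⁻¹ • vertexSeries τ m (t + z • e 1))
      (waveStar τ m t • waveSeries τ t + (τ t)⁻¹ • vertexSeries τ (m - 1) t) where
  coeff_zero := by simp [coeff_zero_vertexSeries]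
  hasDerivAt n := by
    have h1 := hτ.hasLineDerivAt_vertexSeries ht n m
    rw [HasLineDerivAt] at h1
    simp only [div_eq_inv_mul] at h1
    simp only [coeff_smul, smul_eq_mul, zero_smul, add_zero, map_add]
    exact h1.congr_deriv (by ring)

lemma IsTau.hasLineDerivAt_tauAction (hτ : IsTau U τ) (ht : t ∈ U) (hN : 1 ≤ N)
    (hh : ConvergesAround h (t N)) (i m : ℤ) :
    HasLineDerivAt ℂ (fun s => tauAction h N τ i m s / τ s)
      (waveStar τ m t * hApply h N t (waveSeries τ t) i + tauAction h N τ i (m - 1) t / τ t -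
        tauAction h N τ (i - 1) m t / τ t) t (e 1) := by
  have h1 := (hτ.hasTwistedDeriv ht m).hApply hN hh i
  simp only [hApply_smul, hApply_add hN hh, zero_smul, add_zero] at h1
  rw [HasLineDerivAt]
  simp only [tauAction, div_eq_inv_mul]
  exact h1

lemma IsTau.fieldAction_eq (hτ : IsTau U τ) (ht : t ∈ U) (hN : 1 ≤ N)
    (hh : ConvergesAround h (t N)) (i m : ℤ) :
    fieldAction h N τ i m t = 2 * hApply h N t (waveSeries τ t) i * waveStar τ m t := by
  rw [fieldAction, pd, (hτ.hasLineDerivAt_tauAction ht hN hh i m).lineDeriv]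
  ring

lemma IsTau.inducedFlow_eq (hτ : IsTau U τ) (ht : t ∈ U) (hN : 1 ≤ N)
    (hh : ConvergesAround h (t N)) (α : ℤ) : inducedFlow h N α τ t = symmetryFlow h N α τ t := by
  rw [inducedFlow, symmetryFlow, mul_finsum]
  simp only [hτ.fieldAction_eq ht hN hh, mul_assoc]

end FieldAction

/-! ### The residue as a finite sum; the case $N\ge6$ -/

section SymmetryFlow

open Finset hiding antidiagonal mem_antidiagonal
open Finset.HasAntidiagonal (antidiagonal mem_antidiagonal)

variable {U : Set Times} {τ : Times → ℂ} {h : ℤ → ℂ} {N : ℕ} {t : Times}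

lemma waveStar_of_pos {i : ℤ} (hi : 0 < i) : waveStar τ i t = 0 := if_neg hi.not_ge

/-- Both factors are series in $\lambda^{-1}$, so the residue with $\lambda^{n-1}$ collects the
pairs of orders with sum $n=\alpha+1$. -/
lemma symmetryFlow_eq_sum (hN : 1 ≤ N) (hh : ConvergesAround h (t N)) (n : ℕ) :
    symmetryFlow h N ((n : ℤ) - 1) τ t = 2 * ∑ p ∈ antidiagonal n,
      coeff p.1 (opSeries (fun k => laurentDeriv h k (t N) / k.factorial) (dENil N t)
        (waveSeries τ t)) * waveStar τ (-p.2) t := by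
  rw [symmetryFlow]
  congr 1
  rw [finsum_eq_sum_of_support_subset (s := (range (n + 1)).image fun j : ℕ => -(j : ℤ)),
    sum_image (fun a _ b _ hab => by simpa using hab), ← Nat.sum_antidiagonal_swap,
    Nat.sum_antidiagonal_eq_sum_range_succ_mk]
  · refine sum_congr rfl fun j hj => ?_
    have : j ≤ n := by simpa [Nat.lt_succ_iff] using hj
    rw [← hh.hApply_eq hN]
    congr 2
    simp only [Prod.swap_prod_mk]
    omega
  · intro i hi
    by_contra hi'
    apply hi
    have hi'' : 0 < i ∨ i < -n := by
      by_contra h4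
      exact hi' (mem_coe.2 (mem_image.2 ⟨(-i).toNat, mem_range.2 (by omega), by omega⟩))
    rcases hi'' with h4 | h4
    · simp [waveStar_of_pos h4]
    · beta_reduce
      rw [hApply_of_pos _ _ _ _ (by omega), zero_mul]

lemma sum_antidiagonal_shift (f g : ℕ → ℂ) (d m : ℕ) :
    ∑ p ∈ antidiagonal (d + m), (if d ≤ p.1 then f (p.1 - d) else 0) * g p.2 =
      ∑ p ∈ antidiagonal m, f p.1 * g p.2 := by
  induction d with
  | zero => simp
  | succ d ih =>
    rw [show d + 1 + m = d + m + 1 by ring, Nat.sum_antidiagonal_succ, ← ih]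
    simp

lemma coeff_dENil_one (t : Times) (n : ℕ) (A : ℂ⟦X⟧) : coeff n (dENil 1 t A) =
    if 1 ≤ n then (t 0 - (n - 1 : ℕ)) * coeff (n - 1) A else 0 := by
  rw [coeff_dENil le_rfl]
  simp

lemma coeff_dENil_two (t : Times) (n : ℕ) (A : ℂ⟦X⟧) : coeff n (dENil 2 t A) =
    2⁻¹ * ((if 1 ≤ n then t 1 * coeff (n - 1) A else 0) +
      if 2 ≤ n then (t 0 - (n - 2 : ℕ)) * coeff (n - 2) A else 0) := by
  rw [coeff_dENil one_le_two]
  simp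

lemma coeff_dENil_of_three_le (hN : 3 ≤ N)
    (hloc : ∀ k : ℕ, k ≠ 0 → k ≠ 1 → k ≠ 2 → k ≠ N → t k = 0) (n : ℕ) (A : ℂ⟦X⟧) :
    coeff n (dENil N t A) = (N : ℂ)⁻¹ *
      ((if N - 1 ≤ n then t 1 * coeff (n - (N - 1)) A else 0) +
        (if N - 2 ≤ n then 2 * t 2 * coeff (n - (N - 2)) A else 0) +
        if N ≤ n then (t 0 - (n - N : ℕ)) * coeff (n - N) A else 0) := by
  rw [coeff_dENil (by omega)]
  congr 2
  rw [← Finset.sum_subset (s₁ := {1, 2}), sum_pair (by omega)]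
  · simp
  · intro k hk
    simp only [mem_insert, mem_singleton] at hk
    rw [mem_Icc]
    omega
  · intro k hk hk'
    rw [mem_Icc] at hk
    simp only [mem_insert, mem_singleton, not_or] at hk'
    rw [hloc k (by omega) hk'.1 hk'.2 (by omega)]
    simp

lemma coeff_dENil_of_lt (hN : 3 ≤ N)
    (hloc : ∀ k : ℕ, k ≠ 0 → k ≠ 1 → k ≠ 2 → k ≠ N → t k = 0) {n : ℕ} (hn : n < N - 2)
    (A : ℂ⟦X⟧) : coeff n (dENil N t A) = 0 := by
  rw [coeff_dENil_of_three_le hN hloc, if_neg (by omega), if_neg (by omega), if_neg (by omega)]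
  simp

/-- With only $t_1,t_2,t_N$ present, $D$ raises the order by at least $N-2$; two factors raise it by
$2N-4$, which exceeds $N+1$ exactly when $N\ge6$. -/
lemma coeff_dENil_pow_of_le (hN : 6 ≤ N)
    (hloc : ∀ k : ℕ, k ≠ 0 → k ≠ 1 → k ≠ 2 → k ≠ N → t k = 0) {n : ℕ} (hn : n ≤ N + 1) (k : ℕ)
    (A : ℂ⟦X⟧) : coeff n ((dENil N t ^ (k + 2)) A) = 0 := by
  have h0 : ∀ j ≤ 3, coeff j (dENil N t ((dENil N t ^ k) A)) = 0 := fun j hj =>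
    coeff_dENil_of_lt (by omega) hloc (by omega) _
  rw [pow_succ', pow_succ', Module.End.mul_apply, Module.End.mul_apply,
    coeff_dENil_of_three_le (by omega) hloc]
  simp only [h0 (n - (N - 1)) (by omega), h0 (n - (N - 2)) (by omega), h0 (n - N) (by omega)]
  simp

/-- For `N ≥ 6` only two terms of `h(∂_E)` contribute. -/
lemma coeff_opSeries_of_six_le (hN : 6 ≤ N)
    (hloc : ∀ k : ℕ, k ≠ 0 → k ≠ 1 → k ≠ 2 → k ≠ N → t k = 0) {n : ℕ} (hn : n ≤ N + 1)
    (c : ℕ → ℂ) (A : ℂ⟦X⟧) : coeff n (opSeries c (dENil N t) A) =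
      c 0 * coeff n A + c 1 * coeff n (dENil N t A) := by
  rw [(raisesOrder_dENil (by omega) t).coeff_opSeries_of_le c (Nat.le_succ n), sum_range_succ',
    sum_range_succ', sum_eq_zero]
  · simp [add_comm]
  · intro k _
    rw [coeff_dENil_pow_of_le hN hloc hn, mul_zero]

/-- The term $k=0$ gives $\operatorname{res}\lambda^N\varphi\varphi^*$. In $D$ the times $t_1$ and
$t_2$ shift the order by $N-1$ and $N-2$, leaving the residues with $\lambda$ and $\lambda^2$, that
is $w_x$ and $w_y$. -/
lemma IsTau.symmetryFlow_natCast_of_six_le (hτ : IsTau U τ) (ht : t ∈ U) (hN : 6 ≤ N)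
    (hloc : ∀ k : ℕ, k ≠ 0 → k ≠ 1 → k ≠ 2 → k ≠ N → t k = 0)
    (hh : ConvergesAround h (t N)) :
    symmetryFlow h N N τ t = laurentDeriv h 0 (t N) * pd N (field τ) t +
      laurentDeriv h 1 (t N) / N *
        (2 * t 2 * pd 2 (field τ) t + t 1 * pd 1 (field τ) t + field τ t) := by
  have h1 := symmetryFlow_eq_sum (τ := τ) (by omega) hh (N + 1)
  rw [show ((N + 1 : ℕ) : ℤ) - 1 = N by push_cast; ring] at h1
  rw [h1, sum_congr rfl fun p hp => by
    rw [coeff_opSeries_of_six_le hN hloc (by have := mem_antidiagonal.1 hp; omega), add_mul,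
      coeff_dENil_of_three_le (by omega) hloc]]
  have e0 := hτ.sum_antidiagonal_eq ht (N - 1)
  have e1 := hτ.sum_antidiagonal_eq ht 0
  have e2 := hτ.sum_antidiagonal_eq ht 1
  have s1 := sum_antidiagonal_shift (fun j => coeff j (waveSeries τ t))
    (fun j => waveStar τ (-j) t) (N - 1) 2
  have s2 := sum_antidiagonal_shift (fun j => coeff j (waveSeries τ t))
    (fun j => waveStar τ (-j) t) (N - 2) 3
  have s3 := sum_antidiagonal_shift (fun j => (t 0 - j) * coeff j (waveSeries τ t))
    (fun j => waveStar τ (-j) t) N 1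
  rw [show N - 1 + 2 = N + 1 by omega] at e0 s1
  rw [show N - 2 + 3 = N + 1 by omega] at s2
  rw [show N - 1 + 1 = N by omega] at e0
  rw [e1] at s1
  rw [e2] at s2
  -- The zero time drops out: $t_0\cdot w/2+(t_0-1)(-w/2)=w/2$.
  have s3' : ∑ p ∈ antidiagonal 1, (t 0 - p.1) * coeff p.1 (waveSeries τ t) *
      waveStar τ (-p.2) t = field τ t / 2 := by
    simp only [Nat.sum_antidiagonal_succ, Nat.antidiagonal_zero, sum_singleton]
    have := hτ.coeff_zero_waveSeries ht
    have := hτ.waveStar_zero ht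
    have := hτ.coeff_one_waveSeries ht
    have := hτ.waveStar_neg_one ht
    simp_all
    ring
  rw [s3'] at s3
  have hN0 : (N : ℂ) ≠ 0 := by exact_mod_cast (show N ≠ 0 by omega)
  have key : ∀ p : ℕ × ℕ, laurentDeriv h 0 (t N) / (Nat.factorial 0 : ℂ) *
      coeff p.1 (waveSeries τ t) * waveStar τ (-p.2) t +
      laurentDeriv h 1 (t N) / (Nat.factorial 1 : ℂ) * ((N : ℂ)⁻¹ *
      ((if N - 1 ≤ p.1 then t 1 * coeff (p.1 - (N - 1)) (waveSeries τ t) else 0) +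
        (if N - 2 ≤ p.1 then 2 * t 2 * coeff (p.1 - (N - 2)) (waveSeries τ t) else 0) +
        if N ≤ p.1 then (t 0 - (p.1 - N : ℕ)) * coeff (p.1 - N) (waveSeries τ t) else 0)) *
        waveStar τ (-p.2) t =
      laurentDeriv h 0 (t N) * (coeff p.1 (waveSeries τ t) * waveStar τ (-p.2) t) +
      laurentDeriv h 1 (t N) / N * (t 1 * ((if N - 1 ≤ p.1 then
          coeff (p.1 - (N - 1)) (waveSeries τ t) else 0) * waveStar τ (-p.2) t) +
        2 * t 2 * ((if N - 2 ≤ p.1 then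
          coeff (p.1 - (N - 2)) (waveSeries τ t) else 0) * waveStar τ (-p.2) t) +
        (if N ≤ p.1 then (t 0 - (p.1 - N : ℕ)) * coeff (p.1 - N) (waveSeries τ t) else 0) *
          waveStar τ (-p.2) t) := by
    intro p
    rw [Nat.factorial_zero, Nat.factorial_one]
    split_ifs <;> ring
  rw [sum_congr rfl fun p _ => key p]
  simp only [sum_add_distrib, ← mul_sum]
  rw [e0, s1, s2, s3]
  ring

lemma symmetryFlow_sub_one_of_six_le (hN : 6 ≤ N)
    (hloc : ∀ k : ℕ, k ≠ 0 → k ≠ 1 → k ≠ 2 → k ≠ N → t k = 0)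
    (hh : ConvergesAround h (t N)) {n : ℕ} (hn : n ≤ 3) :
    symmetryFlow h N ((n : ℤ) - 1) τ t = 2 * (laurentDeriv h 0 (t N) *
      ∑ p ∈ antidiagonal n, coeff p.1 (waveSeries τ t) * waveStar τ (-p.2) t) := by
  rw [symmetryFlow_eq_sum (by omega) hh]
  congr 1
  rw [mul_sum]
  refine sum_congr rfl fun p hp => ?_
  have := mem_antidiagonal.1 hp
  rw [coeff_opSeries_of_six_le hN hloc (by omega), coeff_dENil_of_lt (by omega) hloc (by omega)]
  simp [mul_assoc]

end SymmetryFlow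

/-! ### Explicit point flows for $N\le5$ -/

section PointSymmetries

open Finset hiding antidiagonal mem_antidiagonal
open Finset.HasAntidiagonal (antidiagonal mem_antidiagonal)

variable {U : Set Times} {τ : Times → ℂ} {h : ℤ → ℂ} {t : Times}

/-- The cases $N\le5$ share one scheme: the `d`s are the low coefficients of $D$, the `e`s evaluate
$\operatorname{res}\lambda^n\varphi\varphi^*$, and the residue is expanded completely. -/
lemma IsTau.symmetryFlow_one (hτ : IsTau U τ) (ht : t ∈ U)
    (hh : ConvergesAround h (t 1)) {α : ℤ} (hα : α = 1 ∨ α = 0 ∨ α = -1) :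
    symmetryFlow h 1 α τ t = pointFlow 1 (pointField 1 α (t 0) (t 1) (t 2) (field τ t)
      fun k => laurentDeriv h k (t 1)) (field τ) t := by
  have k0 := hτ.coeff_zero_waveSeries ht
  have s0 := hτ.waveStar_zero ht
  have k1 := hτ.coeff_one_waveSeries ht
  have s1 := hτ.waveStar_neg_one ht
  have e0 := hτ.sum_antidiagonal_eq ht 0
  -- The simp lemma is switched off so that `coeff 0` keeps the form in which `k0` can rewrite it.
  norm_num [Nat.sum_antidiagonal_succ, -coeff_zero_eq_constantCoeff, k0, k1, s0, s1] at e0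
  have d0 := coeff_dENil_one t 0
  have d1 := coeff_dENil_one t 1
  have d2 := coeff_dENil_one t 2
  norm_num [-coeff_zero_eq_constantCoeff] at d0 d1 d2
  rcases hα with rfl | rfl | rfl
  · have h1 := symmetryFlow_eq_sum (τ := τ) (by norm_num) hh 2
    norm_num [Nat.sum_antidiagonal_succ, coeff_opSeries, sum_range_succ, pow_succ',
      Module.End.mul_apply, d0, d1, d2, -coeff_zero_eq_constantCoeff,
      k0, k1, s0, s1, Nat.factorial] at h1
    simp only [pointFlow, pointField, Int.reduceEq, Int.reduceNeg, reduceIte, reduceCtorEq]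
    linear_combination h1 + 2 * laurentDeriv h 0 (t 1) * e0
  · have h1 := symmetryFlow_eq_sum (τ := τ) (by norm_num) hh 1
    norm_num [Nat.sum_antidiagonal_succ, coeff_opSeries, sum_range_succ, pow_succ',
      Module.End.mul_apply, d0, d1, d2, -coeff_zero_eq_constantCoeff,
      k0, k1, s0, s1, Nat.factorial] at h1
    simp only [pointFlow, pointField, Int.reduceEq, Int.reduceNeg, reduceIte, reduceCtorEq]
    linear_combination h1
  · have h1 := symmetryFlow_eq_sum (τ := τ) (by norm_num) hh 0
    norm_num [Nat.sum_antidiagonal_succ, coeff_opSeries, sum_range_succ, pow_succ',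
      Module.End.mul_apply, d0, d1, d2, -coeff_zero_eq_constantCoeff,
      k0, k1, s0, s1, Nat.factorial] at h1
    simp only [pointFlow, pointField, Int.reduceNeg, reduceIte, reduceCtorEq]
    linear_combination h1

lemma IsTau.symmetryFlow_two (hτ : IsTau U τ) (ht : t ∈ U)
    (hh : ConvergesAround h (t 2)) {α : ℤ} (hα : α = 2 ∨ α = 1 ∨ α = 0 ∨ α = -1) :
    symmetryFlow h 2 α τ t = pointFlow 2 (pointField 2 α (t 0) (t 1) (t 2) (field τ t)
      fun k => laurentDeriv h k (t 2)) (field τ) t := by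
  have k0 := hτ.coeff_zero_waveSeries ht
  have s0 := hτ.waveStar_zero ht
  have k1 := hτ.coeff_one_waveSeries ht
  have s1 := hτ.waveStar_neg_one ht
  have e0 := hτ.sum_antidiagonal_eq ht 0
  have e1 := hτ.sum_antidiagonal_eq ht 1
  norm_num [Nat.sum_antidiagonal_succ, -coeff_zero_eq_constantCoeff, k0, k1, s0, s1] at e0 e1
  have d0 := coeff_dENil_two t 0
  have d1 := coeff_dENil_two t 1
  have d2 := coeff_dENil_two t 2
  have d3 := coeff_dENil_two t 3
  norm_num [-coeff_zero_eq_constantCoeff] at d0 d1 d2 d3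
  rcases hα with rfl | rfl | rfl | rfl
  · have h1 := symmetryFlow_eq_sum (τ := τ) (by norm_num) hh 3
    norm_num [Nat.sum_antidiagonal_succ, coeff_opSeries, sum_range_succ, pow_succ',
      Module.End.mul_apply, d0, d1, d2, d3, -coeff_zero_eq_constantCoeff,
      k0, k1, s0, s1, Nat.factorial] at h1
    simp only [pointFlow, pointField, Int.reduceEq, Int.reduceNeg, reduceIte, reduceCtorEq]
    -- The multipliers of `e1` and `e0` are the coefficients of $\varphi\varphi^*$ sums in the
    -- expanded residue; they trade the higher coefficients of $\varphi,\varphi^*$ for $w_y$ and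
    -- $w_x$.
    linear_combination h1 + 2 * laurentDeriv h 0 (t 2) * e1 + t 1 * laurentDeriv h 1 (t 2) * e0
  · have h1 := symmetryFlow_eq_sum (τ := τ) (by norm_num) hh 2
    norm_num [Nat.sum_antidiagonal_succ, coeff_opSeries, sum_range_succ, pow_succ',
      Module.End.mul_apply, d0, d1, d2, d3, -coeff_zero_eq_constantCoeff,
      k0, k1, s0, s1, Nat.factorial] at h1
    simp only [pointFlow, pointField, Int.reduceEq, Int.reduceNeg, reduceIte, reduceCtorEq]
    linear_combination h1 + 2 * laurentDeriv h 0 (t 2) * e0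
  · have h1 := symmetryFlow_eq_sum (τ := τ) (by norm_num) hh 1
    norm_num [Nat.sum_antidiagonal_succ, coeff_opSeries, sum_range_succ, pow_succ',
      Module.End.mul_apply, d0, d1, d2, d3, -coeff_zero_eq_constantCoeff,
      k0, k1, s0, s1, Nat.factorial] at h1
    simp only [pointFlow, pointField, Int.reduceEq, Int.reduceNeg, reduceIte, reduceCtorEq]
    linear_combination h1
  · have h1 := symmetryFlow_eq_sum (τ := τ) (by norm_num) hh 0
    norm_num [Nat.sum_antidiagonal_succ, coeff_opSeries, sum_range_succ, pow_succ',
      Module.End.mul_apply, d0, d1, d2, d3, -coeff_zero_eq_constantCoeff,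
      k0, k1, s0, s1, Nat.factorial] at h1
    simp only [pointFlow, pointField, Int.reduceNeg, reduceIte, reduceCtorEq]
    linear_combination h1

lemma IsTau.symmetryFlow_three (hτ : IsTau U τ) (ht : t ∈ U)
    (hloc : ∀ k : ℕ, k ≠ 0 → k ≠ 1 → k ≠ 2 → k ≠ 3 → t k = 0)
    (hh : ConvergesAround h (t 3)) {α : ℤ} (hα : α = 3 ∨ α = 2 ∨ α = 1 ∨ α = 0 ∨ α = -1) :
    symmetryFlow h 3 α τ t = pointFlow 3 (pointField 3 α (t 0) (t 1) (t 2) (field τ t)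
      fun k => laurentDeriv h k (t 3)) (field τ) t := by
  have k0 := hτ.coeff_zero_waveSeries ht
  have s0 := hτ.waveStar_zero ht
  have k1 := hτ.coeff_one_waveSeries ht
  have s1 := hτ.waveStar_neg_one ht
  have e0 := hτ.sum_antidiagonal_eq ht 0
  have e1 := hτ.sum_antidiagonal_eq ht 1
  have e2 := hτ.sum_antidiagonal_eq ht 2
  norm_num [Nat.sum_antidiagonal_succ, -coeff_zero_eq_constantCoeff, k0, k1, s0, s1] at e0 e1 e2
  have d0 := coeff_dENil_of_three_le (show 3 ≤ 3 by norm_num) hloc 0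
  have d1 := coeff_dENil_of_three_le (show 3 ≤ 3 by norm_num) hloc 1
  have d2 := coeff_dENil_of_three_le (show 3 ≤ 3 by norm_num) hloc 2
  have d3 := coeff_dENil_of_three_le (show 3 ≤ 3 by norm_num) hloc 3
  have d4 := coeff_dENil_of_three_le (show 3 ≤ 3 by norm_num) hloc 4
  norm_num [-coeff_zero_eq_constantCoeff] at d0 d1 d2 d3 d4
  rcases hα with rfl | rfl | rfl | rfl | rfl
  · have h1 := symmetryFlow_eq_sum (τ := τ) (by norm_num) hh 4
    norm_num [Nat.sum_antidiagonal_succ, coeff_opSeries, sum_range_succ, pow_succ',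
      Module.End.mul_apply, d0, d1, d2, d3, d4, -coeff_zero_eq_constantCoeff,
      k0, k1, s0, s1, Nat.factorial] at h1
    simp only [pointFlow, pointField, Int.reduceEq, Int.reduceNeg, reduceIte, reduceCtorEq]
    -- For $N=3$ the time $y$ raises the order by one only, so all powers up to $D^4$ reach the
    -- residue; the last gives $2(2y/3)^4/4!=\frac4{243}y^4$.
    linear_combination h1 + 2 * laurentDeriv h 0 (t 3) * e2 +
      2 / 3 * laurentDeriv h 1 (t 3) * (2 * t 2 * e1 + t 1 * e0) +
      4 / 9 * t 2 ^ 2 * laurentDeriv h 2 (t 3) * e0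
  · have h1 := symmetryFlow_eq_sum (τ := τ) (by norm_num) hh 3
    norm_num [Nat.sum_antidiagonal_succ, coeff_opSeries, sum_range_succ, pow_succ',
      Module.End.mul_apply, d0, d1, d2, d3, d4, -coeff_zero_eq_constantCoeff,
      k0, k1, s0, s1, Nat.factorial] at h1
    simp only [pointFlow, pointField, Int.reduceEq, Int.reduceNeg, reduceIte, reduceCtorEq]
    linear_combination h1 + 2 * laurentDeriv h 0 (t 3) * e1 +
      4 / 3 * t 2 * laurentDeriv h 1 (t 3) * e0
  · have h1 := symmetryFlow_eq_sum (τ := τ) (by norm_num) hh 2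
    norm_num [Nat.sum_antidiagonal_succ, coeff_opSeries, sum_range_succ, pow_succ',
      Module.End.mul_apply, d0, d1, d2, d3, d4, -coeff_zero_eq_constantCoeff,
      k0, k1, s0, s1, Nat.factorial] at h1
    simp only [pointFlow, pointField, Int.reduceEq, Int.reduceNeg, reduceIte, reduceCtorEq]
    linear_combination h1 + 2 * laurentDeriv h 0 (t 3) * e0
  · have h1 := symmetryFlow_eq_sum (τ := τ) (by norm_num) hh 1
    norm_num [Nat.sum_antidiagonal_succ, coeff_opSeries, sum_range_succ, pow_succ',
      Module.End.mul_apply, d0, d1, d2, d3, d4, -coeff_zero_eq_constantCoeff,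
      k0, k1, s0, s1, Nat.factorial] at h1
    simp only [pointFlow, pointField, Int.reduceEq, Int.reduceNeg, reduceIte, reduceCtorEq]
    linear_combination h1
  · have h1 := symmetryFlow_eq_sum (τ := τ) (by norm_num) hh 0
    norm_num [Nat.sum_antidiagonal_succ, coeff_opSeries, sum_range_succ, pow_succ',
      Module.End.mul_apply, d0, d1, d2, d3, d4, -coeff_zero_eq_constantCoeff,
      k0, k1, s0, s1, Nat.factorial] at h1
    simp only [pointFlow, pointField, Int.reduceNeg, reduceIte, reduceCtorEq]
    linear_combination h1

lemma IsTau.symmetryFlow_four (hτ : IsTau U τ) (ht : t ∈ U)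
    (hloc : ∀ k : ℕ, k ≠ 0 → k ≠ 1 → k ≠ 2 → k ≠ 4 → t k = 0)
    (hh : ConvergesAround h (t 4)) {α : ℤ} (hα : α = 4 ∨ α = 2 ∨ α = 1 ∨ α = 0 ∨ α = -1) :
    symmetryFlow h 4 α τ t = pointFlow 4 (pointField 4 α (t 0) (t 1) (t 2) (field τ t)
      fun k => laurentDeriv h k (t 4)) (field τ) t := by
  have k0 := hτ.coeff_zero_waveSeries ht
  have s0 := hτ.waveStar_zero ht
  have k1 := hτ.coeff_one_waveSeries ht
  have s1 := hτ.waveStar_neg_one ht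
  have e0 := hτ.sum_antidiagonal_eq ht 0
  have e1 := hτ.sum_antidiagonal_eq ht 1
  have e2 := hτ.sum_antidiagonal_eq ht 2
  have e3 := hτ.sum_antidiagonal_eq ht 3
  norm_num [Nat.sum_antidiagonal_succ, -coeff_zero_eq_constantCoeff, k0, k1, s0, s1] at e0 e1 e2 e3
  have d0 := coeff_dENil_of_three_le (show 3 ≤ 4 by norm_num) hloc 0
  have d1 := coeff_dENil_of_three_le (show 3 ≤ 4 by norm_num) hloc 1
  have d2 := coeff_dENil_of_three_le (show 3 ≤ 4 by norm_num) hloc 2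
  have d3 := coeff_dENil_of_three_le (show 3 ≤ 4 by norm_num) hloc 3
  have d4 := coeff_dENil_of_three_le (show 3 ≤ 4 by norm_num) hloc 4
  have d5 := coeff_dENil_of_three_le (show 3 ≤ 4 by norm_num) hloc 5
  norm_num [-coeff_zero_eq_constantCoeff] at d0 d1 d2 d3 d4 d5
  rcases hα with rfl | rfl | rfl | rfl | rfl
  · have h1 := symmetryFlow_eq_sum (τ := τ) (by norm_num) hh 5
    norm_num [Nat.sum_antidiagonal_succ, coeff_opSeries, sum_range_succ, pow_succ',
      Module.End.mul_apply, d0, d1, d2, d3, d4, d5, -coeff_zero_eq_constantCoeff,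
      k0, k1, s0, s1, Nat.factorial] at h1
    simp only [pointFlow, pointField, Int.reduceEq, Int.reduceNeg, reduceIte, reduceCtorEq]
    linear_combination h1 + 2 * laurentDeriv h 0 (t 4) * e3 + laurentDeriv h 1 (t 4) * (t 2 * e1 +
      t 1 / 2 * e0)
  · have h1 := symmetryFlow_eq_sum (τ := τ) (by norm_num) hh 3
    norm_num [Nat.sum_antidiagonal_succ, coeff_opSeries, sum_range_succ, pow_succ',
      Module.End.mul_apply, d0, d1, d2, d3, d4, d5, -coeff_zero_eq_constantCoeff,
      k0, k1, s0, s1, Nat.factorial] at h1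
    simp only [pointFlow, pointField, Int.reduceEq, Int.reduceNeg, reduceIte, reduceCtorEq]
    linear_combination h1 + 2 * laurentDeriv h 0 (t 4) * e1
  · have h1 := symmetryFlow_eq_sum (τ := τ) (by norm_num) hh 2
    norm_num [Nat.sum_antidiagonal_succ, coeff_opSeries, sum_range_succ, pow_succ',
      Module.End.mul_apply, d0, d1, d2, d3, d4, d5, -coeff_zero_eq_constantCoeff,
      k0, k1, s0, s1, Nat.factorial] at h1
    simp only [pointFlow, pointField, Int.reduceEq, Int.reduceNeg, reduceIte, reduceCtorEq]
    linear_combination h1 + 2 * laurentDeriv h 0 (t 4) * e0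
  · have h1 := symmetryFlow_eq_sum (τ := τ) (by norm_num) hh 1
    norm_num [Nat.sum_antidiagonal_succ, coeff_opSeries, sum_range_succ, pow_succ',
      Module.End.mul_apply, d0, d1, d2, d3, d4, d5, -coeff_zero_eq_constantCoeff,
      k0, k1, s0, s1, Nat.factorial] at h1
    simp only [pointFlow, pointField, Int.reduceEq, Int.reduceNeg, reduceIte, reduceCtorEq]
    linear_combination h1
  · have h1 := symmetryFlow_eq_sum (τ := τ) (by norm_num) hh 0
    norm_num [Nat.sum_antidiagonal_succ, coeff_opSeries, sum_range_succ, pow_succ',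
      Module.End.mul_apply, d0, d1, d2, d3, d4, d5, -coeff_zero_eq_constantCoeff,
      k0, k1, s0, s1, Nat.factorial] at h1
    simp only [pointFlow, pointField, Int.reduceNeg, reduceIte, reduceCtorEq]
    linear_combination h1

lemma IsTau.symmetryFlow_five (hτ : IsTau U τ) (ht : t ∈ U)
    (hloc : ∀ k : ℕ, k ≠ 0 → k ≠ 1 → k ≠ 2 → k ≠ 5 → t k = 0)
    (hh : ConvergesAround h (t 5)) {α : ℤ} (hα : α = 5 ∨ α = 2 ∨ α = 1 ∨ α = 0 ∨ α = -1) :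
    symmetryFlow h 5 α τ t = pointFlow 5 (pointField 5 α (t 0) (t 1) (t 2) (field τ t)
      fun k => laurentDeriv h k (t 5)) (field τ) t := by
  have k0 := hτ.coeff_zero_waveSeries ht
  have s0 := hτ.waveStar_zero ht
  have k1 := hτ.coeff_one_waveSeries ht
  have s1 := hτ.waveStar_neg_one ht
  have e0 := hτ.sum_antidiagonal_eq ht 0
  have e1 := hτ.sum_antidiagonal_eq ht 1
  have e2 := hτ.sum_antidiagonal_eq ht 2
  have e3 := hτ.sum_antidiagonal_eq ht 3
  have e4 := hτ.sum_antidiagonal_eq ht 4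
  norm_num [Nat.sum_antidiagonal_succ, -coeff_zero_eq_constantCoeff, k0, k1, s0, s1]
    at e0 e1 e2 e3 e4
  have d0 := coeff_dENil_of_three_le (show 3 ≤ 5 by norm_num) hloc 0
  have d1 := coeff_dENil_of_three_le (show 3 ≤ 5 by norm_num) hloc 1
  have d2 := coeff_dENil_of_three_le (show 3 ≤ 5 by norm_num) hloc 2
  have d3 := coeff_dENil_of_three_le (show 3 ≤ 5 by norm_num) hloc 3
  have d4 := coeff_dENil_of_three_le (show 3 ≤ 5 by norm_num) hloc 4
  have d5 := coeff_dENil_of_three_le (show 3 ≤ 5 by norm_num) hloc 5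
  have d6 := coeff_dENil_of_three_le (show 3 ≤ 5 by norm_num) hloc 6
  norm_num [-coeff_zero_eq_constantCoeff] at d0 d1 d2 d3 d4 d5 d6
  rcases hα with rfl | rfl | rfl | rfl | rfl
  · have h1 := symmetryFlow_eq_sum (τ := τ) (by norm_num) hh 6
    norm_num [Nat.sum_antidiagonal_succ, coeff_opSeries, sum_range_succ, pow_succ',
      Module.End.mul_apply, d0, d1, d2, d3, d4, d5, d6, -coeff_zero_eq_constantCoeff,
      k0, k1, s0, s1, Nat.factorial] at h1
    simp only [pointFlow, pointField, Int.reduceEq, Int.reduceNeg, reduceIte, reduceCtorEq]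
    -- For $N=5$ the total order is $6=2(N-2)$, so $D^2$ contributes only its leading term
    -- $2(2y/5)^2/2!=\frac4{25}y^2$.
    linear_combination h1 + 2 * laurentDeriv h 0 (t 5) * e4 +
      2 / 5 * laurentDeriv h 1 (t 5) * (2 * t 2 * e1 + t 1 * e0)
  · have h1 := symmetryFlow_eq_sum (τ := τ) (by norm_num) hh 3
    norm_num [Nat.sum_antidiagonal_succ, coeff_opSeries, sum_range_succ, pow_succ',
      Module.End.mul_apply, d0, d1, d2, d3, d4, d5, d6, -coeff_zero_eq_constantCoeff,
      k0, k1, s0, s1, Nat.factorial] at h1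
    simp only [pointFlow, pointField, Int.reduceEq, Int.reduceNeg, reduceIte, reduceCtorEq]
    linear_combination h1 + 2 * laurentDeriv h 0 (t 5) * e1
  · have h1 := symmetryFlow_eq_sum (τ := τ) (by norm_num) hh 2
    norm_num [Nat.sum_antidiagonal_succ, coeff_opSeries, sum_range_succ, pow_succ',
      Module.End.mul_apply, d0, d1, d2, d3, d4, d5, d6, -coeff_zero_eq_constantCoeff,
      k0, k1, s0, s1, Nat.factorial] at h1
    simp only [pointFlow, pointField, Int.reduceEq, Int.reduceNeg, reduceIte, reduceCtorEq]
    linear_combination h1 + 2 * laurentDeriv h 0 (t 5) * e0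
  · have h1 := symmetryFlow_eq_sum (τ := τ) (by norm_num) hh 1
    norm_num [Nat.sum_antidiagonal_succ, coeff_opSeries, sum_range_succ, pow_succ',
      Module.End.mul_apply, d0, d1, d2, d3, d4, d5, d6, -coeff_zero_eq_constantCoeff,
      k0, k1, s0, s1, Nat.factorial] at h1
    simp only [pointFlow, pointField, Int.reduceEq, Int.reduceNeg, reduceIte, reduceCtorEq]
    linear_combination h1
  · have h1 := symmetryFlow_eq_sum (τ := τ) (by norm_num) hh 0
    norm_num [Nat.sum_antidiagonal_succ, coeff_opSeries, sum_range_succ, pow_succ',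
      Module.End.mul_apply, d0, d1, d2, d3, d4, d5, d6, -coeff_zero_eq_constantCoeff,
      k0, k1, s0, s1, Nat.factorial] at h1
    simp only [pointFlow, pointField, Int.reduceNeg, reduceIte, reduceCtorEq]
    linear_combination h1

end PointSymmetries

/-! ### All $N$ together -/

section PointSymmetriesGeneral

open Finset.HasAntidiagonal (antidiagonal mem_antidiagonal)

variable {U : Set Times} {τ : Times → ℂ} {h : ℤ → ℂ} {t : Times}

lemma IsTau.symmetryFlow_of_six_le (hτ : IsTau U τ) (ht : t ∈ U) {N : ℕ} (hN : 6 ≤ N)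
    (hloc : ∀ k : ℕ, k ≠ 0 → k ≠ 1 → k ≠ 2 → k ≠ N → t k = 0)
    (hh : ConvergesAround h (t N)) {α : ℤ}
    (hα : α = N ∨ α = 2 ∨ α = 1 ∨ α = 0 ∨ α = -1) :
    symmetryFlow h N α τ t = pointFlow N (pointField N α (t 0) (t 1) (t 2) (field τ t)
      fun k => laurentDeriv h k (t N)) (field τ) t := by
  have k0 := hτ.coeff_zero_waveSeries ht
  have s0 := hτ.waveStar_zero ht
  have k1 := hτ.coeff_one_waveSeries ht
  have s1 := hτ.waveStar_neg_one ht
  have hflow := hτ.symmetryFlow_natCast_of_six_le ht hN hloc hh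
  have hsub : ∀ {n : ℕ}, n ≤ 3 → _ :=
    fun {n} hn => symmetryFlow_sub_one_of_six_le (τ := τ) (n := n) hN hloc hh hn
  -- In this form the pattern match in `pointField` reduces to its generic branch.
  obtain ⟨M, rfl⟩ : ∃ M, N = M + 6 := ⟨N - 6, by omega⟩
  have hc : ∀ m : ℤ, m < 6 → ¬ m = ((M + 6 : ℕ) : ℤ) := by intro m hm; omega
  simp only [pointFlow, pointField]
  rcases hα with rfl | rfl | rfl | rfl | rfl
  · rw [hflow, if_pos rfl]
    ring
  · rw [if_neg (hc 2 (by norm_num)), if_pos rfl, show (2 : ℤ) = ((3 : ℕ) : ℤ) - 1 by norm_num,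
      hsub le_rfl, hτ.sum_antidiagonal_eq ht 1]
    ring
  · rw [if_neg (hc 1 (by norm_num)), if_neg (by norm_num), if_pos rfl,
      show (1 : ℤ) = ((2 : ℕ) : ℤ) - 1 by norm_num, hsub (by norm_num),
      hτ.sum_antidiagonal_eq ht 0]
    ring
  · rw [if_neg (hc 0 (by norm_num)), if_neg (by norm_num), if_neg (by norm_num),
      if_neg (by norm_num), show (0 : ℤ) = ((1 : ℕ) : ℤ) - 1 by norm_num, hsub (by norm_num)]
    simp [Finset.Nat.sum_antidiagonal_succ, -coeff_zero_eq_constantCoeff, k0, k1, s0, s1]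
  · rw [if_neg (hc (-1) (by norm_num)), if_neg (by norm_num), if_neg (by norm_num), if_pos rfl,
      show (-1 : ℤ) = ((0 : ℕ) : ℤ) - 1 by norm_num, hsub (by norm_num)]
    simp [-coeff_zero_eq_constantCoeff, k0, s0]

/-- The symmetry flow is the point flow. -/
theorem IsTau.symmetryFlow_eq_pointFlow (hτ : IsTau U τ) (ht : t ∈ U) {N : ℕ} (hN : 1 ≤ N)
    (hloc : ∀ k : ℕ, k ≠ 0 → k ≠ 1 → k ≠ 2 → k ≠ N → t k = 0)
    (hh : ConvergesAround h (t N)) {α : ℤ}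
    (hα : α = N ∨ α = 2 ∨ α = 1 ∨ α = 0 ∨ α = -1) (hαN : α ≤ N) :
    symmetryFlow h N α τ t = pointFlow N (pointField N α (t 0) (t 1) (t 2) (field τ t)
      fun k => iteratedDeriv k (laurentFun h) (t N)) (field τ) t := by
  simp only [hh.iteratedDeriv_eq]
  rcases le_or_gt 6 N with h6 | h6
  · exact hτ.symmetryFlow_of_six_le ht h6 hloc hh hα
  · interval_cases N
    · exact hτ.symmetryFlow_one ht hh (by omega)
    · exact hτ.symmetryFlow_two ht hh (by omega)
    · exact hτ.symmetryFlow_three ht hloc hh (by omega)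
    · exact hτ.symmetryFlow_four ht hloc hh (by omega)
    · exact hτ.symmetryFlow_five ht hloc hh (by omega)

end PointSymmetriesGeneral

/-! ### The inverse of $\partial_{\lambda^N}$ as an asymptotic path integral -/

section PathIntegral

open Finset (Icc range)

/-- If `φ' ≤ -κ s ^ m` for large `s`, then `∫_r^∞ exp(φ) s ^ m` is bounded by a multiple of
`exp(φ(r))`. -/
lemma integral_exp_mul_pow_le {φ φ' : ℝ → ℝ} {κ R : ℝ} {m : ℕ} (hκ : 0 < κ) (hR : 1 ≤ R)
    (hd : ∀ s, R ≤ s → HasDerivAt φ (φ' s) s) (hle : ∀ s, R ≤ s → φ' s ≤ -κ * s ^ m) :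
    Tendsto φ atTop atBot ∧ ∀ r, R ≤ r →
      IntegrableOn (fun s => Real.exp (φ s) * s ^ m) (Set.Ioi r) ∧
      ∫ s in Set.Ioi r, Real.exp (φ s) * s ^ m ≤ κ⁻¹ * Real.exp (φ r) := by
  have hle' : ∀ s, R ≤ s → φ' s ≤ -κ := fun s hs => by
    have : 1 ≤ s ^ m := one_le_pow₀ (hR.trans hs)
    nlinarith [hle s hs]
  have hlim : Tendsto φ atTop atBot := by
    have hlin : Tendsto (fun s : ℝ => φ R + -κ * (s - R)) atTop atBot :=
      tendsto_atBot_add_const_left _ _ <|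
        (tendsto_atTop_add_const_right _ (-R) tendsto_id).const_mul_atTop_of_neg
          (neg_lt_zero.2 hκ)
    refine tendsto_atBot_mono' _ ?_ hlin
    filter_upwards [eventually_ge_atTop R] with s hs
    have := (convex_Ici R).image_sub_le_mul_sub_of_deriv_le (f := φ) (C := -κ)
      (fun x hx => (hd x hx).continuousAt.continuousWithinAt)
      (fun x hx => (hd x (interior_subset hx)).differentiableAt.differentiableWithinAt)
      (fun x hx => by
        rw [(hd x (interior_subset hx)).deriv]
        exact hle' x (interior_subset hx)) R (Set.mem_Ici.2 le_rfl) s hs hs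
    linarith
  refine ⟨hlim, fun r hr => ?_⟩
  have hexp : ∀ s, R ≤ s →
      HasDerivAt (fun s => Real.exp (φ s)) (Real.exp (φ s) * φ' s) s := fun s hs => (hd s hs).exp
  have hnonpos : ∀ s ∈ Set.Ioi r, Real.exp (φ s) * φ' s ≤ 0 := fun s hs =>
    mul_nonpos_of_nonneg_of_nonpos (Real.exp_pos _).le
      ((hle' s (hr.trans (le_of_lt hs))).trans (neg_nonpos.2 hκ.le))
  have hlim' : Tendsto (fun s => Real.exp (φ s)) atTop (𝓝 0) :=
    Real.tendsto_exp_atBot.comp hlim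
  have hint : IntegrableOn (fun s => Real.exp (φ s) * φ' s) (Set.Ioi r) :=
    integrableOn_Ioi_deriv_of_nonpos (hexp r hr).continuousAt.continuousWithinAt
      (fun s hs => hexp s (hr.trans (le_of_lt hs))) hnonpos hlim'
  have hval : ∫ s in Set.Ioi r, Real.exp (φ s) * φ' s = 0 - Real.exp (φ r) :=
    integral_Ioi_of_hasDerivAt_of_nonpos (hexp r hr).continuousAt.continuousWithinAt
      (fun s hs => hexp s (hr.trans (le_of_lt hs))) hnonpos hlim'
  have hbound : ∀ s ∈ Set.Ioi r,
      Real.exp (φ s) * s ^ m ≤ -κ⁻¹ * (Real.exp (φ s) * φ' s) := fun s hs => by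
    have h1 := hle s (hr.trans (le_of_lt hs))
    have h2 : s ^ m ≤ -κ⁻¹ * φ' s := by
      have := mul_le_mul_of_nonneg_left h1 (inv_nonneg.2 hκ.le)
      field_simp at this ⊢
      linarith
    calc Real.exp (φ s) * s ^ m ≤ Real.exp (φ s) * (-κ⁻¹ * φ' s) :=
          mul_le_mul_of_nonneg_left h2 (Real.exp_pos _).le
      _ = _ := by ring
  have hint' : IntegrableOn (fun s => Real.exp (φ s) * s ^ m) (Set.Ioi r) := by
    refine (hint.const_mul (-κ⁻¹)).mono' ?_ ?_
    · refine ContinuousOn.aestronglyMeasurable (fun s hs => ContinuousAt.continuousWithinAt ?_)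
        measurableSet_Ioi
      exact (hexp s (hr.trans (le_of_lt hs))).continuousAt.mul (by fun_prop)
    · refine (ae_restrict_iff' measurableSet_Ioi).2 (Eventually.of_forall fun s hs => ?_)
      have : 0 ≤ s := by linarith [Set.mem_Ioi.1 hs]
      rw [Real.norm_of_nonneg (by positivity)]
      exact hbound s hs
  refine ⟨hint', (setIntegral_mono_on hint' (hint.const_mul _) measurableSet_Ioi hbound).trans ?_⟩
  rw [integral_const_mul, hval]
  linarith

variable (N : ℕ) (t : Times) (u : ℂ)

/-- The logarithm of `exp(ζ(λ, t))` along the ray `λ = s u`. -/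
def rayExponent (s : ℝ) : ℂ :=
  (Real.log s + Complex.log u) * t 0 + ∑ k ∈ Icc 1 N, t k * (s * u) ^ k

/-- The derivative of `rayExponent`. -/
def rayExponentDeriv (s : ℝ) : ℂ :=
  t 0 / s + ∑ k ∈ Icc 1 N, k * t k * (s * u) ^ (k - 1) * u

variable {N t u}

lemma expZeta_ofReal_mul (hu : u ≠ 0) {s : ℝ} (hs : 0 < s) :
    expZeta N t (s * u) = Complex.exp (rayExponent N t u s) := by
  have : (s : ℂ) * u ≠ 0 := mul_ne_zero (Complex.ofReal_ne_zero.2 hs.ne') hu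
  rw [expZeta, rayExponent, Complex.exp_add, Complex.cpow_def_of_ne_zero this,
    Complex.log_ofReal_mul hs hu]

lemma hasDerivAt_rayExponent {s : ℝ} (hs : 0 < s) :
    HasDerivAt (rayExponent N t u) (rayExponentDeriv N t u s) s := by
  have h1 : HasDerivAt (fun s : ℝ => (Real.log s + Complex.log u) * t 0) (t 0 / s) s := by
    refine ((((Real.hasDerivAt_log hs.ne').ofReal_comp).add_const (Complex.log u)).mul_const
      (t 0)).congr_deriv ?_
    rw [Complex.ofReal_inv, div_eq_mul_inv, mul_comm]
  have h2 : HasDerivAt (fun s : ℝ => (s : ℂ) * u) u s := by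
    simpa using (hasDerivAt_id s).ofReal_comp.mul_const u
  refine h1.add (HasDerivAt.fun_sum fun k _ => ?_)
  refine ((h2.fun_pow k).const_mul (t k)).congr_deriv ?_
  ring

/-- Divided by $s^{N-1}$ the derivative tends to $Nt_Nu^N$, whose real part is negative; half of
that value serves as the bound for large $s$. -/
lemma exists_re_rayExponentDeriv_le (hN : 1 ≤ N) (htu : (t N * u ^ N).re < 0) :
    ∃ κ > 0, ∃ R, 1 ≤ R ∧ ∀ s : ℝ, R ≤ s →
      (rayExponentDeriv N t u s).re ≤ -κ * s ^ (N - 1) := by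
  have hlim : Tendsto (fun s : ℝ => rayExponentDeriv N t u s * (s : ℂ)⁻¹ ^ (N - 1)) atTop
      (𝓝 (N * (t N * u ^ N))) := by
    have hinv : Tendsto (fun s : ℝ => (s : ℂ)⁻¹) atTop (𝓝 0) := by
      have := (Complex.continuous_ofReal.tendsto 0).comp tendsto_inv_atTop_zero
      simpa [Function.comp_def] using this
    have hmain : Tendsto (fun s : ℝ => t 0 * (s : ℂ)⁻¹ ^ N +
        ∑ k ∈ Icc 1 N, k * t k * u ^ k * (s : ℂ)⁻¹ ^ (N - k)) atTop
        (𝓝 (t 0 * 0 ^ N + ∑ k ∈ Icc 1 N, k * t k * u ^ k * 0 ^ (N - k))) :=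
      ((hinv.pow N).const_mul _).add
        (tendsto_finsetSum _ fun k _ => (hinv.pow (N - k)).const_mul _)
    have hval : t 0 * 0 ^ N + ∑ k ∈ Icc 1 N, k * t k * u ^ k * 0 ^ (N - k) =
        N * (t N * u ^ N) := by
      rw [Finset.sum_eq_single_of_mem N (Finset.mem_Icc.2 ⟨hN, le_rfl⟩), zero_pow (by omega)]
      · simp; ring
      · intro k hk hkN
        rw [zero_pow (by have := (Finset.mem_Icc.1 hk).2; omega), mul_zero]
    rw [hval] at hmain
    refine hmain.congr' ?_
    filter_upwards [eventually_gt_atTop 0] with s hs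
    have hs' : (s : ℂ) ≠ 0 := Complex.ofReal_ne_zero.2 hs.ne'
    rw [rayExponentDeriv, add_mul, Finset.sum_mul]
    congr 1
    · obtain ⟨M, rfl⟩ := Nat.exists_eq_add_of_le' hN
      rw [Nat.add_sub_cancel, pow_succ]
      ring
    · refine Finset.sum_congr rfl fun k hk => ?_
      obtain ⟨hk1, hk2⟩ := Finset.mem_Icc.1 hk
      obtain ⟨j, rfl⟩ := Nat.exists_eq_add_of_le' hk1
      obtain ⟨M, rfl⟩ := Nat.exists_eq_add_of_le hk2
      rw [show j + 1 + M - (j + 1) = M by omega, show j + 1 + M - 1 = j + M by omega,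
        Nat.add_sub_cancel, mul_pow, pow_add, pow_succ]
      have : (s : ℂ) ^ j * (s : ℂ)⁻¹ ^ j = 1 := by
        rw [← mul_pow, mul_inv_cancel₀ hs', one_pow]
      linear_combination (-(((j + 1 : ℕ) : ℂ) * t (j + 1) * u ^ j * u * (s : ℂ)⁻¹ ^ M)) * this
  set c : ℝ := (N * (t N * u ^ N) : ℂ).re with hc
  have hcneg : c < 0 := by
    rw [hc, ← Complex.ofReal_natCast, Complex.re_ofReal_mul]
    exact mul_neg_of_pos_of_neg (by exact_mod_cast hN) htu
  have hev : ∀ᶠ s : ℝ in atTop,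
      (rayExponentDeriv N t u s * (s : ℂ)⁻¹ ^ (N - 1)).re < c / 2 :=
    ((Complex.continuous_re.tendsto _).comp hlim).eventually_lt_const (by linarith)
  obtain ⟨R, hR⟩ := eventually_atTop.1 hev
  refine ⟨-(c / 2), by linarith, max R 1, le_max_right _ _, fun s hs => ?_⟩
  have hs0 : 0 < s := zero_lt_one.trans_le ((le_max_right _ _).trans hs)
  have h1 := hR s ((le_max_left _ _).trans hs)
  rw [← Complex.ofReal_inv, ← Complex.ofReal_pow, Complex.re_mul_ofReal, inv_pow,
    ← div_eq_mul_inv, div_lt_iff₀ (pow_pos hs0 _)] at h1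
  linarith

/-- `dE` on polynomials in `λ⁻¹`. -/
def dEPoly (N : ℕ) (t : Times) (p : Polynomial ℂ) : Polynomial ℂ :=
  Polynomial.C (N : ℂ)⁻¹ * ((∑ k ∈ Icc 1 N, Polynomial.C (k * t k) * Polynomial.X ^ (N - k) +
    Polynomial.C (t 0) * Polynomial.X ^ N) * p -
      Polynomial.X ^ (N + 1) * Polynomial.derivative p)

lemma coe_dEPoly (p : Polynomial ℂ) : (dEPoly N t p : ℂ⟦X⟧) = dE N t p := by
  have hsum : ((∑ k ∈ Icc 1 N, Polynomial.C (k * t k) * Polynomial.X ^ (N - k) :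
      Polynomial ℂ) : ℂ⟦X⟧) = ∑ k ∈ Icc 1 N, C (k * t k) * X ^ (N - k) := by
    rw [← Polynomial.coeToPowerSeries.ringHom_apply, map_sum]
    refine Finset.sum_congr rfl fun k _ => ?_
    rw [Polynomial.coeToPowerSeries.ringHom_apply, Polynomial.coe_mul, Polynomial.coe_C,
      Polynomial.coe_pow, Polynomial.coe_X]
  have hsub (a b : Polynomial ℂ) : ((a - b : Polynomial ℂ) : ℂ⟦X⟧) = a - b :=
    map_sub Polynomial.coeToPowerSeries.ringHom a b
  simp only [dEPoly, Polynomial.coe_mul, Polynomial.coe_C, hsub, Polynomial.coe_add, hsum,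
    Polynomial.coe_pow, Polynomial.coe_X, dE, LinearMap.smul_apply, LinearMap.sub_apply,
    LinearMap.mulLeft_apply, LinearMap.comp_apply, smul_eq_C_mul]
  rw [← derivative_coe]
  rfl

lemma truncVal_eq_eval (M : ℕ) (A : ℂ⟦X⟧) (l : ℂ) :
    truncVal M A l = (trunc (M + 1) A).eval l⁻¹ := by
  rw [truncVal, ← Polynomial.eval₂_id, eval₂_trunc_eq_sum_range]
  rfl

/-- `d/dλ (exp(ζ) p) = exp(ζ) (dEPoly N t p) dE/dλ` along a ray. -/
lemma hasDerivAt_exp_rayExponent_mul_eval (hN : 1 ≤ N) (hu : u ≠ 0) (p : Polynomial ℂ) {s : ℝ}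
    (hs : 0 < s) :
    HasDerivAt (fun s : ℝ => Complex.exp (rayExponent N t u s) * p.eval (s * u : ℂ)⁻¹)
      (Complex.exp (rayExponent N t u s) * (dEPoly N t p).eval (s * u : ℂ)⁻¹ *
        (N * (s * u) ^ (N - 1) * u)) s := by
  have hs' : (s : ℂ) ≠ 0 := Complex.ofReal_ne_zero.2 hs.ne'
  have hsu : (s : ℂ) * u ≠ 0 := mul_ne_zero hs' hu
  have hN' : (N : ℂ) ≠ 0 := Nat.cast_ne_zero.2 (by omega)
  have h2 : HasDerivAt (fun s : ℝ => (s : ℂ) * u) u s := by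
    simpa using (hasDerivAt_id s).ofReal_comp.mul_const u
  have h3 := (p.hasDerivAt (s * u : ℂ)⁻¹).comp s (h2.fun_inv hsu)
  refine ((hasDerivAt_rayExponent (N := N) (t := t) (u := u) hs).cexp.fun_mul h3).congr_deriv ?_
  have hsum : (∑ k ∈ Icc 1 N, k * t k * (s * u : ℂ)⁻¹ ^ (N - k)) * (s * u) ^ (N - 1) * u =
      ∑ k ∈ Icc 1 N, k * t k * (s * u) ^ (k - 1) * u := by
    rw [Finset.sum_mul, Finset.sum_mul]
    refine Finset.sum_congr rfl fun k hk => ?_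
    obtain ⟨hk1, hk2⟩ := Finset.mem_Icc.1 hk
    have hpow : (s * u : ℂ)⁻¹ ^ (N - k) * (s * u) ^ (N - 1) = (s * u) ^ (k - 1) := by
      rw [show N - 1 = (N - k) + (k - 1) by omega, pow_add, ← mul_assoc, ← mul_pow,
        inv_mul_cancel₀ hsu, one_pow, one_mul]
    linear_combination k * t k * u * hpow
  have hpow : (s * u : ℂ)⁻¹ ^ N * (s * u) ^ (N - 1) * u = 1 / s := by
    obtain ⟨m, rfl⟩ := Nat.exists_eq_add_of_le' hN
    rw [Nat.add_sub_cancel, pow_succ', mul_assoc _ _ ((s * u : ℂ) ^ m), ← mul_pow,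
      inv_mul_cancel₀ hsu, one_pow]
    field_simp
  have hpow' : (s * u : ℂ)⁻¹ ^ (N + 1) * (s * u) ^ (N - 1) * u = u / (s * u) ^ 2 := by
    rw [pow_succ', mul_assoc, mul_assoc, ← mul_assoc (_ ^ N), hpow]
    field_simp
  rw [rayExponentDeriv, ← hsum]
  simp only [dEPoly, Polynomial.eval_mul, Polynomial.eval_C, Polynomial.eval_sub,
    Polynomial.eval_add, Polynomial.eval_finsetSum, Polynomial.eval_pow, Polynomial.eval_X,
    Function.comp_apply]
  set E := Complex.exp (rayExponent N t u s)
  set P := Polynomial.eval (s * u : ℂ)⁻¹ p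
  set Q := Polynomial.eval (s * u : ℂ)⁻¹ (Polynomial.derivative p)
  set S := ∑ k ∈ Icc 1 N, k * t k * (s * u : ℂ)⁻¹ ^ (N - k)
  have hNN : (N : ℂ)⁻¹ * N = 1 := inv_mul_cancel₀ hN'
  linear_combination -E * ((S + t 0 * (s * u : ℂ)⁻¹ ^ N) * P - (s * u : ℂ)⁻¹ ^ (N + 1) * Q) *
    (s * u) ^ (N - 1) * u * hNN - E * t 0 * P * hpow + E * Q * hpow'

/-- `dE` of a truncated power series agrees with the truncation of `dE` up to higher order. -/
lemma exists_dEPoly_trunc_eq (hN : 1 ≤ N) (M : ℕ) (B : ℂ⟦X⟧) :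
    ∃ d : Polynomial ℂ, dEPoly N t (trunc M B) = trunc M (dE N t B) + Polynomial.X ^ M * d := by
  have hdvd : Polynomial.X ^ M ∣ dEPoly N t (trunc M B) - trunc M (dE N t B) := by
    rw [Polynomial.X_pow_dvd_iff]
    intro n hn
    have htr : ∀ j < n + 1, coeff j (trunc M B : ℂ⟦X⟧) = coeff j B := fun j hj => by
      rw [Polynomial.coeff_coe, coeff_trunc, if_pos (by omega)]
    rw [Polynomial.coeff_sub, coeff_trunc, if_pos hn, ← Polynomial.coeff_coe, coe_dEPoly, dE_eq,
      LinearMap.add_apply, LinearMap.add_apply, map_add, map_add,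
      (raisesOrder_dENil hN t).coeff_congr fun j hj => htr j (by omega)]
    simp [htr n (by omega)]
  obtain ⟨d, hd⟩ := hdvd
  exact ⟨d, by rw [← hd]; ring⟩

lemma exists_norm_eval_inv_le (hu : ‖u‖ = 1) (d : Polynomial ℂ) :
    ∃ K, 0 ≤ K ∧ ∀ s : ℝ, 1 ≤ s → ‖d.eval (s * u : ℂ)⁻¹‖ ≤ K := by
  obtain ⟨K, hK⟩ := (isCompact_closedBall (0 : ℂ) 1).exists_bound_of_continuousOn
    d.continuous.continuousOn
  refine ⟨K, (norm_nonneg _).trans (hK 0 (by simp)), fun s hs => hK _ ?_⟩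
  rw [mem_closedBall_zero_iff, norm_inv, norm_mul, hu, mul_one,
    Complex.norm_of_nonneg (by linarith)]
  exact inv_le_one_of_one_le₀ hs

/-- The integrals along a ray converge, and their tails have the order of the integrand at the
end point. -/
lemma integrableOn_exp_rayExponent (hN : 1 ≤ N) (hu : ‖u‖ = 1) (htu : (t N * u ^ N).re < 0) :
    Tendsto (fun s => (rayExponent N t u s).re) atTop atBot ∧
    (∀ d : Polynomial ℂ, ∀ r : ℝ, 0 < r → IntegrableOn (fun s : ℝ =>
      Complex.exp (rayExponent N t u s) * d.eval (s * u : ℂ)⁻¹ * (N * (s * u) ^ (N - 1) * u))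
        (Set.Ioi r)) ∧
    ∃ κ R : ℝ, 1 ≤ R ∧ ∀ r, R ≤ r →
      IntegrableOn (fun s => Real.exp (rayExponent N t u s).re * s ^ (N - 1)) (Set.Ioi r) ∧
      ∫ s in Set.Ioi r, Real.exp (rayExponent N t u s).re * s ^ (N - 1) ≤
        κ⁻¹ * Real.exp (rayExponent N t u r).re := by
  obtain ⟨κ, hκ, R, hR, hle⟩ := exists_re_rayExponentDeriv_le hN htu
  have hmain := integral_exp_mul_pow_le (φ := fun s => (rayExponent N t u s).re) hκ hR
    (fun s hs => (Complex.reCLM.hasFDerivAt.comp_hasDerivAt s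
      (hasDerivAt_rayExponent (zero_lt_one.trans_le (hR.trans hs))) :)) hle
  refine ⟨hmain.1, fun d r hr => ?_, κ, R, hR, hmain.2⟩
  have hu0 : u ≠ 0 := norm_ne_zero_iff.1 (by rw [hu]; exact one_ne_zero)
  have hcont : ContinuousOn (fun s : ℝ => Complex.exp (rayExponent N t u s) *
      d.eval (s * u : ℂ)⁻¹ * (N * (s * u) ^ (N - 1) * u)) (Set.Ioi 0) := by
    intro s hs
    have hsu : (s : ℂ) * u ≠ 0 := mul_ne_zero (Complex.ofReal_ne_zero.2 (ne_of_gt hs)) hu0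
    have h1 : ContinuousAt (fun s : ℝ => (s : ℂ) * u) s := by fun_prop
    exact (((hasDerivAt_rayExponent hs).continuousAt.cexp.mul
      (d.continuous.continuousAt.comp (h1.inv₀ hsu))).mul
        (by fun_prop)).continuousWithinAt
  obtain ⟨K, hK0, hK⟩ := exists_norm_eval_inv_le hu d
  have htail : IntegrableOn (fun s : ℝ => Complex.exp (rayExponent N t u s) *
      d.eval (s * u : ℂ)⁻¹ * (N * (s * u) ^ (N - 1) * u)) (Set.Ioi (max r R)) := by
    refine ((hmain.2 _ (le_max_right r R)).1.const_mul (K * N)).mono'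
      ((hcont.mono (Set.Ioi_subset_Ioi (hr.le.trans (le_max_left _ _)))).aestronglyMeasurable
        measurableSet_Ioi) ((ae_restrict_iff' measurableSet_Ioi).2 (Eventually.of_forall ?_))
    intro s hs
    have hs1 : 1 ≤ s := hR.trans ((le_max_right r R).trans (le_of_lt hs))
    rw [norm_mul, norm_mul, norm_mul, norm_mul, norm_pow, norm_mul, hu, Complex.norm_exp,
      Complex.norm_natCast, Complex.norm_of_nonneg (by linarith), mul_one, mul_one]
    have := mul_le_mul_of_nonneg_left (hK s hs1)
      (show 0 ≤ Real.exp (rayExponent N t u s).re * (N * s ^ (N - 1)) by positivity)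
    linarith
  -- Decay controls only the part beyond $R$; up to there the integrand is continuous on a compact
  -- interval away from $0$.
  rw [← Set.Ioc_union_Ioi_eq_Ioi (le_max_left r R)]
  refine IntegrableOn.union ?_ htail
  exact ((hcont.mono fun s hs => hr.trans_le hs.1).integrableOn_Icc).mono_set
    Set.Ioc_subset_Icc_self

/-- The asymptotic expansion of the path integral is inverse to `∂_E`. -/
theorem isPathIntegral_of_dE_eq (hN : 1 ≤ N) {A B : ℂ⟦X⟧} (h : dE N t B = A) :
    IsPathIntegral N t A B := by
  intro u hu htu M
  have hu0 : u ≠ 0 := norm_ne_zero_iff.1 (by rw [hu]; exact one_ne_zero)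
  obtain ⟨hlim, hint, κ, R, hR, htail⟩ := integrableOn_exp_rayExponent hN hu htu
  have hcongr : ∀ r : ℝ, 0 < r → Set.EqOn (fun s : ℝ => expZeta N t (s * u) *
      truncVal M A (s * u) * (N * (s * u) ^ (N - 1) * u)) (fun s : ℝ =>
      Complex.exp (rayExponent N t u s) * (trunc (M + 1) A).eval (s * u : ℂ)⁻¹ *
        (N * (s * u) ^ (N - 1) * u)) (Set.Ioi r) := fun r hr s hs => by
    simp only [expZeta_ofReal_mul hu0 (hr.trans hs), truncVal_eq_eval]
  refine ⟨fun r hr => (hint _ r hr).congr_fun (hcongr r hr).symm measurableSet_Ioi, ?_⟩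
  -- The truncation of $B$ is an exact antiderivative of the truncation of $A$ up to an error
  -- divisible by $\lambda^{-(M+1)}$, where `trunc (M + 1)` keeps the terms through order $M$.
  obtain ⟨d, hd⟩ := exists_dEPoly_trunc_eq (t := t) hN (M + 1) B
  rw [h] at hd
  obtain ⟨K, hK0, hK⟩ := exists_norm_eval_inv_le hu d
  obtain ⟨K', hK'0, hK'⟩ := exists_norm_eval_inv_le hu (trunc (M + 1) B)
  have hFTC : ∀ r : ℝ, 0 < r → ∫ s in Set.Ioi r, Complex.exp (rayExponent N t u s) *
      (dEPoly N t (trunc (M + 1) B)).eval (s * u : ℂ)⁻¹ * (N * (s * u) ^ (N - 1) * u) =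
      0 - Complex.exp (rayExponent N t u r) * (trunc (M + 1) B).eval (r * u : ℂ)⁻¹ := by
    intro r hr
    refine integral_Ioi_of_hasDerivAt_of_tendsto
      (hasDerivAt_exp_rayExponent_mul_eval hN hu0 _ hr).continuousAt.continuousWithinAt
      (fun s hs => hasDerivAt_exp_rayExponent_mul_eval hN hu0 _ (hr.trans hs)) (hint _ r hr) ?_
    have h0 : Tendsto (fun s => Real.exp (rayExponent N t u s).re * K') atTop (𝓝 0) := by
      simpa using (Real.tendsto_exp_atBot.comp hlim).mul_const K'
    refine squeeze_zero_norm' ?_ h0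
    filter_upwards [eventually_ge_atTop 1] with s hs
    rw [norm_mul, Complex.norm_exp]
    exact mul_le_mul_of_nonneg_left (hK' s hs) (Real.exp_pos _).le
  refine Asymptotics.IsBigO.of_bound (K * N * κ⁻¹) ?_
  filter_upwards [eventually_ge_atTop R] with r hr
  have hr0 : 0 < r := zero_lt_one.trans_le (hR.trans hr)
  have hne := Complex.exp_ne_zero (rayExponent N t u r)
  have hsplit : ∫ s in Set.Ioi r, Complex.exp (rayExponent N t u s) *
      (trunc (M + 1) A).eval (s * u : ℂ)⁻¹ * (N * (s * u) ^ (N - 1) * u) =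
      -(Complex.exp (rayExponent N t u r) * (trunc (M + 1) B).eval (r * u : ℂ)⁻¹) -
      ∫ s in Set.Ioi r, Complex.exp (rayExponent N t u s) *
        (Polynomial.X ^ (M + 1) * d).eval (s * u : ℂ)⁻¹ * (N * (s * u) ^ (N - 1) * u) := by
    rw [← zero_sub, ← hFTC r hr0, ← integral_sub (hint _ r hr0) (hint _ r hr0)]
    congr 1
    funext s
    rw [hd, Polynomial.eval_add]
    ring
  rw [setIntegral_congr_fun measurableSet_Ioi (hcongr r hr0), hsplit,
    expZeta_ofReal_mul hu0 hr0, truncVal_eq_eval]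
  set I := ∫ s in Set.Ioi r, Complex.exp (rayExponent N t u s) *
    (Polynomial.X ^ (M + 1) * d).eval (s * u : ℂ)⁻¹ * (N * (s * u) ^ (N - 1) * u) with hI
  have hval : -(-(Complex.exp (rayExponent N t u r) * (trunc (M + 1) B).eval (r * u : ℂ)⁻¹) - I) /
      Complex.exp (rayExponent N t u r) - (trunc (M + 1) B).eval (r * u : ℂ)⁻¹ =
      I / Complex.exp (rayExponent N t u r) := by
    field_simp
    ring
  -- On the tail $s\ge r$ the error factor $s^{-(M+1)}$ is at most $r^{-(M+1)}$; what remains is the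
  -- integral bounded by the exponential at the end point.
  have hIle : ‖I‖ ≤ K * N * r⁻¹ ^ (M + 1) * (κ⁻¹ * Real.exp (rayExponent N t u r).re) := by
    refine le_trans ?_ (mul_le_mul_of_nonneg_left (htail r hr).2 (by positivity))
    rw [← integral_const_mul]
    refine norm_integral_le_of_norm_le ((htail r hr).1.const_mul _)
      ((ae_restrict_iff' measurableSet_Ioi).2 (Eventually.of_forall fun s hs => ?_))
    have hrs : r ≤ s := le_of_lt hs
    have hs1 : 1 ≤ s := hR.trans (hr.trans hrs)
    rw [Polynomial.eval_mul, Polynomial.eval_pow, Polynomial.eval_X, norm_mul, norm_mul, norm_mul,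
      norm_mul, norm_mul, norm_pow, norm_pow, norm_inv, norm_mul, hu, Complex.norm_exp,
      Complex.norm_natCast, Complex.norm_of_nonneg (by linarith), mul_one, mul_one]
    have h1 : s⁻¹ ^ (M + 1) ≤ r⁻¹ ^ (M + 1) :=
      pow_le_pow_left₀ (by positivity) (inv_anti₀ hr0 hrs) _
    have h2 := mul_le_mul h1 (hK s hs1) (norm_nonneg _) (by positivity)
    have := mul_le_mul_of_nonneg_left h2
      (show 0 ≤ Real.exp (rayExponent N t u s).re * (N * s ^ (N - 1)) by positivity)
    linarith
  rw [hval, norm_div, Complex.norm_exp, div_le_iff₀ (Real.exp_pos _),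
    Real.norm_of_nonneg (by positivity)]
  linarith

end PathIntegral

end

end KP

open KP PowerSeries in
theorem theorem5 (N : ℕ) (hN : 1 ≤ N) (α : ℤ)
    (hα : α = N ∨ α = 2 ∨ α = 1 ∨ α = 0 ∨ α = -1) (hαN : α ≤ N)
    (U : Set Times) (τ : Times → ℂ) (hτ : IsTau U τ) (h : ℤ → ℂ)
    (t : Times) (ht : t ∈ U)
    (hloc : ∀ k : ℕ, k ≠ 0 → k ≠ 1 → k ≠ 2 → k ≠ N → t k = 0)
    (hloc' : ∀ k : ℕ, N < k → t k = 0)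
    (hh : ConvergesAround h (t N)) :
    -- the inverse of `∂_{λ ^ N}` is the path integral from infinity
    (t N ≠ 0 → IsUnit (dE N t) ∧ ∀ A : ℂ⟦X⟧, IsPathIntegral N t A (dEpow N t (-1) A)) ∧
    -- the series `h(∂_{λ ^ N})` converge on `X(λ) X*(μ) τ` and on `φ(λ)`
    (∀ (n : ℕ) (m : ℤ), Summable fun j : ℤ => h j * coeff n (dEpow N t j (vertexSeries τ m t))) ∧
    (∀ n : ℕ, Summable fun j : ℤ => h j * coeff n (dEpow N t j (waveSeries τ t))) ∧
    (∀ i m : ℤ, LineDifferentiableAt ℂ (fun s => tauAction h N τ i m s / τ s) t (e 1)) ∧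
    -- the induced variation of `w` is `2 [h(∂_{λ ^ N}) φ(λ)] φ*(μ)`, so one can put `μ = λ`
    (∀ i m : ℤ, fieldAction h N τ i m t =
      2 * hApply h N t (waveSeries τ t) i * waveStar τ m t) ∧
    -- the induced flow of `w` is the symmetry `V^N(α, h)`, which is the point symmetry
    inducedFlow h N α τ t = symmetryFlow h N α τ t ∧
    inducedFlow h N α τ t =
      pointFlow N
        (pointField N α (t 0) (t 1) (t 2) (field τ t)
          (fun k => iteratedDeriv k (laurentFun h) (t N)))
        (field τ) t := by
  have hflow := hτ.inducedFlow_eq ht hN hh α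
  refine ⟨fun htN => ⟨isUnit_dE hN htN, fun A =>
      isPathIntegral_of_dE_eq hN (mul_dEpow_neg_one hN htN A)⟩,
    fun n m => hh.summable_coeff_dEpow hN n _, fun n => hh.summable_coeff_dEpow hN n _,
    fun i m => (hτ.hasLineDerivAt_tauAction ht hN hh i m).lineDifferentiableAt,
    fun i m => hτ.fieldAction_eq ht hN hh i m, hflow, ?_⟩
  rw [hflow]
  exact hτ.symmetryFlow_eq_pointFlow ht hN hloc hh hα hαN
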